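/- Let $\Omega\subset\mathbb{R}^3$ be a bounded domain with analytic boundary $\Gamma=\partial\Omega$ that is star-shaped with respect to a ball, and let $V=H^1(\Omega)$ (complex valued) with trace operator $\gamma_0:V\to L^2(\Gamma)$. Write $(\cdot,\cdot)$ and $(\cdot,\cdot)_\Gamma$ for the $L^2(\Omega)$ and $L^2(\Gamma)$ scalar products (conjugate linear in the second argument) and $\|\cdot\|$ for the $L^2(\Omega)$ norm. For $\zeta\in\mathbb{C}$ with $\operatorname{Re}\zeta\ge 0$ and $|\zeta|\ge 1$ put $$a_\zeta(u,v)=(\nabla u,\nabla v)+\zeta^2(u,v)+\zeta(\gamma_0u,\gamma_0v)_\Gamma,\qquad \|u\|_{|\zeta|}=\bigl(\|\nabla u\|^2+|\zeta|^2\|u\|^2\bigr)^{1/2}\qquad(u,v\in V).$$ There is a constant $C_b\ge 0$, independent of $\zeta$, such that $$|a_\zeta(u,v)|\le(1+C_b)\,\|u\|_{|\zeta|}\|v\|_{|\zeta|}\qquad\text{for all }u,v\in V\text{ and all }\zeta\text{ with }\operatorname{Re}\zeta\ge0,\ |\zeta|\ge1. \tag{1}$$ Let $C_b$ be any real constant for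 which (1) holds. Let $\operatorname{Re}\zeta\ge0$ and $|\zeta|\ge1$, let $S\subset V$ be a closed subspace, let $\tilde S_\zeta f\in V$ denote, for $f\in L^2(\Omega)$, the solution $z$ of the adjoint problem $a_{\overline\zeta}(z,w)=(f,w)$ for all $w\in V$, and let $$\eta(S)=\sup_{f\in L^2(\Omega)\setminus\{0\}}\ \inf_{v\in S}\frac{\|\tilde S_\zeta f-v\|_{|\zeta|}}{\|f\|}.$$ If $$\frac{(\operatorname{Im}\zeta)^2}{|\zeta|}\,\eta(S)\le\frac{1}{4(1+C_b)},$$ then for every $u\in V$ there is a unique $u_S\in S$ with $a_\zeta(u-u_S,v)=0$ for all $v\in S$, and $$\|u-u_S\|_{|\zeta|}\le 2(1+C_b)\inf_{v\in S}\|u-v\|_{|\zeta|},\qquad \|u-u_S\|\le(1+C_b)\,\eta(S)\,\|u-u_S\|_{|\zeta|}.$$ In particular the constants do not degenerate as $\operatorname{Re}\zeta\to0$. -/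

import Mathlib

open MeasureTheory Set Filter Topology
open scoped ENNReal ContDiff ComplexConjugate

namespace HelmholtzRobin

/-- Euclidean three-space. -/
abbrev E3 : Type := EuclideanSpace ℝ (Fin 3)

/-- `Ω` has an analytic boundary: near each boundary point, `Ω` is the set where some real-analytic
function with nonvanishing derivative is negative. -/
def HasAnalyticBoundary (Ω : Set E3) : Prop :=
  ∀ x ∈ frontier Ω, ∃ (U : Set E3) (ρ : E3 → ℝ), IsOpen U ∧ x ∈ U ∧ AnalyticOnNhd ℝ ρ U ∧
    (∀ y ∈ U, fderiv ℝ ρ y ≠ 0) ∧ Ω ∩ U = {y ∈ U | ρ y < 0}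

/-- `Ω` is star-shaped with respect to some ball of positive radius. -/
def StarShapedWrtBall (Ω : Set E3) : Prop :=
  ∃ (x₀ : E3) (r : ℝ), 0 < r ∧ ∀ y ∈ Metric.ball x₀ r, StarConvex ℝ y Ω

/-- Bounded domain with analytic boundary that is star-shaped with respect to a ball. -/
structure IsAdmissibleDomain (Ω : Set E3) : Prop where
  isOpen : IsOpen Ω
  isConnected : IsConnected Ω
  isBounded : Bornology.IsBounded Ω
  analyticBoundary : HasAnalyticBoundary Ω
  starShaped : StarShapedWrtBall Ω

/-- `L²(Ω)`, complex valued. -/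
abbrev L2 (Ω : Set E3) : Type := Lp ℂ 2 (volume.restrict Ω)

/-- `L²(Ω; ℂ³)`. -/
abbrev L2Vec (Ω : Set E3) : Type := Lp (EuclideanSpace ℂ (Fin 3)) 2 (volume.restrict Ω)

/-- Surface measure on the boundary `Γ = ∂Ω`: two-dimensional Hausdorff measure, normalised so that
it is Lebesgue measure on planes. -/
noncomputable def surfaceMeasure (Ω : Set E3) : Measure E3 :=
  (Measure.euclideanHausdorffMeasure 2 : Measure E3).restrict (frontier Ω)

/-- `L²(Γ)`, complex valued. -/
abbrev L2Bdry (Ω : Set E3) : Type := Lp ℂ 2 (surfaceMeasure Ω)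

/-- `g` is the weak gradient of `u` in `Ω`. -/
def IsWeakGrad (Ω : Set E3) (u : E3 → ℂ) (g : E3 → EuclideanSpace ℂ (Fin 3)) : Prop :=
  ∀ φ : E3 → ℝ, ContDiff ℝ ∞ φ → HasCompactSupport φ → tsupport φ ⊆ Ω → ∀ i : Fin 3,
    ∫ x in Ω, (fderiv ℝ φ x (EuclideanSpace.single i (1 : ℝ))) • u x = -∫ x in Ω, φ x • g x i

theorem integrable_testFun_smul {Ω : Set E3} {ψ : E3 → ℝ} (hψ : Continuous ψ)
    (hc : HasCompactSupport ψ) {u : E3 → ℂ} (hu : MemLp u 2 (volume.restrict Ω)) :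
    Integrable (fun x => ψ x • u x) (volume.restrict Ω) := by
  have h : MemLp ψ 2 (volume.restrict Ω) := hψ.memLp_of_hasCompactSupport hc
  exact memLp_one_iff_integrable.1 (hu.smul (p := 2) (q := 2) (r := 1) h)

theorem memLp_coord {Ω : Set E3} {g : E3 → EuclideanSpace ℂ (Fin 3)}
    (hg : MemLp g 2 (volume.restrict Ω)) (i : Fin 3) :
    MemLp (fun x => g x i) 2 (volume.restrict Ω) :=
  hg.continuousLinearMap_comp (EuclideanSpace.proj (𝕜 := ℂ) i)

theorem integrable_deriv_smul {Ω : Set E3} {φ : E3 → ℝ} (hφ : ContDiff ℝ ∞ φ)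
    (hc : HasCompactSupport φ) (i : Fin 3) {u : E3 → ℂ} (hu : MemLp u 2 (volume.restrict Ω)) :
    Integrable (fun x => (fderiv ℝ φ x (EuclideanSpace.single i (1 : ℝ))) • u x)
      (volume.restrict Ω) := by
  refine integrable_testFun_smul
    (ψ := fun x => fderiv ℝ φ x (EuclideanSpace.single i (1 : ℝ))) ?_ ?_ hu
  · exact (hφ.continuous_fderiv (by simp)).clm_apply continuous_const
  · exact hc.fderiv_apply ℝ _

/-- The Sobolev space `H¹(Ω)`, realised as the space of pairs `(u, ∇u)` of an `L²` function and its
weak gradient in `L²`; the norm is the usual `H¹` norm `(‖u‖² + ‖∇u‖²)^(1/2)`. -/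
def H1 (Ω : Set E3) : Submodule ℂ (WithLp 2 (L2 Ω × L2Vec Ω)) where
  carrier := {p | IsWeakGrad Ω p.fst p.snd}
  zero_mem' := by
    intro φ _ _ _ i
    have h1 : ∫ x in Ω, (fderiv ℝ φ x (EuclideanSpace.single i (1 : ℝ))) •
        (0 : WithLp 2 (L2 Ω × L2Vec Ω)).fst x = 0 := by
      refine integral_eq_zero_of_ae ?_
      filter_upwards [Lp.coeFn_zero ℂ 2 (volume.restrict Ω)] with x hx
      rw [WithLp.zero_fst, hx, Pi.zero_apply, smul_zero]
    have h2 : ∫ x in Ω, φ x • (0 : WithLp 2 (L2 Ω × L2Vec Ω)).snd x i = 0 := by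
      refine integral_eq_zero_of_ae ?_
      filter_upwards [Lp.coeFn_zero (EuclideanSpace ℂ (Fin 3)) 2 (volume.restrict Ω)] with x hx
      rw [WithLp.zero_snd, hx, Pi.zero_apply, PiLp.zero_apply, smul_zero, Pi.zero_apply]
    rw [h1, h2, neg_zero]
  add_mem' := by
    intro p q hp hq φ hφ hc hs i
    have e1 : ∫ x in Ω, (fderiv ℝ φ x (EuclideanSpace.single i (1 : ℝ))) • (p + q).fst x =
        ∫ x in Ω, ((fderiv ℝ φ x (EuclideanSpace.single i (1 : ℝ))) • p.fst x +
          (fderiv ℝ φ x (EuclideanSpace.single i (1 : ℝ))) • q.fst x) := by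
      refine integral_congr_ae ?_
      filter_upwards [Lp.coeFn_add p.fst q.fst] with x hx
      rw [WithLp.add_fst, hx, Pi.add_apply, smul_add]
    have e2 : ∫ x in Ω, φ x • (p + q).snd x i =
        ∫ x in Ω, (φ x • p.snd x i + φ x • q.snd x i) := by
      refine integral_congr_ae ?_
      filter_upwards [Lp.coeFn_add p.snd q.snd] with x hx
      rw [WithLp.add_snd, hx, Pi.add_apply, PiLp.add_apply, smul_add]
    rw [e1, e2, integral_add (integrable_deriv_smul hφ hc i (Lp.memLp _))
      (integrable_deriv_smul hφ hc i (Lp.memLp _)),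
      integral_add (integrable_testFun_smul hφ.continuous hc (memLp_coord (Lp.memLp _) i))
      (integrable_testFun_smul hφ.continuous hc (memLp_coord (Lp.memLp _) i)),
      hp φ hφ hc hs i, hq φ hφ hc hs i, neg_add]
  smul_mem' := by
    intro c p hp φ hφ hc hs i
    have e1 : ∫ x in Ω, (fderiv ℝ φ x (EuclideanSpace.single i (1 : ℝ))) • (c • p).fst x =
        ∫ x in Ω, c • ((fderiv ℝ φ x (EuclideanSpace.single i (1 : ℝ))) • p.fst x) := by
      refine integral_congr_ae ?_
      filter_upwards [Lp.coeFn_smul c p.fst] with x hx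
      rw [WithLp.smul_fst, hx, Pi.smul_apply, smul_comm]
    have e2 : ∫ x in Ω, φ x • (c • p).snd x i = ∫ x in Ω, c • (φ x • p.snd x i) := by
      refine integral_congr_ae ?_
      filter_upwards [Lp.coeFn_smul c p.snd] with x hx
      rw [WithLp.smul_snd, hx, Pi.smul_apply, PiLp.smul_apply, smul_comm]
    rw [e1, e2, integral_smul, integral_smul, hp φ hφ hc hs i, smul_neg]

/-- The underlying `L²` function of an `H¹` function. -/
def toL2 {Ω : Set E3} (u : H1 Ω) : L2 Ω := (u : WithLp 2 (L2 Ω × L2Vec Ω)).fst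

/-- The weak gradient of an `H¹` function. -/
def grad {Ω : Set E3} (u : H1 Ω) : L2Vec Ω := (u : WithLp 2 (L2 Ω × L2Vec Ω)).snd

/-- `T` is the continuous extension to `H¹(Ω)` of the restriction `u ↦ u|_Γ` of functions that are
smooth up to the boundary. -/
def IsTraceOperator (Ω : Set E3) (T : H1 Ω →L[ℂ] L2Bdry Ω) : Prop :=
  ∀ φ : E3 → ℂ, ContDiff ℝ ∞ φ → ∀ u : H1 Ω,
    (toL2 u : E3 → ℂ) =ᵐ[volume.restrict Ω] φ → (T u : E3 → ℂ) =ᵐ[surfaceMeasure Ω] φ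

open Classical in
/-- The trace operator `γ₀ : H¹(Ω) → L²(Γ)` (for the domains considered it exists and is unique;
the default value `0` is never used for them). -/
noncomputable def trace (Ω : Set E3) : H1 Ω →L[ℂ] L2Bdry Ω :=
  if h : ∃ T : H1 Ω →L[ℂ] L2Bdry Ω, IsTraceOperator Ω T then h.choose else 0

/-- `b_ζ(γ₀u, γ₀v) = (ζ γ₀u, γ₀v)_Γ`. Mathlib's inner product is conjugate linear in its first
argument, hence the order of the arguments. -/
noncomputable def bForm {Ω : Set E3} (ζ : ℂ) (u v : H1 Ω) : ℂ :=
  ζ * inner ℂ (trace Ω v) (trace Ω u)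

/-- `a_ζ(u, v) = (∇u, ∇v) + (ζ² u, v) + (ζ γ₀u, γ₀v)_Γ`. -/
noncomputable def aForm {Ω : Set E3} (ζ : ℂ) (u v : H1 Ω) : ℂ :=
  inner ℂ (grad v) (grad u) + ζ ^ 2 * inner ℂ (toL2 v) (toL2 u) + bForm ζ u v

/-- The weighted norm `‖u‖_ρ = (‖∇u‖² + ρ²‖u‖²)^(1/2)`. -/
noncomputable def wnorm {Ω : Set E3} (ρ : ℝ) (u : H1 Ω) : ℝ :=
  Real.sqrt (‖grad u‖ ^ 2 + ρ ^ 2 * ‖toL2 u‖ ^ 2)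

/-- `Cb` is a constant, independent of `ζ`, in the continuity estimate
`|a_ζ(u, v)| ≤ (1 + Cb) ‖u‖_{|ζ|} ‖v‖_{|ζ|}` for `Re ζ ≥ 0`, `|ζ| ≥ 1`. -/
def IsContinuityConstant (Ω : Set E3) (Cb : ℝ) : Prop :=
  ∀ ζ : ℂ, 0 ≤ ζ.re → 1 ≤ ‖ζ‖ → ∀ u v : H1 Ω,
    ‖aForm ζ u v‖ ≤ (1 + Cb) * wnorm ‖ζ‖ u * wnorm ‖ζ‖ v

/-- `z` solves the adjoint problem `a_{conj ζ}(z, w) = (f, w)` for all `w ∈ H¹(Ω)`. -/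
def IsAdjointSolution {Ω : Set E3} (ζ : ℂ) (f : L2 Ω) (z : H1 Ω) : Prop :=
  ∀ w : H1 Ω, aForm (conj ζ) z w = inner ℂ (toL2 w) f

open Classical in
/-- The solution operator of the adjoint problem (which is uniquely solvable in the situation
considered, so that the default value `0` is never used). -/
noncomputable def adjointSolution {Ω : Set E3} (ζ : ℂ) (f : L2 Ω) : H1 Ω :=
  if h : ∃ z : H1 Ω, IsAdjointSolution ζ f z then h.choose else 0

/-- The adjoint approximability
`η(S) = sup_{f ≠ 0} inf_{v ∈ S} ‖S̃_ζ f - v‖_{|ζ|} / ‖f‖`, as a supremum in `[0, ∞]`. -/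
noncomputable def eta {Ω : Set E3} (ζ : ℂ) (S : Submodule ℂ (H1 Ω)) : ℝ≥0∞ :=
  ⨆ (f : L2 Ω) (_ : f ≠ 0), ⨅ v : S,
    ENNReal.ofReal (wnorm ‖ζ‖ (adjointSolution ζ f - (v : H1 Ω)) / ‖f‖)

/-- `uS` is the Galerkin approximation of `u` in `S`: it lies in `S` and
`a_ζ(u - uS, v) = 0` for all `v ∈ S`. -/
def IsGalerkinSolution {Ω : Set E3} (ζ : ℂ) (S : Submodule ℂ (H1 Ω)) (u uS : H1 Ω) : Prop :=
  uS ∈ S ∧ ∀ v ∈ S, aForm ζ (u - uS) v = 0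

end HelmholtzRobin

/-! The estimates follow Schatz's duality argument. Since `Re ζ² + 2 (Im ζ)² = |ζ|²` and `Re ζ ≥ 0`,
the form satisfies the Gårding inequality `‖e‖²_{|ζ|} ≤ Re a_ζ(e,e) + 2 (Im ζ)² ‖e‖²`
(`wnorm_sq_le`). If `e` is Galerkin orthogonal to `S`, testing with the adjoint solution `z` for the
datum `e` gives `‖e‖² = a_ζ(e, z - v)` for every `v ∈ S`, hence `‖e‖ ≤ (1 + C_b) η(S) ‖e‖_{|ζ|}`.
With the smallness of `(Im ζ)² η(S) / |ζ|` and `|ζ| ‖e‖ ≤ ‖e‖_{|ζ|}`, the negative term is at most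
half of `‖e‖²_{|ζ|}` and is absorbed. What remains is `½ ‖e‖²_{|ζ|} ≤ |a_ζ(e, y)|` with `e - y ∈ S`,
which is quasi-optimality. The same bound with `y = 0` is injectivity on `S`, and the Fredholm
alternative turns it into existence.

Three analytic facts are needed: a trace operator with `‖γ₀u‖² ≤ K ‖u‖ (‖u‖ + ‖∇u‖)`, compactness of
`H¹ → L²`, and solvability of the adjoint problem.

For the trace, the boundary is viewed as a Lipschitz radial graph. On each face cut out by a
coordinate cone, central projection is bi-Lipschitz, so surface measure is comparable to Lebesgue
measure of slopes; along a ray, the divergence of `ψ (x - c)` integrates exactly by the fundamental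
theorem of calculus. Only two-sided comparison of integrals is used, never a normal vector. Rellich
compactness and density of smooth functions come from one mollifier that averages over `(1 - ε) x +
ε y` with `y` near the centre: star-shapedness keeps these points inside `Ω`, so no extension
operator is needed.

Solvability reduces by Fredholm to uniqueness. `Re (conj ζ · a_ζ(u,u)) = 0` forces zero trace, and
for `Re ζ > 0` also `u = 0`. For `Re ζ = 0`, testing with plane waves shows that the Fourier
transform of the zero extension vanishes off a sphere, hence almost everywhere. -/

namespace HelmholtzRobin

/-! ### Fredholm alternative from a Gårding inequality. -/

section FunctionalAnalysis

variable {H X : Type*} [NormedAddCommGroup H] [InnerProductSpace ℂ H] [CompleteSpace H]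
  [NormedAddCommGroup X] [InnerProductSpace ℂ X] [CompleteSpace X]

/-- A bounded operator which is coercive is bijective (Lax–Milgram). -/
theorem isUnit_of_coercive (B : H →L[ℂ] H) {c : ℝ} (hc : 0 < c)
    (hB : ∀ u, c * ‖u‖ ^ 2 ≤ (inner ℂ u (B u)).re) : IsUnit B := by
  have hbelow : ∀ u, c * ‖u‖ ≤ ‖B u‖ := by
    intro u
    rcases eq_or_ne u 0 with rfl | hu
    · simp
    have h1 : c * ‖u‖ ^ 2 ≤ ‖u‖ * ‖B u‖ :=
      (hB u).trans ((Complex.re_le_norm _).trans (norm_inner_le_norm _ _))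
    have h2 : 0 < ‖u‖ := norm_pos_iff.2 hu
    nlinarith
  have hanti : AntilipschitzWith (Real.toNNReal c⁻¹) B := by
    refine B.antilipschitz_of_bound fun u => ?_
    rw [Real.coe_toNNReal _ (by positivity), inv_mul_eq_div, le_div_iff₀ hc, mul_comm]
    exact hbelow u
  have hcl : IsClosed (B.range : Set H) := by
    have := hanti.isClosed_range B.uniformContinuous
    rwa [← ContinuousLinearMap.coe_coe, ← LinearMap.coe_range] at this
  rw [ContinuousLinearMap.isUnit_iff_bijective]
  refine ⟨hanti.injective, ?_⟩
  have : CompleteSpace B.range := hcl.completeSpace_coe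
  have htop : B.range = ⊤ := by
    -- A vector orthogonal to the range is orthogonal to its own image, so coercivity makes it zero.
    rw [← Submodule.orthogonal_eq_bot_iff, Submodule.eq_bot_iff]
    intro w hw
    have h0 : inner ℂ w (B w) = 0 := by
      rw [← inner_conj_symm, (Submodule.mem_orthogonal _ _).1 hw (B w) ⟨w, rfl⟩, map_zero]
    have := hB w
    rw [h0, Complex.zero_re] at this
    have h3 : ‖w‖ ^ 2 ≤ 0 := by nlinarith [sq_nonneg ‖w‖]
    simpa using h3
  exact LinearMap.range_eq_top.1 htop

/-- Fredholm alternative for operators satisfying a Gårding inequality with respect to a compact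
operator: injectivity implies surjectivity. -/
theorem surjective_of_garding (A : H →L[ℂ] H) (J : H →L[ℂ] X) (hJ : IsCompactOperator J)
    {c C : ℝ} (hc : 0 < c)
    (hA : ∀ u, c * ‖u‖ ^ 2 ≤ (inner ℂ u (A u)).re + C * ‖J u‖ ^ 2)
    (hinj : ∀ u, A u = 0 → u = 0) : Function.Surjective A := by
  -- Adding the compact `N = C J*J` makes `A` coercive. With `G = (A + N)⁻¹` one has `A = (A + N)(1
  -- - G N)`, so it suffices to invert `1 - G N`.
  set N : H →L[ℂ] H := (C : ℂ) • (ContinuousLinearMap.adjoint J ∘L J) with hN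
  have hNc : IsCompactOperator N := by
    have h1 : IsCompactOperator (ContinuousLinearMap.adjoint J ∘L J) :=
      hJ.clm_comp (ContinuousLinearMap.adjoint J)
    exact h1.smul (C : ℂ)
  obtain ⟨U, hU⟩ := isUnit_of_coercive (A + N) hc (by
    intro u
    refine (hA u).trans (le_of_eq ?_)
    have : inner ℂ u (N u) = ((C * ‖J u‖ ^ 2 : ℝ) : ℂ) := by
      simp only [hN, smul_apply, ContinuousLinearMap.comp_apply,
        inner_smul_right, ContinuousLinearMap.adjoint_inner_right, inner_self_eq_norm_sq_to_K]
      push_cast; rfl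
    rw [add_apply, inner_add_right, this, Complex.add_re, Complex.ofReal_re])
  set G : H →L[ℂ] H := ↑U⁻¹ with hG
  have hGU : ∀ x, G ((A + N) x) = x := fun x => by
    have := congrArg (fun T : H →L[ℂ] H => T x) (U.inv_mul)
    rwa [hU] at this
  have hUG : ∀ x, (A + N) (G x) = x := fun x => by
    have := congrArg (fun T : H →L[ℂ] H => T x) (U.mul_inv)
    rwa [hU] at this
  have hK : IsCompactOperator (G ∘L N) := hNc.clm_comp G
  -- A fixed vector `v = G N v` satisfies `(A + N) v = N v`, that is `A v = 0`; this excludes the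
  -- eigenvalue `1`.
  rcases IsCompactOperator.hasEigenvalue_or_mem_resolventSet (T := G ∘L N) hK
    (one_ne_zero : (1 : ℂ) ≠ 0) with h | h
  · exfalso
    obtain ⟨v, hv⟩ := h.exists_hasEigenvector
    apply hv.2
    apply hinj
    have h1 : G (N v) = v := by simpa using hv.apply_eq_smul
    have h2 := hUG (N v)
    rw [h1, add_apply] at h2
    simpa using h2
  · rw [spectrum.mem_resolventSet_iff, ContinuousLinearMap.isUnit_iff_bijective] at h
    intro y
    obtain ⟨x, hx⟩ := h.2 (G y)
    refine ⟨x, ?_⟩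
    have h1 : x - G (N x) = G y := by simpa using hx
    have h2 := congrArg (A + N) h1
    rw [map_sub, hUG, hUG] at h2
    rw [← h2, add_apply, add_sub_cancel_right]

end FunctionalAnalysis

/-! ### Compactness of operators with square-integrable kernels. -/

section KernelOperator

variable {H : Type*} [NormedAddCommGroup H] [InnerProductSpace ℂ H]

/-- The operator `u ↦ (x ↦ K x u)` with an `L²` kernel of functionals. -/
noncomputable def kernelOp {α : Type*} [MeasurableSpace α] (μ : Measure α) :
    Lp (H →L[ℂ] ℂ) 2 μ →L[ℂ] H →L[ℂ] Lp ℂ 2 μ :=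
  ((ContinuousLinearMap.apply ℂ ℂ : H →L[ℂ] (H →L[ℂ] ℂ) →L[ℂ] ℂ).compLpL₂ 2 μ).flip

theorem coeFn_kernelOp {α : Type*} [MeasurableSpace α] (μ : Measure α)
    (K : Lp (H →L[ℂ] ℂ) 2 μ) (u : H) : kernelOp μ K u =ᵐ[μ] fun x => K x u :=
  ((ContinuousLinearMap.apply ℂ ℂ : H →L[ℂ] (H →L[ℂ] ℂ) →L[ℂ] ℂ) u).coeFn_compLpL K

/-- A kernel that is constant on a set and zero elsewhere gives an operator of rank at most one.
Such kernels span a dense subspace of `L²`, the operator depends continuously on the kernel, and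
compact operators are closed in operator norm. -/
theorem isCompactOperator_kernelOp {α : Type*} [MeasurableSpace α] (μ : Measure α)
    (K : Lp (H →L[ℂ] ℂ) 2 μ) : IsCompactOperator (kernelOp μ K) := by
  refine Lp.induction (p := 2) (by simp) (fun K => IsCompactOperator (kernelOp μ K)) ?_ ?_ ?_ K
  · intro c s hs hμs
    have : (kernelOp μ (Lp.simpleFunc.indicatorConst 2 hs hμs.ne c) : H → Lp ℂ 2 μ) =
        fun u => (ContinuousLinearMap.toSpanSingleton ℂ (indicatorConstLp 2 hs hμs.ne (1 : ℂ)) ∘L c)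
          u := by
      ext1 u
      apply Lp.ext
      refine (coeFn_kernelOp μ _ u).trans ?_
      rw [Lp.simpleFunc.coe_indicatorConst]
      simp only [ContinuousLinearMap.comp_apply, ContinuousLinearMap.toSpanSingleton_apply]
      filter_upwards [indicatorConstLp_coeFn (p := 2) (hs := hs) (hμs := hμs.ne) (c := c),
        indicatorConstLp_coeFn (p := 2) (hs := hs) (hμs := hμs.ne) (c := (1 : ℂ)),
        Lp.coeFn_smul (c u) (indicatorConstLp 2 hs hμs.ne (1 : ℂ))] with x h1 h2 h3
      rw [h1, h3, Pi.smul_apply, h2]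
      by_cases hx : x ∈ s <;> simp [Set.indicator, hx]
    rw [this]
    exact (isCompactOperator_of_locallyCompactSpace_dom c).clm_comp
      (ContinuousLinearMap.toSpanSingleton ℂ (indicatorConstLp 2 hs hμs.ne (1 : ℂ)))
  · intro f g hf hg _ h1 h2
    rw [map_add]
    exact h1.add h2
  · exact isClosed_setOfPred_isCompactOperator.preimage (kernelOp μ).continuous

end KernelOperator

end HelmholtzRobin

/-! ### Geometry of star-shaped domains: rays and the radial function. -/

namespace HelmholtzRobin

/-- `Ω` is open, contained in the closed ball of radius `M` about `c` and star-shaped with respect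
to the ball of radius `ρ` about `c`. -/
structure IsStarDomain (Ω : Set E3) (c : E3) (ρ M : ℝ) : Prop where
  isOpen : IsOpen Ω
  nonempty : Ω.Nonempty
  pos : 0 < ρ
  star : ∀ y ∈ Metric.ball c ρ, StarConvex ℝ y Ω
  subset : Ω ⊆ Metric.closedBall c M

theorem IsAdmissibleDomain.exists_isStarDomain {Ω : Set E3} (hΩ : IsAdmissibleDomain Ω) :
    ∃ (c : E3) (ρ M : ℝ), IsStarDomain Ω c ρ M := by
  obtain ⟨c, ρ, hρ, hs⟩ := hΩ.starShaped
  obtain ⟨M, hM⟩ := hΩ.isBounded.subset_closedBall c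
  exact ⟨c, ρ, M, hΩ.isOpen, hΩ.isConnected.nonempty, hρ, hs, hM⟩

namespace IsStarDomain

variable {Ω : Set E3} {c : E3} {ρ M : ℝ}

/-- Replacing `x` by a nearby `x' ∈ Ω` and keeping the point on the segment fixed moves the other
end only slightly, so it stays in the open ball, and star-shapedness about that moved end applies.
Hence half-open segments from the ball to boundary points lie in `Ω`. -/
theorem mem_of_mem_closure (h : IsStarDomain Ω c ρ M) {x y : E3} (hx : x ∈ closure Ω)
    (hy : y ∈ Metric.ball c ρ) {t : ℝ} (ht0 : 0 ≤ t) (ht1 : t < 1) : y + t • (x - y) ∈ Ω := by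
  have h1t : 0 < 1 - t := by linarith
  set p := y + t • (x - y) with hp
  have hcont : Continuous fun x' : E3 => (1 - t)⁻¹ • (p - t • x') := by fun_prop
  have hx0 : (1 - t)⁻¹ • (p - t • x) = y := by
    rw [inv_smul_eq_iff₀ h1t.ne', hp]; module
  have hnear : ∀ᶠ x' in 𝓝 x, (1 - t)⁻¹ • (p - t • x') ∈ Metric.ball c ρ := by
    refine hcont.continuousAt.eventually_mem ?_
    simp only [hx0]
    exact Metric.isOpen_ball.mem_nhds hy
  obtain ⟨x', hx', hx'Ω⟩ := (mem_closure_iff_frequently.1 hx).and_eventually hnear |>.exists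
  have := h.star _ hx'Ω hx' h1t.le ht0 (by ring)
  rwa [smul_inv_smul₀ h1t.ne', sub_add_cancel] at this

theorem ball_subset (h : IsStarDomain Ω c ρ M) : Metric.ball c ρ ⊆ Ω := by
  intro y hy
  obtain ⟨z, hz⟩ := h.nonempty
  simpa using h.mem_of_mem_closure (subset_closure hz) hy le_rfl one_pos

theorem isBounded (h : IsStarDomain Ω c ρ M) : Bornology.IsBounded Ω :=
  Metric.isBounded_closedBall.subset h.subset

theorem closure_subset (h : IsStarDomain Ω c ρ M) : closure Ω ⊆ Metric.closedBall c M :=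
  closure_minimal h.subset Metric.isClosed_closedBall

theorem center_mem (h : IsStarDomain Ω c ρ M) : c ∈ Ω :=
  h.ball_subset (Metric.mem_ball_self h.pos)

theorem notMem_of_mem_frontier (h : IsStarDomain Ω c ρ M) {x : E3} (hx : x ∈ frontier Ω) :
    x ∉ Ω := by
  rw [h.isOpen.frontier_eq] at hx
  exact hx.2

theorem le_norm_of_mem_frontier (h : IsStarDomain Ω c ρ M) {x : E3} (hx : x ∈ frontier Ω) :
    ρ ≤ ‖x - c‖ := by
  by_contra! hlt
  exact h.notMem_of_mem_frontier hx (h.ball_subset (by rwa [Metric.mem_ball, dist_eq_norm]))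

theorem norm_le_of_mem_closure (h : IsStarDomain Ω c ρ M) {x : E3} (hx : x ∈ closure Ω) :
    ‖x - c‖ ≤ M := by
  simpa [Metric.mem_closedBall, dist_eq_norm] using h.closure_subset hx

theorem norm_le_of_mem_frontier (h : IsStarDomain Ω c ρ M) {x : E3} (hx : x ∈ frontier Ω) :
    ‖x - c‖ ≤ M :=
  h.norm_le_of_mem_closure (frontier_subset_closure hx)

theorem radius_nonneg (h : IsStarDomain Ω c ρ M) : 0 ≤ M :=
  (norm_nonneg _).trans (h.norm_le_of_mem_closure (subset_closure h.center_mem))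

/-- Every ray from the centre meets the boundary exactly once. -/
theorem exists_frontier_ray (h : IsStarDomain Ω c ρ M) {d : E3} (hd : d ≠ 0) :
    ∃ R : ℝ, 0 < R ∧ c + R • d ∈ frontier Ω ∧ ∀ r : ℝ, 0 ≤ r → (c + r • d ∈ Ω ↔ r < R) := by
  have hcont : Continuous fun r : ℝ => c + r • d := by fun_prop
  have hd' : 0 < ‖d‖ := norm_pos_iff.2 hd
  set T := (M + 1) / ‖d‖ with hT
  have hT0 : 0 ≤ T := by have := h.radius_nonneg; positivity
  have hTout : c + T • d ∉ Ω := by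
    intro hmem
    have := h.norm_le_of_mem_closure (subset_closure hmem)
    rw [add_sub_cancel_left, norm_smul, Real.norm_of_nonneg hT0, hT, div_mul_cancel₀ _ hd'.ne']
      at this
    linarith
  have hcomp : IsCompact (Icc (0 : ℝ) T ∩ (fun r : ℝ => c + r • d) ⁻¹' Ωᶜ) :=
    isCompact_Icc.inter_right (h.isOpen.isClosed_compl.preimage hcont)
  -- `R` is the first exit parameter. `T` was chosen so that the ray has reached distance `M + 1`
  -- from `c`, which is outside `Ω`.
  obtain ⟨R, ⟨hR, hRΩ⟩, hRmin⟩ := hcomp.exists_isLeast ⟨T, ⟨hT0, le_rfl⟩, hTout⟩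
  have hR0 : 0 < R := by
    refine lt_of_le_of_ne hR.1 fun h0 => hRΩ ?_
    simpa [← h0] using h.center_mem
  have hRΓ : c + R • d ∈ frontier Ω := by
    rw [h.isOpen.frontier_eq]
    refine ⟨map_mem_closure hcont (s := Ico 0 R) ?_ fun r hr => ?_, hRΩ⟩
    · rw [closure_Ico hR0.ne]; exact ⟨hR0.le, le_rfl⟩
    · by_contra hout
      exact (hRmin ⟨⟨hr.1, hr.2.le.trans hR.2⟩, hout⟩).not_gt hr.2
  refine ⟨R, hR0, hRΓ, fun r hr => ⟨fun hmem => ?_, fun hlt => ?_⟩⟩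
  · by_contra! hle
    rcases hle.eq_or_lt with rfl | hlt
    · exact h.notMem_of_mem_frontier hRΓ hmem
    · have := h.mem_of_mem_closure (subset_closure hmem) (Metric.mem_ball_self h.pos)
        (t := R / r) (by positivity) (by rwa [div_lt_one (by linarith)])
      rw [add_sub_cancel_left, smul_smul, div_mul_cancel₀ _ (by linarith)] at this
      exact h.notMem_of_mem_frontier hRΓ this
  · have := h.mem_of_mem_closure (frontier_subset_closure hRΓ) (Metric.mem_ball_self h.pos)
      (t := r / R) (by positivity) (by rwa [div_lt_one hR0])
    rwa [add_sub_cancel_left, smul_smul, div_mul_cancel₀ _ hR0.ne'] at this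

/-- The radial function of the boundary is Lipschitz. -/
theorem abs_radius_sub_le (h : IsStarDomain Ω c ρ M) {a a' : ℝ} {d d' : E3} (haa : 0 < a * a')
    (hx : c + a • d ∈ frontier Ω) (hx' : c + a' • d' ∈ frontier Ω) :
    ρ * |a - a'| ≤ |a| * |a'| * ‖d - d'‖ := by
  have key : ∀ {a a' : ℝ} {d d' : E3}, 0 < a * a' → |a'| < |a| → c + a • d ∈ frontier Ω →
      c + a' • d' ∈ frontier Ω → ρ * |a - a'| ≤ |a| * |a'| * ‖d - d'‖ := by
    clear hx hx' haa a a' d d'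
    intro a a' d d' haa hlt hx hx'
    have ha : a ≠ 0 := by rintro rfl; simp at haa
    have hne : a - a' ≠ 0 := by
      intro h0
      rw [sub_eq_zero.1 h0] at hlt
      exact lt_irrefl _ hlt
    have ht0 : 0 ≤ a' / a := by
      rw [div_eq_mul_inv]
      have : a' * a⁻¹ = (a * a') * (a⁻¹) ^ 2 := by field_simp
      rw [this]; positivity
    have ht1 : a' / a < 1 := by
      refine (le_abs_self _).trans_lt ?_
      rwa [abs_div, div_lt_one (abs_pos.2 ha)]
    -- `y` is the point for which `c + a' • d'` lies on the segment from `y` to `c + a • d`. Were it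
    -- in the ball, the second boundary point would be in `Ω`; so `‖y - c‖ ≥ ρ`, which is the claim.
    set y := c + (a * a' / (a - a')) • (d' - d) with hy
    have hp : y + (a' / a) • (c + a • d - y) = c + a' • d' := by
      have e : y + (a' / a) • (c + a • d - y) = (1 - a' / a) • (y - c) + c + ((a' / a) * a) • d := by
        module
      rw [e, hy, add_sub_cancel_left, smul_smul, div_mul_cancel₀ _ ha]
      have : (1 - a' / a) * (a * a' / (a - a')) = a' := by field_simp
      rw [this]; module
    have hyb : y ∉ Metric.ball c ρ := fun hyb =>
      h.notMem_of_mem_frontier hx'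
        (hp ▸ h.mem_of_mem_closure (frontier_subset_closure hx) hyb ht0 ht1)
    rw [Metric.mem_ball, dist_eq_norm, not_lt, hy, add_sub_cancel_left, norm_smul, norm_sub_rev,
      Real.norm_eq_abs, abs_div, abs_mul, div_mul_eq_mul_div, le_div_iff₀ (abs_pos.2 hne)] at hyb
    exact hyb
  rcases lt_trichotomy |a'| |a| with hlt | heq | hgt
  · exact key haa hlt hx hx'
  · have : a = a' := by
      rcases abs_eq_abs.1 heq with e | e
      · exact e.symm
      · rw [e] at haa; nlinarith [sq_nonneg a]
    rw [this, sub_self, abs_zero, mul_zero]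
    positivity
  · rw [abs_sub_comm, norm_sub_rev, mul_comm |a|]
    exact key (by rwa [mul_comm]) hgt hx' hx

/-- The same domain with respect to a different centre of the ball. -/
theorem change_center (h : IsStarDomain Ω c ρ M) {c' : E3} (hc : dist c' c ≤ ρ / 2) :
    IsStarDomain Ω c' (ρ / 2) (M + ρ / 2) where
  isOpen := h.isOpen
  nonempty := h.nonempty
  pos := half_pos h.pos
  star := fun y hy => h.star y (by
    rw [Metric.mem_ball] at hy ⊢
    linarith [dist_triangle y c' c])
  subset := fun x hx => by
    have := h.subset hx
    rw [Metric.mem_closedBall] at this ⊢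
    linarith [dist_triangle x c c', dist_comm c c']

end IsStarDomain

/-! ### Coordinate cones and central projection of the boundary. -/

/-- The point with `i`-th coordinate `1` and the other coordinates `s`. -/
noncomputable def dir (i : Fin 3) (s : Fin 2 → ℝ) : E3 :=
  WithLp.toLp 2 (i.insertNth (1 : ℝ) s : Fin 3 → ℝ)

/-- The coordinates of `x` other than the `i`-th, divided by the `i`-th. -/
noncomputable def slope (i : Fin 3) (x : E3) : Fin 2 → ℝ := fun j => x (i.succAbove j) / x i

/-- The cone of nonzero `x` whose first coordinate of maximal absolute value is the `i`-th. -/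
def cone (i : Fin 3) : Set E3 :=
  {x | x i ≠ 0 ∧ ∀ j, |x j| ≤ |x i| ∧ (j < i → |x j| < |x i|)}

@[simp] theorem dir_self (i : Fin 3) (s : Fin 2 → ℝ) : dir i s i = 1 := by simp [dir]

@[simp] theorem dir_succAbove (i : Fin 3) (s : Fin 2 → ℝ) (j : Fin 2) :
    dir i s (i.succAbove j) = s j := by simp [dir]

theorem dir_ne_zero (i : Fin 3) (s : Fin 2 → ℝ) : dir i s ≠ 0 := by
  intro h
  have := dir_self i s
  rw [h] at this
  simp at this

theorem ext_succAbove (i : Fin 3) {x y : E3} (h : x i = y i)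
    (h' : ∀ j, x (i.succAbove j) = y (i.succAbove j)) : x = y := by
  ext k
  rcases Fin.eq_self_or_eq_succAbove i k with rfl | ⟨j, rfl⟩
  · exact h
  · exact h' j

theorem smul_dir_slope (i : Fin 3) {x : E3} (hx : x i ≠ 0) : x i • dir i (slope i x) = x := by
  refine ext_succAbove i (by simp) fun j => ?_
  simp only [PiLp.smul_apply, dir_succAbove, slope, smul_eq_mul]
  field_simp

theorem slope_smul_dir (i : Fin 3) {r : ℝ} (hr : r ≠ 0) (s : Fin 2 → ℝ) :
    slope i (r • dir i s) = s := by
  ext j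
  simp [slope, hr]

theorem smul_mem_cone {i : Fin 3} {r : ℝ} (hr : r ≠ 0) {x : E3} : r • x ∈ cone i ↔ x ∈ cone i := by
  have hr' : 0 < |r| := abs_pos.2 hr
  simp [cone, hr, abs_mul, hr']

theorem exists_mem_cone {x : E3} (hx : x ≠ 0) : ∃ i, x ∈ cone i := by
  classical
  have hne : (Finset.univ.filter fun i : Fin 3 => ∀ j, |x j| ≤ |x i|).Nonempty := by
    obtain ⟨i, -, hi⟩ := Finset.exists_max_image Finset.univ (fun i => |x i|)
      (Finset.univ_nonempty (α := Fin 3))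
    exact ⟨i, by simpa using fun j => hi j (Finset.mem_univ j)⟩
  set i := Finset.min' _ hne with hi
  have hi1 : ∀ j, |x j| ≤ |x i| := by
    have := Finset.min'_mem _ hne
    rw [← hi] at this
    simpa using this
  refine ⟨i, ?_, fun j => ⟨hi1 j, fun hj => lt_of_le_of_ne (hi1 j) fun he => ?_⟩⟩
  · intro h0
    apply hx
    ext j
    have := hi1 j
    rw [h0, abs_zero] at this
    simpa using this
  · refine (Finset.min'_le (Finset.univ.filter fun i : Fin 3 => ∀ j, |x j| ≤ |x i|) j ?_).not_gt hj
    simpa [he] using hi1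

theorem disjoint_cone {i j : Fin 3} (hij : i ≠ j) : Disjoint (cone i) (cone j) := by
  rw [Set.disjoint_left]
  intro x hi hj
  rcases lt_or_gt_of_ne hij with h | h
  · exact absurd ((hj.2 i).2 h) (not_lt.2 (hi.2 j).1)
  · exact absurd ((hi.2 j).2 h) (not_lt.2 (hj.2 i).1)

theorem measurableSet_cone (i : Fin 3) : MeasurableSet (cone i) := by
  have hm : ∀ k, Measurable fun x : E3 => x k := fun k => by fun_prop
  have : cone i = {x : E3 | x i ≠ 0} ∩ ⋂ j, ({x : E3 | |x j| ≤ |x i|} ∩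
      {x : E3 | j < i → |x j| < |x i|}) := by
    ext x; simp [cone]
  rw [this]
  refine MeasurableSet.inter ?_ (MeasurableSet.iInter fun j => MeasurableSet.inter ?_ ?_)
  · exact (measurableSet_eq_fun (hm i) measurable_const).compl
  · exact measurableSet_le (hm j).abs (hm i).abs
  · by_cases hj : j < i
    · simpa [hj] using measurableSet_lt (hm j).abs (hm i).abs
    · simp [hj]

theorem abs_coord_le_norm (x : E3) (i : Fin 3) : |x i| ≤ ‖x‖ := by
  simpa using PiLp.norm_apply_le x i

/-- No coordinate exceeds the `i`-th in absolute value; `2` rounds up `√3`. -/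
theorem norm_le_two_mul_abs {i : Fin 3} {x : E3} (hx : x ∈ cone i) : ‖x‖ ≤ 2 * |x i| := by
  rw [EuclideanSpace.norm_eq]
  refine Real.sqrt_le_iff.2 ⟨by positivity, ?_⟩
  have : ∀ j, ‖x j‖ ^ 2 ≤ |x i| ^ 2 := fun j => by
    rw [Real.norm_eq_abs]
    exact pow_le_pow_left₀ (abs_nonneg _) (hx.2 j).1 2
  calc ∑ j, ‖x j‖ ^ 2 ≤ ∑ _j : Fin 3, |x i| ^ 2 := Finset.sum_le_sum fun j _ => this j
    _ ≤ (2 * |x i|) ^ 2 := by simp; nlinarith [sq_nonneg |x i|, sq_abs (x i)]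

theorem norm_dir_sub_dir_le (i : Fin 3) (s s' : Fin 2 → ℝ) :
    ‖dir i s - dir i s'‖ ≤ 2 * ‖s - s'‖ := by
  rw [EuclideanSpace.norm_eq]
  refine Real.sqrt_le_iff.2 ⟨by positivity, ?_⟩
  rw [Fin.sum_univ_succAbove _ i]
  have : ∀ j, ‖(dir i s - dir i s') (i.succAbove j)‖ ^ 2 ≤ ‖s - s'‖ ^ 2 := fun j => by
    simp only [PiLp.sub_apply, dir_succAbove]
    exact pow_le_pow_left₀ (norm_nonneg _) (norm_le_pi_norm (s - s') j) 2
  calc _ ≤ ‖(dir i s - dir i s') i‖ ^ 2 + ∑ _j : Fin 2, ‖s - s'‖ ^ 2 := by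
        exact add_le_add le_rfl (Finset.sum_le_sum fun j _ => this j)
    _ ≤ _ := by simp; nlinarith [sq_nonneg ‖s - s'‖]

/-- The part of the boundary in the cone `± cone i` with centre `c`. -/
def face (Ω : Set E3) (c : E3) (i : Fin 3) (e : ℝ) : Set E3 :=
  {x | x ∈ frontier Ω ∧ x - c ∈ cone i ∧ 0 < e * (x - c) i}

theorem measurableSet_face (Ω : Set E3) (c : E3) (i : Fin 3) (e : ℝ) :
    MeasurableSet (face Ω c i e) := by
  have hm : Measurable fun x : E3 => x - c := by fun_prop
  have hm2 : Measurable fun x : E3 => e * (x - c) i := by fun_prop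
  exact isClosed_frontier.measurableSet.inter ((hm (measurableSet_cone i)).inter
    (measurableSet_lt measurable_const hm2))

theorem measurable_slope (i : Fin 3) : Measurable (slope i) := by
  unfold slope; fun_prop

namespace IsStarDomain

variable {Ω : Set E3} {c : E3} {ρ M : ℝ}

/-- Writing `x = c + a • d` with `d` normalised in the `i`-th coordinate, `x - x' = (a - a') • d +
a' • (d - d')`. The radial part is controlled by `abs_radius_sub_le`; the constant collects `|a|,
|a'| ≤ M`, `‖d‖ ≤ 2` and the Lipschitz constant `2` of `dir`. Thus the inverse of central projection
is Lipschitz on a face. -/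
theorem dist_le_of_mem_face (h : IsStarDomain Ω c ρ M) {i : Fin 3} {e : ℝ} {x x' : E3}
    (hx : x ∈ face Ω c i e) (hx' : x' ∈ face Ω c i e) :
    dist x x' ≤ (4 * M ^ 2 / ρ + 2 * M) * dist (slope i (x - c)) (slope i (x' - c)) := by
  obtain ⟨hxΓ, hxc, hxe⟩ := hx
  obtain ⟨hxΓ', hxc', hxe'⟩ := hx'
  set a := (x - c) i with ha
  set a' := (x' - c) i with ha'
  set d := dir i (slope i (x - c)) with hd
  set d' := dir i (slope i (x' - c)) with hd'
  have hxd : x = c + a • d := by rw [ha, hd, smul_dir_slope i hxc.1, add_sub_cancel]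
  have hxd' : x' = c + a' • d' := by rw [ha', hd', smul_dir_slope i hxc'.1, add_sub_cancel]
  have haa : 0 < a * a' := by
    have := mul_pos hxe hxe'
    have e2 : e * a * (e * a') = e ^ 2 * (a * a') := by ring
    rw [e2] at this
    exact pos_of_mul_pos_right this (sq_nonneg e)
  have hrad := h.abs_radius_sub_le haa (hxd ▸ hxΓ) (hxd' ▸ hxΓ')
  have hdd : ‖d - d'‖ ≤ 2 * dist (slope i (x - c)) (slope i (x' - c)) := by
    rw [dist_eq_norm]; exact norm_dir_sub_dir_le i _ _
  have haM : |a| ≤ M := (abs_coord_le_norm _ i).trans (h.norm_le_of_mem_frontier hxΓ)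
  have haM' : |a'| ≤ M := (abs_coord_le_norm _ i).trans (h.norm_le_of_mem_frontier hxΓ')
  have hd2 : ‖d‖ ≤ 2 := by
    have h1 : a • d ∈ cone i := by rw [ha, hd, smul_dir_slope i hxc.1]; exact hxc
    have := norm_le_two_mul_abs ((smul_mem_cone hxc.1).1 h1)
    simpa [hd] using this
  have hM := h.radius_nonneg
  have hρ := h.pos
  set D := dist (slope i (x - c)) (slope i (x' - c))
  have hD : 0 ≤ D := dist_nonneg
  have h1 : |a - a'| ≤ 2 * M ^ 2 / ρ * D := by
    rw [div_mul_eq_mul_div, le_div_iff₀ hρ]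
    calc |a - a'| * ρ = ρ * |a - a'| := mul_comm _ _
      _ ≤ |a| * |a'| * ‖d - d'‖ := hrad
      _ ≤ M * M * (2 * D) := by gcongr
      _ = 2 * M ^ 2 * D := by ring
  calc dist x x' = ‖(a - a') • d + a' • (d - d')‖ := by
        rw [dist_eq_norm, hxd, hxd']; congr 1; module
    _ ≤ |a - a'| * ‖d‖ + |a'| * ‖d - d'‖ := by
        refine (norm_add_le _ _).trans ?_
        rw [norm_smul, norm_smul, Real.norm_eq_abs, Real.norm_eq_abs]
    _ ≤ (2 * M ^ 2 / ρ * D) * 2 + M * (2 * D) := by gcongr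
    _ = (4 * M ^ 2 / ρ + 2 * M) * D := by ring

/-- A slope is a quotient whose denominator is at least `ρ / 2` in absolute value on a face, while
the cone condition bounds the quotient itself by `1`. -/
theorem dist_slope_le_of_mem_face (h : IsStarDomain Ω c ρ M) {i : Fin 3} {e : ℝ} {x x' : E3}
    (hx : x ∈ face Ω c i e) (hx' : x' ∈ face Ω c i e) :
    dist (slope i (x - c)) (slope i (x' - c)) ≤ (4 / ρ) * dist x x' := by
  obtain ⟨hxΓ, hxc, hxe⟩ := hx
  obtain ⟨hxΓ', hxc', hxe'⟩ := hx'
  have hρ := h.pos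
  rw [dist_pi_le_iff (by positivity)]
  intro j
  have ha : ρ ≤ 2 * |(x - c) i| := (h.le_norm_of_mem_frontier hxΓ).trans (norm_le_two_mul_abs hxc)
  set a := (x - c) i with hadef
  set a' := (x' - c) i with hadef'
  set b := (x - c) (i.succAbove j) with hb
  set b' := (x' - c) (i.succAbove j) with hb'
  have ha0 : a ≠ 0 := hxc.1
  have ha0' : a' ≠ 0 := hxc'.1
  have hbb : |b - b'| ≤ dist x x' := by
    rw [dist_eq_norm, show x - x' = (x - c) - (x' - c) by abel]
    exact abs_coord_le_norm ((x - c) - (x' - c)) (i.succAbove j)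
  have haa : |a - a'| ≤ dist x x' := by
    rw [dist_eq_norm, show x - x' = (x - c) - (x' - c) by abel]
    exact abs_coord_le_norm ((x - c) - (x' - c)) i
  have hs : |b' / a'| ≤ 1 := by
    rw [abs_div, div_le_one (abs_pos.2 ha0')]
    exact (hxc'.2 _).1
  have e : b / a - b' / a' = ((b - b') - (b' / a') * (a - a')) / a := by field_simp; ring
  change dist (b / a) (b' / a') ≤ _
  rw [Real.dist_eq, e, abs_div, div_le_iff₀ (abs_pos.2 ha0)]
  calc |b - b' - b' / a' * (a - a')| ≤ |b - b'| + |b' / a'| * |a - a'| := by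
        rw [← abs_mul]; exact abs_sub _ _
    _ ≤ dist x x' + 1 * dist x x' := by gcongr
    _ = (2 * dist x x') := by ring
    _ ≤ 4 / ρ * dist x x' * |a| := by
        rw [show 4 / ρ * dist x x' * |a| = 2 * dist x x' * ((2 * |a|) / ρ) by ring]
        refine le_mul_of_one_le_right (by positivity) ?_
        rwa [one_le_div hρ]

end IsStarDomain

end HelmholtzRobin

/-! ### Integration along rays, and surface measure in slope coordinates. -/

namespace HelmholtzRobin

/-- The slopes of the directions in `cone i`. -/
def slopes (i : Fin 3) : Set (Fin 2 → ℝ) := {s | dir i s ∈ cone i}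

theorem measurable_dir (i : Fin 3) : Measurable (dir i) := by
  have h1 : Measurable fun s : Fin 2 → ℝ => (MeasurableEquiv.piFinSuccAbove (fun _ => ℝ) i).symm
      ((1 : ℝ), s) := (MeasurableEquiv.measurable _).comp (by fun_prop)
  exact (PiLp.continuous_toLp 2 _).measurable.comp h1

theorem measurableSet_slopes (i : Fin 3) : MeasurableSet (slopes i) :=
  measurable_dir i (measurableSet_cone i)

theorem slope_mem_slopes {i : Fin 3} {x : E3} (hx : x ∈ cone i) : slope i x ∈ slopes i := by
  have h := smul_dir_slope i hx.1
  rw [← h] at hx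
  refine (smul_mem_cone ?_).1 hx
  intro h0
  rw [h0, zero_smul] at hx
  exact hx.1 rfl

/-- Integration in the coordinates `(s, r) ↦ c + r • dir i s`. -/
theorem lintegral_eq_lintegral_dir (c : E3) (i : Fin 3) {F : E3 → ℝ≥0∞} (hF : Measurable F) :
    ∫⁻ x, F x = ∫⁻ s : Fin 2 → ℝ, ∫⁻ r : ℝ, ENNReal.ofReal (r ^ 2) * F (c + r • dir i s) := by
  have hmp : MeasurePreserving (fun p : ℝ × (Fin 2 → ℝ) =>
      (WithLp.toLp 2 ((MeasurableEquiv.piFinSuccAbove (fun _ : Fin 3 => ℝ) i).symm p) : E3)) :=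
    (PiLp.volume_preserving_toLp (Fin 3)).comp
      (volume_preserving_piFinSuccAbove (fun _ : Fin 3 => ℝ) i).symm
  have hFc : Measurable fun x : E3 => F (c + x) := hF.comp (by fun_prop)
  have hmd : Measurable fun p : (Fin 2 → ℝ) × ℝ => c + p.2 • dir i p.1 :=
    measurable_const.add (measurable_snd.smul ((measurable_dir i).comp measurable_fst))
  calc ∫⁻ x, F x = ∫⁻ x, F (c + x) := (lintegral_add_left_eq_self F c).symm
    _ = ∫⁻ p : ℝ × (Fin 2 → ℝ), F (c + WithLp.toLp 2
          ((MeasurableEquiv.piFinSuccAbove (fun _ : Fin 3 => ℝ) i).symm p)) :=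
        (hmp.lintegral_comp hFc).symm
    _ = ∫⁻ r : ℝ, ∫⁻ y : Fin 2 → ℝ, F (c + WithLp.toLp 2
          ((MeasurableEquiv.piFinSuccAbove (fun _ : Fin 3 => ℝ) i).symm (r, y))) := by
        have hm := (hFc.comp hmp.measurable).aemeasurable (μ := volume)
        simp only [Function.comp_def] at hm
        rw [Measure.volume_eq_prod, lintegral_prod _ hm]
    -- For `r ≠ 0` substitute `y = r • s` in the plane; the Jacobian is `r ^ 2`.
    _ = ∫⁻ r : ℝ, ∫⁻ s : Fin 2 → ℝ, ENNReal.ofReal (r ^ 2) * F (c + r • dir i s) := by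
        refine lintegral_congr_ae ?_
        filter_upwards [compl_mem_ae_iff.2 (measure_singleton (0 : ℝ))] with r hr
        have hr0 : r ≠ 0 := hr
        have hG : Measurable fun y : Fin 2 → ℝ => F (c + WithLp.toLp 2
            ((MeasurableEquiv.piFinSuccAbove (fun _ : Fin 3 => ℝ) i).symm (r, y))) :=
          (hFc.comp hmp.measurable).comp (by fun_prop)
        have hmap := Measure.map_addHaar_smul (volume : Measure (Fin 2 → ℝ)) hr0
        have h1 := lintegral_map (μ := (volume : Measure (Fin 2 → ℝ))) hG
          (measurable_const_smul r)
        rw [hmap, lintegral_smul_measure] at h1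
        rw [lintegral_const_mul]
        · have h2 : ∀ s : Fin 2 → ℝ, (WithLp.toLp 2
              ((MeasurableEquiv.piFinSuccAbove (fun _ : Fin 3 => ℝ) i).symm (r, r • s)) : E3) =
              r • dir i s := fun s => ext_succAbove i (by simp) (by simp)
          simp only [h2] at h1
          rw [← h1, smul_eq_mul, ← mul_assoc, ← ENNReal.ofReal_mul (sq_nonneg r)]
          have : r ^ 2 * |(r ^ Module.finrank ℝ (Fin 2 → ℝ))⁻¹| = 1 := by
            rw [Module.finrank_fin_fun, abs_inv, abs_of_nonneg (sq_nonneg r)]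
            field_simp
          rw [this, ENNReal.ofReal_one, one_mul]
        · exact hF.comp (hmd.comp (measurable_id.prodMk measurable_const))
    _ = _ := by
        rw [lintegral_lintegral_swap]
        refine Measurable.aemeasurable ?_
        refine Measurable.mul (by fun_prop) ?_
        exact hF.comp (hmd.comp measurable_swap)

/-- Integration over `c + cone i` in the coordinates `(s, r) ↦ c + r • dir i s`. -/
theorem lintegral_cone (c : E3) (i : Fin 3) {F : E3 → ℝ≥0∞} (hF : Measurable F) :
    ∫⁻ x in {x | x - c ∈ cone i}, F x =
      ∫⁻ s in slopes i, ∫⁻ r : ℝ, ENNReal.ofReal (r ^ 2) * F (c + r • dir i s) := by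
  have hm : MeasurableSet {x : E3 | x - c ∈ cone i} :=
    (show Measurable fun x : E3 => x - c by fun_prop) (measurableSet_cone i)
  classical
  rw [← lintegral_indicator hm, lintegral_eq_lintegral_dir c i (hF.indicator hm),
    ← lintegral_indicator (measurableSet_slopes i)]
  refine lintegral_congr fun s => ?_
  rw [indicator_apply]
  split_ifs with hs
  · refine lintegral_congr_ae ?_
    filter_upwards [compl_mem_ae_iff.2 (measure_singleton (0 : ℝ))] with r hr
    rw [indicator_of_mem]
    simpa using (smul_mem_cone hr).2 hs
  · rw [← lintegral_zero (μ := (volume : Measure ℝ))]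
    refine lintegral_congr_ae ?_
    filter_upwards [compl_mem_ae_iff.2 (measure_singleton (0 : ℝ))] with r hr
    rw [indicator_of_notMem, mul_zero]
    simpa using fun h => hs ((smul_mem_cone hr).1 h)

/-- The change of variables as an identity of measures, which carries over to Bochner integrals. -/
theorem map_dir_withDensity (c : E3) (i : Fin 3) :
    ((volume : Measure ((Fin 2 → ℝ) × ℝ)).withDensity fun p => ENNReal.ofReal (p.2 ^ 2)).map
      (fun p => c + p.2 • dir i p.1) = volume := by
  have hmd : Measurable fun p : (Fin 2 → ℝ) × ℝ => c + p.2 • dir i p.1 :=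
    measurable_const.add (measurable_snd.smul ((measurable_dir i).comp measurable_fst))
  refine Measure.ext_of_lintegral _ fun F hF => ?_
  rw [lintegral_map hF hmd, lintegral_withDensity_eq_lintegral_mul _ (by fun_prop)
      (show Measurable fun p : (Fin 2 → ℝ) × ℝ => F (c + p.2 • dir i p.1) from hF.comp hmd),
    lintegral_eq_lintegral_dir c i hF, Measure.volume_eq_prod, lintegral_prod]
  · rfl
  · exact (Measurable.mul (by fun_prop) (hF.comp hmd)).aemeasurable

/-- The norm stays outside the integral over each line, so the cancellation there survives and the
fundamental theorem of calculus can be applied to it. -/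
theorem enorm_integral_le_lintegral_dir (c : E3) (i : Fin 3) {f : E3 → ℂ} (hf : Integrable f) :
    ‖∫ x, f x‖ₑ ≤ ∫⁻ s : Fin 2 → ℝ, ‖∫ r : ℝ, (r ^ 2) • f (c + r • dir i s)‖ₑ := by
  have hmd : Measurable fun p : (Fin 2 → ℝ) × ℝ => c + p.2 • dir i p.1 :=
    measurable_const.add (measurable_snd.smul ((measurable_dir i).comp measurable_fst))
  have hw : Measurable fun p : (Fin 2 → ℝ) × ℝ => ENNReal.ofReal (p.2 ^ 2) := by fun_prop
  have hmap := map_dir_withDensity c i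
  have hf' := hf
  rw [← hmap] at hf'
  have h1 := (integrable_map_measure hf'.aestronglyMeasurable hmd.aemeasurable).1 hf'
  have h2 := (integrable_withDensity_iff_integrable_smul' hw
    (Eventually.of_forall fun _ => ENNReal.ofReal_lt_top)).1 h1
  simp only [Function.comp_def] at h2
  have h3 : ∫ x, f x = ∫ p : (Fin 2 → ℝ) × ℝ, (ENNReal.ofReal (p.2 ^ 2)).toReal •
      f (c + p.2 • dir i p.1) := by
    conv_lhs => rw [← hmap]
    rw [integral_map hmd.aemeasurable hf'.aestronglyMeasurable,
      integral_withDensity_eq_integral_toReal_smul hw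
        (Eventually.of_forall fun _ => ENNReal.ofReal_lt_top)]
  rw [h3, Measure.volume_eq_prod, integral_prod _ h2]
  refine (enorm_integral_le_lintegral_enorm _).trans (le_of_eq ?_)
  refine lintegral_congr fun s => ?_
  simp only [ENNReal.toReal_ofReal (sq_nonneg _)]

/-- Lipschitz maps are estimated for the unnormalised Hausdorff measure; a positive finite factor
between the two normalisations is all that matters. -/
theorem exists_euclideanHausdorffMeasure_eq :
    ∃ κ : NNReal, 0 < κ ∧ (Measure.euclideanHausdorffMeasure 2 : Measure E3) =
      κ • Measure.hausdorffMeasure (2 : ℝ) := by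
  have : (Measure.hausdorffMeasure (2 : ℝ) : Measure (EuclideanSpace ℝ (Fin 2))).IsAddHaarMeasure :=
    by simpa using MeasureTheory.isAddHaarMeasure_hausdorffMeasure (E := EuclideanSpace ℝ (Fin 2))
  refine ⟨_, Measure.addHaarScalarFactor_pos_of_isAddHaarMeasure
    (volume : Measure (EuclideanSpace ℝ (Fin 2))) (Measure.hausdorffMeasure (2 : ℝ)), ?_⟩
  rw [Measure.euclideanHausdorffMeasure_def]
  norm_num

/-- Slopes carry the sup metric, for which no normalising factor appears. -/
theorem hausdorffMeasure_two_fin_two :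
    (Measure.hausdorffMeasure (2 : ℝ) : Measure (Fin 2 → ℝ)) = volume := by
  rw [← hausdorffMeasure_pi_real, Fintype.card_fin, Nat.cast_two]

theorem surfaceMeasure_restrict_face (Ω : Set E3) (c : E3) (i : Fin 3) (e : ℝ) :
    (surfaceMeasure Ω).restrict (face Ω c i e) =
      (Measure.euclideanHausdorffMeasure 2 : Measure E3).restrict (face Ω c i e) := by
  rw [surfaceMeasure, Measure.restrict_restrict_of_subset fun x hx => hx.1]

namespace IsStarDomain

variable {Ω : Set E3} {c : E3} {ρ M : ℝ}

/-- By `dist_le_of_mem_face` the projection of a face is antilipschitz, so area cannot shrink by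
more than a fixed factor. The subtype enters because antilipschitz maps are defined globally. -/
theorem exists_map_slope_le (h : IsStarDomain Ω c ρ M) : ∃ K : NNReal, ∀ i e,
    ((surfaceMeasure Ω).restrict (face Ω c i e)).map (fun x => slope i (x - c)) ≤
      (K : ℝ≥0∞) • volume.restrict (slopes i) := by
  obtain ⟨κ, -, hκ⟩ := exists_euclideanHausdorffMeasure_eq
  have hM := h.radius_nonneg
  have hρ := h.pos
  set L : NNReal := Real.toNNReal (4 * M ^ 2 / ρ + 2 * M) with hL
  refine ⟨κ * L ^ 2, fun i e => ?_⟩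
  have hms : Measurable fun x : E3 => slope i (x - c) := (measurable_slope i).comp (by fun_prop)
  refine Measure.le_iff.2 fun B hB => ?_
  rw [Measure.map_apply hms hB, surfaceMeasure_restrict_face,
    Measure.restrict_apply (hms hB), hκ, Measure.smul_apply, Measure.smul_apply,
    Measure.restrict_apply hB]
  set A : Set E3 := (fun x => slope i (x - c)) ⁻¹' B ∩ face Ω c i e with hA
  have hanti : AntilipschitzWith L (fun x : A => slope i ((x : E3) - c)) := by
    refine AntilipschitzWith.of_le_mul_dist fun x y => ?_
    rw [hL, Real.coe_toNNReal _ (by positivity)]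
    exact h.dist_le_of_mem_face x.2.2 y.2.2
  have h1 := hanti.le_hausdorffMeasure_image (d := 2) (by norm_num) univ
  have h2 := (isometry_subtype_coe (s := A)).hausdorffMeasure_image (d := 2)
    (Or.inl (by norm_num)) univ
  rw [image_univ, Subtype.range_coe] at h2
  rw [← h2, hausdorffMeasure_two_fin_two] at h1
  have h3 : (fun x : A => slope i ((x : E3) - c)) '' univ ⊆ B ∩ slopes i := by
    rintro _ ⟨x, -, rfl⟩
    exact ⟨x.2.1, slope_mem_slopes x.2.2.2.1⟩
  have h4 : (L : ℝ≥0∞) ^ (2 : ℝ) = (L : ℝ≥0∞) ^ 2 := by norm_cast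
  rw [h4] at h1
  calc κ • Measure.hausdorffMeasure 2 A ≤ κ • ((L : ℝ≥0∞) ^ 2 * volume (B ∩ slopes i)) := by
        gcongr; exact h1.trans (by gcongr)
    _ = _ := by
        rw [ENNReal.smul_def, smul_eq_mul, smul_eq_mul]; push_cast; ring

/-- The projection of a face is Lipschitz, and it is onto `slopes i`, since every half-line from the
centre reaches the boundary. -/
theorem exists_le_map_slope (h : IsStarDomain Ω c ρ M) : ∃ K : NNReal, ∀ i, ∀ e : ℝ, e ≠ 0 →
    volume.restrict (slopes i) ≤ (K : ℝ≥0∞) •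
      ((surfaceMeasure Ω).restrict (face Ω c i e)).map (fun x => slope i (x - c)) := by
  obtain ⟨κ, hκ0, hκ⟩ := exists_euclideanHausdorffMeasure_eq
  have hρ := h.pos
  set L : NNReal := Real.toNNReal (4 / ρ) with hL
  refine ⟨κ⁻¹ * L ^ 2, fun i e he => ?_⟩
  have hms : Measurable fun x : E3 => slope i (x - c) := (measurable_slope i).comp (by fun_prop)
  refine Measure.le_iff.2 fun B hB => ?_
  rw [Measure.smul_apply, Measure.map_apply hms hB, surfaceMeasure_restrict_face,
    Measure.restrict_apply (hms hB), hκ, Measure.smul_apply,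
    Measure.restrict_apply hB]
  set A : Set E3 := (fun x => slope i (x - c)) ⁻¹' B ∩ face Ω c i e with hA
  have hlip : LipschitzOnWith L (fun x : E3 => slope i (x - c)) A := by
    refine LipschitzOnWith.of_dist_le_mul fun x hx y hy => ?_
    rw [hL, Real.coe_toNNReal _ (by positivity)]
    exact h.dist_slope_le_of_mem_face hx.2 hy.2
  have h1 := hlip.hausdorffMeasure_image_le (d := 2) (by norm_num)
  rw [hausdorffMeasure_two_fin_two] at h1
  have h3 : B ∩ slopes i ⊆ (fun x : E3 => slope i (x - c)) '' A := by
    rintro s ⟨hsB, hs⟩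
    -- Scaling the direction by `e` selects the half-line that belongs to the face of that sign.
    obtain ⟨R, hR, hRΓ, -⟩ := h.exists_frontier_ray (d := e • dir i s)
      (smul_ne_zero he (dir_ne_zero i s))
    have hRe : R * e ≠ 0 := mul_ne_zero hR.ne' he
    rw [smul_smul] at hRΓ
    have hsl : slope i (c + (R * e) • dir i s - c) = s := by
      rw [add_sub_cancel_left, slope_smul_dir i hRe]
    refine ⟨c + (R * e) • dir i s, ⟨?_, hRΓ, ?_, ?_⟩, hsl⟩
    · rw [mem_preimage, hsl]; exact hsB
    · rw [add_sub_cancel_left, smul_mem_cone hRe]; exact hs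
    · rw [add_sub_cancel_left, PiLp.smul_apply, dir_self, smul_eq_mul, mul_one,
        show e * (R * e) = R * e ^ 2 by ring]
      positivity
  have h4 : (L : ℝ≥0∞) ^ (2 : ℝ) = (L : ℝ≥0∞) ^ 2 := by norm_cast
  rw [h4] at h1
  calc volume (B ∩ slopes i) ≤ (L : ℝ≥0∞) ^ 2 * Measure.hausdorffMeasure 2 A :=
        (measure_mono h3).trans h1
    _ = _ := by
        rw [ENNReal.smul_def, smul_eq_mul, smul_eq_mul]
        push_cast [ENNReal.coe_inv hκ0.ne']
        rw [← mul_assoc _ (κ : ℝ≥0∞), mul_right_comm _ _ (κ : ℝ≥0∞), ENNReal.inv_mul_cancel (by exact_mod_cast hκ0.ne')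
          ENNReal.coe_ne_top, one_mul]

end IsStarDomain

end HelmholtzRobin

/-! ### Comparison of boundary integrals with integrals of a radial divergence. -/

namespace HelmholtzRobin

/-- The divergence of the vector field `x ↦ ψ x • (x - c)`. -/
noncomputable def radialDiv (c : E3) (ψ : E3 → ℂ) (x : E3) : ℂ :=
  3 * ψ x + fderiv ℝ ψ x (x - c)

theorem continuous_radialDiv (c : E3) {ψ : E3 → ℂ} (hψ : ContDiff ℝ 1 ψ) :
    Continuous (radialDiv c ψ) :=
  (continuous_const.mul hψ.continuous).add
    ((hψ.continuous_fderiv one_ne_zero).clm_apply (by fun_prop))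

/-- In the coordinates with volume factor `r ^ 2`, the radial divergence is an exact derivative
along each ray: `(r³ψ)' = r² (3ψ + r ∂_d ψ)`. -/
theorem hasDerivAt_cube_smul (c d : E3) {ψ : E3 → ℂ} (hψ : ContDiff ℝ 1 ψ) (r : ℝ) :
    HasDerivAt (fun r : ℝ => (r ^ 3) • ψ (c + r • d)) ((r ^ 2) • radialDiv c ψ (c + r • d)) r := by
  have h1 : HasDerivAt (fun r : ℝ => c + r • d) d r := by
    simpa using ((hasDerivAt_id r).smul_const d).const_add c
  have h2 : HasDerivAt (fun r : ℝ => ψ (c + r • d)) (fderiv ℝ ψ (c + r • d) d) r :=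
    ((hψ.differentiable one_ne_zero) _).hasFDerivAt.comp_hasDerivAt r h1
  have h3 := (hasDerivAt_pow 3 r).smul h2
  convert! h3 using 1
  simp only [radialDiv, add_sub_cancel_left, map_smul, Complex.real_smul]
  push_cast
  ring

theorem integral_sq_smul_radialDiv (c d : E3) {ψ : E3 → ℂ} (hψ : ContDiff ℝ 1 ψ) (a b : ℝ) :
    ∫ r in a..b, (r ^ 2) • radialDiv c ψ (c + r • d) =
      (b ^ 3) • ψ (c + b • d) - (a ^ 3) • ψ (c + a • d) := by
  refine intervalIntegral.integral_eq_sub_of_hasDerivAt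
    (fun r _ => hasDerivAt_cube_smul c d hψ r) (Continuous.intervalIntegrable ?_ _ _)
  exact (continuous_pow 2).smul ((continuous_radialDiv c hψ).comp (by fun_prop))

namespace IsStarDomain

variable {Ω : Set E3} {c : E3} {ρ M : ℝ}

/-- The fundamental theorem of calculus from the centre to the boundary point; the part of the ray
in between lies in `Ω`. The parameter `R` may be negative, so that one formula serves both faces of
a cone. -/
theorem enorm_cube_mul_le (h : IsStarDomain Ω c ρ M) {ψ : E3 → ℂ} (hψ : ContDiff ℝ 1 ψ) {R : ℝ}
    {d : E3} (hR : c + R • d ∈ frontier Ω) :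
    ‖R‖ₑ ^ 3 * ‖ψ (c + R • d)‖ₑ ≤
      ∫⁻ r : ℝ, ENNReal.ofReal (r ^ 2) * Ω.indicator (fun x => ‖radialDiv c ψ x‖ₑ) (c + r • d) := by
  have h0 := integral_sq_smul_radialDiv c d hψ 0 R
  rw [zero_pow three_ne_zero, zero_smul, sub_zero] at h0
  have h1 : ‖R‖ₑ ^ 3 * ‖ψ (c + R • d)‖ₑ = ‖∫ r in (0 : ℝ)..R, (r ^ 2) • radialDiv c ψ (c + r • d)‖ₑ := by
    rw [h0, enorm_smul, enorm_pow]
  have hR0 : R ≠ 0 := by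
    rintro rfl
    exact h.notMem_of_mem_frontier hR (by simpa using h.center_mem)
  have h2 : ‖∫ r in (0 : ℝ)..R, (r ^ 2) • radialDiv c ψ (c + r • d)‖ₑ =
      ‖∫ r in uIoc 0 R, (r ^ 2) • radialDiv c ψ (c + r • d)‖ₑ := by
    rw [← ofReal_norm, ← ofReal_norm, intervalIntegral.norm_intervalIntegral_eq]
  rw [h1, h2]
  refine (enorm_integral_le_lintegral_enorm _).trans ?_
  rw [← lintegral_indicator measurableSet_uIoc]
  refine lintegral_mono_ae ?_
  filter_upwards [compl_mem_ae_iff.2 (measure_singleton R)] with r hr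
  by_cases hrm : r ∈ uIoc 0 R
  swap
  · rw [indicator_of_notMem hrm]; exact zero_le
  rw [indicator_of_mem hrm]
  have hmem : c + r • d ∈ Ω := by
    have hq : 0 ≤ r / R ∧ r / R < 1 := by
      rcases lt_or_gt_of_ne hR0 with hneg | hpos
      · rw [uIoc_of_ge hneg.le] at hrm
        refine ⟨div_nonneg_of_nonpos hrm.2 hneg.le, ?_⟩
        rw [div_lt_one_of_neg hneg]
        exact hrm.1
      · rw [uIoc_of_le hpos.le] at hrm
        refine ⟨div_nonneg hrm.1.le hpos.le, ?_⟩
        rw [div_lt_one hpos]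
        exact lt_of_le_of_ne hrm.2 hr
    have := h.mem_of_mem_closure (frontier_subset_closure hR) (Metric.mem_ball_self h.pos)
      hq.1 hq.2
    rwa [add_sub_cancel_left, smul_smul, div_mul_cancel₀ _ hR0] at this
  rw [indicator_of_mem hmem, enorm_smul, Real.enorm_eq_ofReal (sq_nonneg r)]

theorem frontier_subset_iUnion_face (h : IsStarDomain Ω c ρ M) :
    frontier Ω ⊆ ⋃ p : Fin 3 × Bool, face Ω c p.1 (if p.2 then 1 else -1) := by
  intro x hx
  have hx0 : x - c ≠ 0 := by
    have := h.le_norm_of_mem_frontier hx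
    have := h.pos
    exact norm_pos_iff.1 (by linarith)
  obtain ⟨i, hi⟩ := exists_mem_cone hx0
  rw [mem_iUnion]
  rcases lt_or_gt_of_ne hi.1 with hneg | hpos
  · exact ⟨(i, false), hx, hi, by simpa using hneg⟩
  · exact ⟨(i, true), hx, hi, by simpa using hpos⟩

theorem lintegral_surface_le_sum (h : IsStarDomain Ω c ρ M) (f : E3 → ℝ≥0∞) :
    ∫⁻ x, f x ∂surfaceMeasure Ω ≤
      ∑ p : Fin 3 × Bool, ∫⁻ x in face Ω c p.1 (if p.2 then 1 else -1), f x ∂surfaceMeasure Ω := by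
  have h1 : surfaceMeasure Ω = (surfaceMeasure Ω).restrict (frontier Ω) := by
    rw [surfaceMeasure, Measure.restrict_restrict isClosed_frontier.measurableSet, inter_self]
  conv_lhs => rw [h1]
  refine (lintegral_mono_set h.frontier_subset_iUnion_face).trans ?_
  refine (lintegral_iUnion_le _ _).trans ?_
  rw [tsum_fintype]

/-- The integral of a `C¹` function over the boundary is controlled by the integral over the domain
of the divergence of its product with the radial field. -/
theorem exists_lintegral_surface_le (h : IsStarDomain Ω c ρ M) : ∃ K : NNReal, ∀ ψ : E3 → ℂ,
    ContDiff ℝ 1 ψ → ∫⁻ x, ‖ψ x‖ₑ ∂surfaceMeasure Ω ≤ K * ∫⁻ x in Ω, ‖radialDiv c ψ x‖ₑ := by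
  obtain ⟨K, hK⟩ := h.exists_map_slope_le
  have hρ := h.pos
  -- On a face, `ρ ≤ ‖x - c‖ ≤ 2 |(x - c) i|`, so `k` bounds the parameter of the boundary point
  -- from below. The factor `6` below counts the faces.
  set k : NNReal := Real.toNNReal (ρ / 2) with hk
  have hk0 : 0 < k := by rw [hk, Real.toNNReal_pos]; positivity
  refine ⟨6 * ((k ^ 3)⁻¹ * K), fun ψ hψ => ?_⟩
  set F : E3 → ℝ≥0∞ := Ω.indicator (fun x => ‖radialDiv c ψ x‖ₑ) with hF
  have hFm : Measurable F :=
    (continuous_radialDiv c hψ).measurable.enorm.indicator h.isOpen.measurableSet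
  have hface : ∀ i e, ∫⁻ x in face Ω c i e, ‖ψ x‖ₑ ∂surfaceMeasure Ω ≤
      (((k ^ 3)⁻¹ * K : NNReal) : ℝ≥0∞) * ∫⁻ x in Ω, ‖radialDiv c ψ x‖ₑ := by
    intro i e
    set G : (Fin 2 → ℝ) → ℝ≥0∞ := fun s =>
      ∫⁻ r : ℝ, ENNReal.ofReal (r ^ 2) * F (c + r • dir i s) with hG
    have hmd : Measurable fun p : (Fin 2 → ℝ) × ℝ => c + p.2 • dir i p.1 :=
      measurable_const.add (measurable_snd.smul ((measurable_dir i).comp measurable_fst))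
    have hGm : Measurable G :=
      Measurable.lintegral_prod_right' (f := fun p : (Fin 2 → ℝ) × ℝ =>
        ENNReal.ofReal (p.2 ^ 2) * F (c + p.2 • dir i p.1))
        (Measurable.mul (by fun_prop) (hFm.comp hmd))
    have hms : Measurable fun x : E3 => slope i (x - c) := (measurable_slope i).comp (by fun_prop)
    have hpt : ∀ x ∈ face Ω c i e, ‖ψ x‖ₑ ≤ ((k ^ 3)⁻¹ : NNReal) * G (slope i (x - c)) := by
      rintro x ⟨hxΓ, hxc, -⟩
      have hxe : x = c + (x - c) i • dir i (slope i (x - c)) := by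
        rw [smul_dir_slope i hxc.1, add_sub_cancel]
      have h1 := h.enorm_cube_mul_le hψ (R := (x - c) i) (d := dir i (slope i (x - c)))
        (hxe ▸ hxΓ)
      rw [← hxe] at h1
      have h2 : (k : ℝ≥0∞) ≤ ‖(x - c) i‖ₑ := by
        rw [hk, ← ofReal_norm]
        refine ENNReal.ofReal_le_ofReal ?_
        have := (h.le_norm_of_mem_frontier hxΓ).trans (norm_le_two_mul_abs hxc)
        rw [Real.norm_eq_abs]
        linarith
      have h3 : (k : ℝ≥0∞) ^ 3 * ‖ψ x‖ₑ ≤ G (slope i (x - c)) :=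
        le_trans (by gcongr) h1
      calc ‖ψ x‖ₑ = ((k ^ 3)⁻¹ : NNReal) * ((k : ℝ≥0∞) ^ 3 * ‖ψ x‖ₑ) := by
            rw [← mul_assoc, ← ENNReal.coe_pow, ← ENNReal.coe_mul,
              inv_mul_cancel₀ (by positivity), ENNReal.coe_one, one_mul]
        _ ≤ _ := by gcongr
    calc ∫⁻ x in face Ω c i e, ‖ψ x‖ₑ ∂surfaceMeasure Ω
        ≤ ∫⁻ x in face Ω c i e, ((k ^ 3)⁻¹ : NNReal) * G (slope i (x - c)) ∂surfaceMeasure Ω :=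
          setLIntegral_mono' (measurableSet_face Ω c i e) hpt
      _ = ((k ^ 3)⁻¹ : NNReal) * ∫⁻ x in face Ω c i e, G (slope i (x - c)) ∂surfaceMeasure Ω :=
          lintegral_const_mul _ (hGm.comp hms)
      _ = ((k ^ 3)⁻¹ : NNReal) * ∫⁻ s, G s ∂(((surfaceMeasure Ω).restrict (face Ω c i e)).map
            (fun x => slope i (x - c))) := by rw [lintegral_map hGm hms]
      _ ≤ ((k ^ 3)⁻¹ : NNReal) * ∫⁻ s, G s ∂((K : ℝ≥0∞) • volume.restrict (slopes i)) := by
          gcongr; exact hK i e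
      _ = (((k ^ 3)⁻¹ * K : NNReal) : ℝ≥0∞) * ∫⁻ x in {x | x - c ∈ cone i}, F x := by
          rw [lintegral_smul_measure, lintegral_cone c i hFm, smul_eq_mul, ← mul_assoc,
            ENNReal.coe_mul]
      _ ≤ (((k ^ 3)⁻¹ * K : NNReal) : ℝ≥0∞) * ∫⁻ x, F x := by
          gcongr; exact Measure.restrict_le_self
      _ = _ := by rw [hF, lintegral_indicator h.isOpen.measurableSet]
  calc ∫⁻ x, ‖ψ x‖ₑ ∂surfaceMeasure Ω
      ≤ ∑ p : Fin 3 × Bool, ∫⁻ x in face Ω c p.1 (if p.2 then 1 else -1),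
          ‖ψ x‖ₑ ∂surfaceMeasure Ω := h.lintegral_surface_le_sum _
    _ ≤ ∑ _p : Fin 3 × Bool, (((k ^ 3)⁻¹ * K : NNReal) : ℝ≥0∞) *
          ∫⁻ x in Ω, ‖radialDiv c ψ x‖ₑ := Finset.sum_le_sum fun p _ => hface _ _
    _ = _ := by
        rw [Finset.sum_const, Finset.card_univ, Fintype.card_prod, Fintype.card_fin,
          Fintype.card_bool, nsmul_eq_mul]
        push_cast
        ring

/-- The case `ψ = 1`, whose radial divergence is the constant `3` on a bounded set. -/
theorem isFiniteMeasure_surfaceMeasure (h : IsStarDomain Ω c ρ M) :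
    IsFiniteMeasure (surfaceMeasure Ω) := by
  obtain ⟨K, hK⟩ := h.exists_lintegral_surface_le
  have h1 := hK (fun _ => 1) contDiff_const
  simp only [enorm_one, lintegral_const, one_mul, radialDiv, fderiv_fun_const, Pi.zero_apply,
    zero_apply, mul_one, add_zero] at h1
  refine ⟨h1.trans_lt ?_⟩
  rw [Measure.restrict_apply_univ]
  have := h.isBounded.measure_lt_top (μ := volume)
  exact ENNReal.mul_lt_top ENNReal.coe_lt_top (ENNReal.mul_lt_top (by simp) this)

/-- The integral over the domain of the divergence of the product of a `C¹` function with the radial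
field is controlled by the boundary values of the function. -/
theorem exists_enorm_integral_radialDiv_le (h : IsStarDomain Ω c ρ M) :
    ∃ K : NNReal, ∀ ψ : E3 → ℂ, ContDiff ℝ 1 ψ →
      ‖∫ x in Ω, radialDiv c ψ x‖ₑ ≤ K * ∫⁻ x, ‖ψ x‖ₑ ∂surfaceMeasure Ω := by
  obtain ⟨K, hK⟩ := h.exists_le_map_slope
  set m : NNReal := Real.toNNReal M with hm
  refine ⟨6 * (m ^ 3 * K), fun ψ hψ => ?_⟩
  have hmc : ∀ i, MeasurableSet {x : E3 | x - c ∈ cone i} := fun i =>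
    (show Measurable fun x : E3 => x - c by fun_prop) (measurableSet_cone i)
  have hcontV := continuous_radialDiv c hψ
  have hint : IntegrableOn (radialDiv c ψ) Ω :=
    (hcontV.continuousOn.integrableOn_compact h.isBounded.isCompact_closure).mono_set subset_closure
  have hsplit : ∫ x in Ω, radialDiv c ψ x =
      ∑ i, ∫ x in Ω ∩ {x | x - c ∈ cone i}, radialDiv c ψ x := by
    -- The cones cover everything but the centre, a null set.
    have hae : Ω =ᵐ[volume] ⋃ i, Ω ∩ {x : E3 | x - c ∈ cone i} := by
      refine eventuallyEq_set.2 ?_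
      filter_upwards [compl_mem_ae_iff.2 (measure_singleton c)] with x hx
      rw [mem_iUnion]
      refine ⟨fun hxΩ => ?_, fun ⟨i, hi⟩ => hi.1⟩
      obtain ⟨i, hi⟩ := exists_mem_cone (sub_ne_zero.2 hx)
      exact ⟨i, hxΩ, hi⟩
    rw [setIntegral_congr_set hae, integral_iUnion_fintype]
    · exact fun i => h.isOpen.measurableSet.inter (hmc i)
    · intro i j hij
      refine Set.disjoint_left.2 fun x hx hx' => ?_
      exact Set.disjoint_left.1 (disjoint_cone hij) hx.2 hx'.2
    · exact fun i => hint.mono_set inter_subset_left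
  have hcone : ∀ i, ‖∫ x in Ω ∩ {x | x - c ∈ cone i}, radialDiv c ψ x‖ₑ ≤
      2 * ((m ^ 3 * K : NNReal) : ℝ≥0∞) * ∫⁻ x, ‖ψ x‖ₑ ∂surfaceMeasure Ω := by
    intro i
    have hms : Measurable fun x : E3 => slope i (x - c) := (measurable_slope i).comp (by fun_prop)
    -- For `e = 1` and `e = -1` these are the exit parameters of the two half-lines of slope `s`;
    -- the line meets `Ω` between `-R (-1)` and `R 1`, and the integral over it reduces to two
    -- boundary values.
    choose R hR hRΓ hRΩ using fun (e : ℝ) (he : e ≠ 0) (s : Fin 2 → ℝ) =>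
      h.exists_frontier_ray (d := e • dir i s) (smul_ne_zero he (dir_ne_zero i s))
    set P : ℝ → (Fin 2 → ℝ) → ℝ≥0∞ := fun e s =>
      if he : e ≠ 0 then ‖ψ (c + R e he s • e • dir i s)‖ₑ else 0 with hP
    have hone : (1 : ℝ) ≠ 0 := one_ne_zero
    have hneg : (-1 : ℝ) ≠ 0 := by norm_num
    have hRm : ∀ (e : ℝ) (he : e ≠ 0), |e| = 1 → ∀ s, ‖R e he s‖ₑ ≤ m := by
      intro e he he1 s
      rw [← ofReal_norm, hm]
      refine ENNReal.ofReal_le_ofReal ?_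
      have h1 := h.norm_le_of_mem_frontier (hRΓ e he s)
      rw [add_sub_cancel_left, norm_smul, norm_smul, Real.norm_eq_abs e, he1, one_mul] at h1
      refine le_trans ?_ h1
      refine le_mul_of_one_le_right (norm_nonneg _) ?_
      have := abs_coord_le_norm (dir i s) i
      simpa using this
    have hinner : ∀ s ∈ slopes i, ‖∫ r : ℝ, (r ^ 2) •
        (Ω ∩ {x | x - c ∈ cone i}).indicator (radialDiv c ψ) (c + r • dir i s)‖ₑ ≤
        (m : ℝ≥0∞) ^ 3 * (P 1 s + P (-1) s) := by
      intro s hs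
      have hset : ∀ r : ℝ, r ≠ 0 → (c + r • dir i s ∈ Ω ∩ {x | x - c ∈ cone i} ↔
          r ∈ Ioo (-(R (-1) hneg s)) (R 1 hone s)) := by
        intro r hr
        have hc : c + r • dir i s ∈ {x | x - c ∈ cone i} := by
          simpa using (smul_mem_cone hr).2 hs
        rw [mem_inter_iff, and_iff_left hc]
        rcases le_total 0 r with h0 | h0
        · have h1 := hRΩ 1 hone s r h0
          rw [one_smul] at h1
          rw [h1]
          have := hR (-1) hneg s
          exact ⟨fun hlt => ⟨by linarith, hlt⟩, fun hlt => hlt.2⟩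
        · have h1 := hRΩ (-1) hneg s (-r) (by linarith)
          rw [neg_one_smul, smul_neg, neg_smul, neg_neg] at h1
          rw [h1]
          have := hR 1 hone s
          exact ⟨fun hlt => ⟨by linarith, by linarith⟩, fun hlt => by linarith [hlt.1]⟩
      have h1 : ∫ r : ℝ, (r ^ 2) •
          (Ω ∩ {x | x - c ∈ cone i}).indicator (radialDiv c ψ) (c + r • dir i s) =
          ∫ r in (-(R (-1) hneg s))..(R 1 hone s), (r ^ 2) • radialDiv c ψ (c + r • dir i s) := by
        have := hR (-1) hneg s
        have := hR 1 hone s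
        rw [intervalIntegral.integral_of_le (by linarith), integral_Ioc_eq_integral_Ioo,
          ← integral_indicator measurableSet_Ioo]
        refine integral_congr_ae ?_
        filter_upwards [compl_mem_ae_iff.2 (measure_singleton (0 : ℝ))] with r hr
        by_cases hmem : r ∈ Ioo (-(R (-1) hneg s)) (R 1 hone s)
        · rw [indicator_of_mem ((hset r hr).2 hmem), indicator_of_mem hmem]
        · rw [indicator_of_notMem (fun hh => hmem ((hset r hr).1 hh)), indicator_of_notMem hmem,
            smul_zero]
      rw [h1, integral_sq_smul_radialDiv c _ hψ, mul_add]
      refine enorm_sub_le.trans ?_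
      rw [enorm_smul, enorm_smul, enorm_pow, enorm_pow, enorm_neg]
      refine add_le_add (mul_le_mul' ?_ ?_) (mul_le_mul' ?_ ?_)
      · exact pow_le_pow_left' (hRm 1 hone (by simp) s) 3
      · simp [hP]
      · exact pow_le_pow_left' (hRm (-1) hneg (by simp) s) 3
      · simp [hP]
    have hPface : ∀ e : ℝ, e ≠ 0 → ∫⁻ s in slopes i, P e s ≤
        K * ∫⁻ x, ‖ψ x‖ₑ ∂surfaceMeasure Ω := by
      intro e he
      -- A point of the face is the exit point of its own half-line, by uniqueness of the
      -- intersection with the boundary.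
      have hPψ : ∀ x ∈ face Ω c i e, P e (slope i (x - c)) = ‖ψ x‖ₑ := by
        rintro x ⟨hxΓ, hxc, hxe⟩
        have hxd : c + (e⁻¹ * (x - c) i) • e • dir i (slope i (x - c)) = x := by
          rw [smul_smul, mul_right_comm, inv_mul_cancel₀ he, one_mul, smul_dir_slope i hxc.1,
            add_sub_cancel]
        have hpos : 0 < e⁻¹ * (x - c) i := by
          have : e⁻¹ * (x - c) i = (e⁻¹) ^ 2 * (e * (x - c) i) := by field_simp
          rw [this]
          exact mul_pos (by positivity) hxe
        have h1 := hRΩ e he (slope i (x - c)) (e⁻¹ * (x - c) i) hpos.le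
        rw [hxd] at h1
        have h2 : R e he (slope i (x - c)) ≤ e⁻¹ * (x - c) i :=
          not_lt.1 fun hlt => h.notMem_of_mem_frontier hxΓ (h1.2 hlt)
        have h3 : R e he (slope i (x - c)) = e⁻¹ * (x - c) i := by
          refine h2.antisymm (not_lt.1 fun hlt => ?_)
          refine h.notMem_of_mem_frontier (hRΓ e he (slope i (x - c))) ?_
          have h4 := h.mem_of_mem_closure (frontier_subset_closure hxΓ)
            (Metric.mem_ball_self h.pos)
            (t := R e he (slope i (x - c)) / (e⁻¹ * (x - c) i))
            (div_nonneg (hR _ _ _).le hpos.le) (by rwa [div_lt_one hpos])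
          have h5 : (R e he (slope i (x - c)) / (e⁻¹ * (x - c) i)) • (x - c) =
              R e he (slope i (x - c)) • e • dir i (slope i (x - c)) := by
            rw [← div_mul_cancel₀ (R e he (slope i (x - c))) hpos.ne', mul_smul,
              mul_div_cancel_right₀ _ hpos.ne']
            exact congrArg _ (eq_sub_iff_add_eq'.2 hxd).symm
          rwa [h5] at h4
        simp only [hP, dif_pos he]
        rw [h3, hxd]
      calc ∫⁻ s in slopes i, P e s
          ≤ ∫⁻ s, P e s ∂((K : ℝ≥0∞) • ((surfaceMeasure Ω).restrict (face Ω c i e)).map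
              (fun x => slope i (x - c))) := lintegral_mono' (hK i e he) le_rfl
        _ = K * ∫⁻ s, P e s ∂(((surfaceMeasure Ω).restrict (face Ω c i e)).map
              (fun x => slope i (x - c))) := by rw [lintegral_smul_measure, smul_eq_mul]
        _ ≤ K * ∫⁻ x in face Ω c i e, P e (slope i (x - c)) ∂surfaceMeasure Ω := by
            gcongr; exact lintegral_map_le _ _
        _ = K * ∫⁻ x in face Ω c i e, ‖ψ x‖ₑ ∂surfaceMeasure Ω := by
            rw [setLIntegral_congr_fun (measurableSet_face Ω c i e) hPψ]
        _ ≤ _ := by gcongr; exact Measure.restrict_le_self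
    have hint' : Integrable ((Ω ∩ {x | x - c ∈ cone i}).indicator (radialDiv c ψ)) :=
      (integrable_indicator_iff (h.isOpen.measurableSet.inter (hmc i))).2
        (hint.mono_set inter_subset_left)
    -- The set where the exit parameter exceeds `r ≥ 0` is the set of slopes with `c + r • dir i s ∈
    -- Ω`. One measurable summand suffices to split the integral, so `R (-1)` needs no such
    -- argument.
    have hRmeas : Measurable (R 1 hone) := by
      refine measurable_of_Ioi fun r => ?_
      rcases le_or_gt 0 r with h0 | h0
      · have : R 1 hone ⁻¹' Ioi r = {s | c + r • (1 : ℝ) • dir i s ∈ Ω} := by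
          ext s; exact (hRΩ 1 hone s r h0).symm
        rw [this]
        exact (measurable_const.add (((measurable_dir i).const_smul (1 : ℝ)).const_smul r))
          h.isOpen.measurableSet
      · have : R 1 hone ⁻¹' Ioi r = univ :=
          eq_univ_of_forall fun s => h0.trans (hR 1 hone s)
        rw [this]; exact MeasurableSet.univ
    have hPm : Measurable (P 1) := by
      simp only [hP, dif_pos hone]
      exact (hψ.continuous.measurable.comp (measurable_const.add
        (hRmeas.smul ((measurable_dir i).const_smul (1 : ℝ))))).enorm
    calc ‖∫ x in Ω ∩ {x | x - c ∈ cone i}, radialDiv c ψ x‖ₑ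
        = ‖∫ x, (Ω ∩ {x | x - c ∈ cone i}).indicator (radialDiv c ψ) x‖ₑ := by
          rw [integral_indicator (h.isOpen.measurableSet.inter (hmc i))]
      _ ≤ ∫⁻ s : Fin 2 → ℝ, ‖∫ r : ℝ, (r ^ 2) •
            (Ω ∩ {x | x - c ∈ cone i}).indicator (radialDiv c ψ) (c + r • dir i s)‖ₑ :=
          enorm_integral_le_lintegral_dir c i hint'
      _ ≤ ∫⁻ s : Fin 2 → ℝ, (slopes i).indicator
            (fun s => (m : ℝ≥0∞) ^ 3 * (P 1 s + P (-1) s)) s := by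
          refine lintegral_mono fun s => ?_
          by_cases hs : s ∈ slopes i
          · rw [indicator_of_mem hs]; exact hinner s hs
          · rw [indicator_of_notMem hs, integral_eq_zero_of_ae, enorm_zero]
            filter_upwards [compl_mem_ae_iff.2 (measure_singleton (0 : ℝ))] with r hr
            rw [indicator_of_notMem, smul_zero, Pi.zero_apply]
            rintro ⟨-, hh⟩
            refine hs ((smul_mem_cone hr).1 ?_)
            simpa using hh
      _ = (m : ℝ≥0∞) ^ 3 * ∫⁻ s in slopes i, (P 1 s + P (-1) s) := by
          rw [lintegral_indicator (measurableSet_slopes i),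
            lintegral_const_mul' _ _ (by simp)]
      _ ≤ _ := by
          rw [lintegral_add_left hPm]
          calc _ ≤ (m : ℝ≥0∞) ^ 3 * (K * ∫⁻ x, ‖ψ x‖ₑ ∂surfaceMeasure Ω +
                K * ∫⁻ x, ‖ψ x‖ₑ ∂surfaceMeasure Ω) := by
                gcongr
                · exact hPface 1 hone
                · exact hPface (-1) hneg
            _ = _ := by push_cast; ring
  calc ‖∫ x in Ω, radialDiv c ψ x‖ₑ
      ≤ ∑ i : Fin 3, ‖∫ x in Ω ∩ {x | x - c ∈ cone i}, radialDiv c ψ x‖ₑ := by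
        rw [hsplit]; exact enorm_sum_le _ _
    _ ≤ ∑ _i : Fin 3, 2 * ((m ^ 3 * K : NNReal) : ℝ≥0∞) * ∫⁻ x, ‖ψ x‖ₑ ∂surfaceMeasure Ω :=
        Finset.sum_le_sum fun i _ => hcone i
    _ = _ := by
        rw [Finset.sum_const, Finset.card_univ, Fintype.card_fin, nsmul_eq_mul]
        push_cast
        ring

end IsStarDomain

end HelmholtzRobin

/-! ### `H¹(Ω)` as a Hilbert space, and smooth functions in it. -/

namespace HelmholtzRobin

variable {Ω : Set E3}

/-- `toL2` as a continuous linear map. -/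
noncomputable def toL2L (Ω : Set E3) : H1 Ω →L[ℂ] L2 Ω :=
  WithLp.fstL 2 ℂ (L2 Ω) (L2Vec Ω) ∘L (H1 Ω).subtypeL

/-- `grad` as a continuous linear map. -/
noncomputable def gradL (Ω : Set E3) : H1 Ω →L[ℂ] L2Vec Ω :=
  WithLp.sndL 2 ℂ (L2 Ω) (L2Vec Ω) ∘L (H1 Ω).subtypeL

theorem toL2L_apply (u : H1 Ω) : toL2L Ω u = toL2 u := rfl

theorem gradL_apply (u : H1 Ω) : gradL Ω u = grad u := rfl

/-- The `i`-th component of an `L²` vector field. -/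
noncomputable def comp (Ω : Set E3) (i : Fin 3) : L2Vec Ω →L[ℂ] L2 Ω :=
  (EuclideanSpace.proj (𝕜 := ℂ) i).compLpL 2 (volume.restrict Ω)

theorem coeFn_comp (i : Fin 3) (g : L2Vec Ω) :
    comp Ω i g =ᵐ[volume.restrict Ω] fun x => g x i :=
  (EuclideanSpace.proj (𝕜 := ℂ) i).coeFn_compLpL g

theorem inner_eq_sum_comp (g g' : L2Vec Ω) :
    inner ℂ g g' = ∑ i, inner ℂ (comp Ω i g) (comp Ω i g') := by
  simp only [MeasureTheory.L2.inner_def]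
  rw [← integral_finsetSum]
  · refine integral_congr_ae ?_
    filter_upwards [coeFn_comp 0 g, coeFn_comp 1 g, coeFn_comp 2 g, coeFn_comp 0 g',
      coeFn_comp 1 g', coeFn_comp 2 g'] with x h0 h1 h2 h3 h4 h5
    rw [PiLp.inner_apply, Fin.sum_univ_three, Fin.sum_univ_three, h0, h1, h2, h3, h4, h5]
  · exact fun i _ => L2.integrable_inner _ _

theorem norm_sq_eq_sum_comp (g : L2Vec Ω) : ‖g‖ ^ 2 = ∑ i, ‖comp Ω i g‖ ^ 2 := by
  have h := inner_eq_sum_comp g g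
  simp only [inner_self_eq_norm_sq_to_K] at h
  exact_mod_cast h

theorem norm_sq_H1 (u : H1 Ω) : ‖u‖ ^ 2 = ‖toL2 u‖ ^ 2 + ‖grad u‖ ^ 2 :=
  WithLp.prod_norm_sq_eq_of_L2 _

theorem isWeakGrad_iff_forall_comp (p : WithLp 2 (L2 Ω × L2Vec Ω)) :
    p ∈ H1 Ω ↔ ∀ φ : E3 → ℝ, ContDiff ℝ ∞ φ → HasCompactSupport φ → tsupport φ ⊆ Ω → ∀ i : Fin 3,
      ∫ x in Ω, (fderiv ℝ φ x (EuclideanSpace.single i (1 : ℝ))) • p.fst x =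
        -∫ x in Ω, φ x • comp Ω i p.snd x := by
  change IsWeakGrad Ω p.fst p.snd ↔ _
  have h : ∀ (φ : E3 → ℝ) (i : Fin 3), ∫ x in Ω, φ x • comp Ω i p.snd x =
      ∫ x in Ω, φ x • p.snd x i := fun φ i => by
    refine integral_congr_ae ?_
    filter_upwards [coeFn_comp i p.snd] with x hx
    rw [hx]
  simp only [IsWeakGrad, h]

/-- Integration against a test function, as a continuous functional. -/
theorem continuous_integral_smul {ψ : E3 → ℝ} (hψ : Continuous ψ) (hc : HasCompactSupport ψ) :
    Continuous fun u : L2 Ω => ∫ x in Ω, ψ x • u x := by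
  have hm : MemLp (fun x => (ψ x : ℂ)) 2 (volume.restrict Ω) :=
    (hψ.memLp_of_hasCompactSupport hc).ofReal
  have h : (fun u : L2 Ω => ∫ x in Ω, ψ x • u x) = fun u => inner ℂ hm.toLp u := by
    funext u
    rw [MeasureTheory.L2.inner_def]
    refine integral_congr_ae ?_
    filter_upwards [hm.coeFn_toLp] with x hx
    rw [hx, RCLike.inner_apply, Complex.conj_ofReal, Complex.real_smul, mul_comm]
  rw [h]
  fun_prop

/-- Each defining equation of a weak gradient pairs `L²` components with compactly supported
continuous functions, so both sides are continuous. Completeness of `H1 Ω` follows. -/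
theorem isClosed_H1 (Ω : Set E3) : IsClosed (H1 Ω : Set (WithLp 2 (L2 Ω × L2Vec Ω))) := by
  have h : (H1 Ω : Set (WithLp 2 (L2 Ω × L2Vec Ω))) = ⋂ (φ : E3 → ℝ) (_ : ContDiff ℝ ∞ φ)
      (_ : HasCompactSupport φ) (_ : tsupport φ ⊆ Ω) (i : Fin 3),
      {p | ∫ x in Ω, (fderiv ℝ φ x (EuclideanSpace.single i (1 : ℝ))) • p.fst x =
        -∫ x in Ω, φ x • comp Ω i p.snd x} := by
    ext p
    simp only [mem_iInter, SetLike.mem_coe, isWeakGrad_iff_forall_comp, mem_ofPred_eq]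
  rw [h]
  refine isClosed_iInter fun φ => isClosed_iInter fun hφ => isClosed_iInter fun hc =>
    isClosed_iInter fun _ => isClosed_iInter fun i => isClosed_eq ?_ ?_
  · refine (continuous_integral_smul (Ω := Ω)
      (ψ := fun x => fderiv ℝ φ x (EuclideanSpace.single i (1 : ℝ))) ?_ ?_).comp
      (WithLp.fstL 2 ℂ (L2 Ω) (L2Vec Ω)).continuous
    · exact (hφ.continuous_fderiv (by simp)).clm_apply continuous_const
    · exact hc.fderiv_apply ℝ _
  · exact ((continuous_integral_smul (Ω := Ω) hφ.continuous hc).comp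
      ((comp Ω i).continuous.comp (WithLp.sndL 2 ℂ (L2 Ω) (L2Vec Ω)).continuous)).neg

instance instCompleteSpaceH1 (Ω : Set E3) : CompleteSpace (H1 Ω) :=
  (isClosed_H1 Ω).completeSpace_coe

/-- Weak gradients are unique. -/
theorem H1.ext_of_toL2_eq (hΩ : IsOpen Ω) {u v : H1 Ω} (h : toL2 u = toL2 v) : u = v := by
  have hw : toL2 (u - v) = 0 := by
    rw [← toL2L_apply, map_sub, toL2L_apply, toL2L_apply, h, sub_self]
  set w := u - v with hwdef
  have hcomp : ∀ i, comp Ω i (grad w) = 0 := by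
    intro i
    have hloc : LocallyIntegrableOn (comp Ω i (grad w)) Ω := by
      have h2 : MemLp (comp Ω i (grad w)) 2 (volume.restrict Ω) := Lp.memLp _
      intro x hx
      obtain ⟨r, hr, hrΩ⟩ := Metric.isOpen_iff.1 hΩ x hx
      refine ⟨Metric.ball x r, mem_nhdsWithin_of_mem_nhds (Metric.ball_mem_nhds x hr), ?_⟩
      have h3 := h2.restrict (Metric.ball x r)
      rw [Measure.restrict_restrict Metric.isOpen_ball.measurableSet,
        inter_eq_left.2 hrΩ] at h3
      have : IsFiniteMeasure (volume.restrict (Metric.ball x r)) :=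
        ⟨by rw [Measure.restrict_apply_univ]; exact measure_ball_lt_top⟩
      exact h3.integrable (by norm_num)
    have hz := hΩ.ae_eq_zero_of_integral_contDiff_smul_eq_zero hloc (fun φ hφ hc hs => by
      have h1 := (isWeakGrad_iff_forall_comp (w : WithLp 2 (L2 Ω × L2Vec Ω))).1 w.2 φ hφ hc hs i
      have h2 : ∫ x in Ω, (fderiv ℝ φ x (EuclideanSpace.single i (1 : ℝ))) •
          (w : WithLp 2 (L2 Ω × L2Vec Ω)).fst x = 0 := by
        refine integral_eq_zero_of_ae ?_
        change toL2 w = 0 at hw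
        change (fun x => (fderiv ℝ φ x (EuclideanSpace.single i (1 : ℝ))) • toL2 w x)
          =ᵐ[volume.restrict Ω] 0
        rw [hw]
        filter_upwards [Lp.coeFn_zero ℂ 2 (volume.restrict Ω)] with x hx
        rw [hx, Pi.zero_apply, smul_zero]
      rw [h2] at h1
      have h3 : ∫ x in Ω, φ x • comp Ω i (grad w) x = 0 := neg_eq_zero.1 h1.symm
      rw [← h3]
      refine (setIntegral_eq_integral_of_forall_compl_eq_zero fun x hx => ?_).symm
      rw [image_eq_zero_of_notMem_tsupport fun hh => hx (hs hh), zero_smul])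
    apply Lp.ext
    filter_upwards [(ae_restrict_iff' hΩ.measurableSet).2 hz,
      Lp.coeFn_zero ℂ 2 (volume.restrict Ω)] with x h1 h2
    rw [h1, h2, Pi.zero_apply]
  have hg : ‖grad w‖ ^ 2 = 0 := by simp [norm_sq_eq_sum_comp, hcomp]
  have : ‖w‖ ^ 2 = 0 := by rw [norm_sq_H1, hg, hw]; simp
  rw [← sub_eq_zero]
  simpa using this

/-- The gradient of a differentiable function. -/
noncomputable def classicalGrad (φ : E3 → ℂ) (x : E3) : EuclideanSpace ℂ (Fin 3) :=
  WithLp.toLp 2 fun i => fderiv ℝ φ x (EuclideanSpace.single i (1 : ℝ))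

theorem continuous_classicalGrad {φ : E3 → ℂ} (hφ : ContDiff ℝ 1 φ) :
    Continuous (classicalGrad φ) :=
  (PiLp.continuous_toLp 2 _).comp (continuous_pi fun _ =>
    (hφ.continuous_fderiv one_ne_zero).clm_apply continuous_const)

theorem norm_fderiv_apply_le (φ : E3 → ℂ) (x v : E3) :
    ‖fderiv ℝ φ x v‖ ≤ ‖classicalGrad φ x‖ * ‖v‖ := by
  have hv : v = ∑ i, v i • EuclideanSpace.single i (1 : ℝ) := by
    ext j
    simp [Pi.single_apply]
  have h1 : fderiv ℝ φ x v = ∑ i, v i • fderiv ℝ φ x (EuclideanSpace.single i (1 : ℝ)) := by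
    conv_lhs => rw [hv]
    simp
  rw [h1]
  calc ‖∑ i, v i • fderiv ℝ φ x (EuclideanSpace.single i (1 : ℝ))‖
      ≤ ∑ i, ‖classicalGrad φ x i‖ * ‖v i‖ := by
        refine (norm_sum_le _ _).trans (Finset.sum_le_sum fun i _ => ?_)
        rw [norm_smul, mul_comm]; rfl
    _ ≤ _ := by
        rw [EuclideanSpace.norm_eq, EuclideanSpace.norm_eq]
        exact Real.sum_mul_le_sqrt_mul_sqrt _ _ _

theorem memLp_restrict_of_continuous (hb : Bornology.IsBounded Ω) {F : Type*}
    [NormedAddCommGroup F] [SecondCountableTopologyEither E3 F] {φ : E3 → F} (hφ : Continuous φ) :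
    MemLp φ 2 (volume.restrict Ω) := by
  have hfin : IsFiniteMeasure (volume.restrict (closure Ω)) :=
    ⟨by rw [Measure.restrict_apply_univ]; exact hb.isCompact_closure.measure_lt_top⟩
  obtain ⟨C, hC⟩ := hb.isCompact_closure.exists_bound_of_continuousOn hφ.continuousOn
  have h : MemLp φ 2 (volume.restrict (closure Ω)) :=
    MemLp.of_bound hφ.aestronglyMeasurable C
      ((ae_restrict_iff' isClosed_closure.measurableSet).2 (Eventually.of_forall hC))
  exact h.mono_measure (Measure.restrict_mono subset_closure le_rfl)

/-- The space of smooth functions. -/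
def smoothFun : Submodule ℂ (E3 → ℂ) where
  carrier := {φ | ContDiff ℝ ∞ φ}
  zero_mem' := (contDiff_const : ContDiff ℝ ∞ fun _ : E3 => (0 : ℂ))
  add_mem' := fun {f g} (hf : ContDiff ℝ ∞ f) (hg : ContDiff ℝ ∞ g) => hf.add hg
  smul_mem' := fun c f (hf : ContDiff ℝ ∞ f) => hf.const_smul c

theorem smoothFun_contDiff (φ : smoothFun) : ContDiff ℝ ∞ (φ : E3 → ℂ) := φ.2

theorem smoothFun_continuous (φ : smoothFun) : Continuous (φ : E3 → ℂ) := (smoothFun_contDiff φ).continuous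

theorem smoothFun_continuous_classicalGrad (φ : smoothFun) : Continuous (classicalGrad φ) :=
  HelmholtzRobin.continuous_classicalGrad ((smoothFun_contDiff φ).of_le (by simp))

theorem isWeakGrad_classicalGrad {φ : E3 → ℂ} (hφ : ContDiff ℝ ∞ φ) :
    IsWeakGrad Ω φ (classicalGrad φ) := by
  intro ψ hψ hc hs i
  set e := EuclideanSpace.single (𝕜 := ℝ) i (1 : ℝ)
  have hφ1 : Continuous fun x => fderiv ℝ φ x e :=
    (hφ.continuous_fderiv (by simp)).clm_apply continuous_const
  have hψ1 : Continuous fun x => fderiv ℝ ψ x e :=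
    (hψ.continuous_fderiv (by simp)).clm_apply continuous_const
  have hc1 : HasCompactSupport fun x => fderiv ℝ ψ x e := hc.fderiv_apply ℝ _
  have key := integral_bilinear_fderiv_right_eq_neg_left_of_integrable (μ := (volume : Measure E3))
    (f := ψ) (g := φ) (v := e) (B := ContinuousLinearMap.lsmul ℝ ℝ)
    ((hψ1.smul hφ.continuous).integrable_of_hasCompactSupport hc1.smul_right)
    ((hψ.continuous.smul hφ1).integrable_of_hasCompactSupport hc.smul_right)
    ((hψ.continuous.smul hφ.continuous).integrable_of_hasCompactSupport hc.smul_right)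
    (fun x _ => (hψ.differentiable (by simp)) x) (fun x _ => (hφ.differentiable (by simp)) x)
  simp only [ContinuousLinearMap.lsmul_apply] at key
  rw [setIntegral_eq_integral_of_forall_compl_eq_zero, setIntegral_eq_integral_of_forall_compl_eq_zero]
  · change _ = -∫ x, ψ x • fderiv ℝ φ x e
    rw [key, neg_neg]
  · intro x hx
    rw [image_eq_zero_of_notMem_tsupport fun hh => hx (hs hh), zero_smul]
  · intro x hx
    have : fderiv ℝ ψ x = 0 := by
      by_contra hne
      exact hx (hs (support_fderiv_subset ℝ hne))
    rw [this, zero_apply, zero_smul]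

/-- Smooth functions as elements of `H¹(Ω)`. -/
noncomputable def smoothToH1 (hΩ : IsOpen Ω) (hb : Bornology.IsBounded Ω) :
    smoothFun →ₗ[ℂ] H1 Ω where
  toFun φ := ⟨WithLp.toLp 2
    ((memLp_restrict_of_continuous hb (smoothFun_continuous φ)).toLp,
      (memLp_restrict_of_continuous hb
        (smoothFun_continuous_classicalGrad φ)).toLp), by
    intro ψ hψ hc hs i
    refine Eq.trans ?_ ((isWeakGrad_classicalGrad (smoothFun_contDiff φ) ψ hψ hc hs i).trans ?_)
    · refine integral_congr_ae ?_
      filter_upwards [(memLp_restrict_of_continuous hb (smoothFun_continuous φ)).coeFn_toLp] with x hx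
      rw [WithLp.toLp_fst, hx]
    · rw [neg_inj]
      refine integral_congr_ae ?_
      filter_upwards [(memLp_restrict_of_continuous hb
        (smoothFun_continuous_classicalGrad φ)).coeFn_toLp] with x hx
      rw [WithLp.toLp_snd, hx]⟩
  map_add' φ ψ := by
    -- Only the `L²` components need comparing, as weak gradients are unique.
    refine H1.ext_of_toL2_eq hΩ ?_
    rfl
  map_smul' a φ := by
    refine H1.ext_of_toL2_eq hΩ ?_
    rfl

theorem coeFn_toL2_smoothToH1 (hΩ : IsOpen Ω) (hb : Bornology.IsBounded Ω) (φ : smoothFun) :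
    toL2 (smoothToH1 hΩ hb φ) =ᵐ[volume.restrict Ω] φ :=
  (memLp_restrict_of_continuous hb (smoothFun_continuous φ)).coeFn_toLp

theorem coeFn_grad_smoothToH1 (hΩ : IsOpen Ω) (hb : Bornology.IsBounded Ω) (φ : smoothFun) :
    grad (smoothToH1 hΩ hb φ) =ᵐ[volume.restrict Ω] classicalGrad φ :=
  (memLp_restrict_of_continuous hb
        (smoothFun_continuous_classicalGrad φ)).coeFn_toLp

theorem eq_smoothToH1 (hΩ : IsOpen Ω) (hb : Bornology.IsBounded Ω) (φ : smoothFun) {u : H1 Ω}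
    (hu : toL2 u =ᵐ[volume.restrict Ω] φ) : u = smoothToH1 hΩ hb φ :=
  H1.ext_of_toL2_eq hΩ (Lp.ext (hu.trans (coeFn_toL2_smoothToH1 hΩ hb φ).symm))

end HelmholtzRobin

/-! ### Mollification adapted to star-shaped domains. -/

namespace HelmholtzRobin

open scoped Convolution

theorem eLpNorm_two_sq {α F : Type*} [MeasurableSpace α] [NormedAddCommGroup F] (μ : Measure α)
    (f : α → F) : eLpNorm f 2 μ ^ 2 = ∫⁻ x, ‖f x‖ₑ ^ 2 ∂μ := by
  have := eLpNorm_nnreal_pow_eq_lintegral (μ := μ) (f := f) (p := 2) two_ne_zero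
  simpa using this

theorem enorm_sq_Lp {α F : Type*} [MeasurableSpace α] [NormedAddCommGroup F] {μ : Measure α}
    (f : Lp F 2 μ) : ‖f‖ₑ ^ 2 = ∫⁻ x, ‖f x‖ₑ ^ 2 ∂μ := by
  rw [Lp.enorm_def, eLpNorm_two_sq]

/-- Jensen's inequality for the square and a probability measure. -/
theorem enorm_integral_sq_le {α : Type*} [MeasurableSpace α] (μ : Measure α)
    [IsProbabilityMeasure μ] {f : α → ℂ} (hf : AEStronglyMeasurable f μ) :
    ‖∫ x, f x ∂μ‖ₑ ^ 2 ≤ ∫⁻ x, ‖f x‖ₑ ^ 2 ∂μ := by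
  rw [← eLpNorm_two_sq]
  gcongr
  refine (enorm_integral_le_lintegral_enorm _).trans ?_
  rw [← eLpNorm_one_eq_lintegral_enorm]
  exact eLpNorm_le_eLpNorm_of_exponent_le (by norm_num) hf

namespace IsStarDomain

variable {Ω : Set E3} {c : E3} {ρ M : ℝ}

/-- A bump function supported in the ball with respect to which the domain is star-shaped. -/
noncomputable def bump (h : IsStarDomain Ω c ρ M) : ContDiffBump c :=
  ⟨ρ / 4, ρ / 2, by have := h.pos; positivity, by have := h.pos; linarith⟩

/-- The probability measure whose density is the normalised bump function. -/
noncomputable def bumpMeasure (h : IsStarDomain Ω c ρ M) : Measure E3 :=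
  volume.withDensity fun y => ENNReal.ofReal (h.bump.normed volume y)

instance (h : IsStarDomain Ω c ρ M) : IsProbabilityMeasure h.bumpMeasure := by
  refine ⟨?_⟩
  rw [bumpMeasure, withDensity_apply _ MeasurableSet.univ, setLIntegral_univ,
    ← ofReal_integral_eq_lintegral_ofReal h.bump.integrable_normed
      (Eventually.of_forall h.bump.nonneg_normed), h.bump.integral_normed, ENNReal.ofReal_one]

theorem measurable_density (h : IsStarDomain Ω c ρ M) :
    Measurable fun y => ENNReal.ofReal (h.bump.normed volume y) :=
  h.bump.continuous_normed.measurable.ennreal_ofReal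

theorem ae_bumpMeasure (h : IsStarDomain Ω c ρ M) : ∀ᵐ y ∂h.bumpMeasure, y ∈ Metric.ball c ρ := by
  rw [bumpMeasure, ae_withDensity_iff h.measurable_density]
  refine Eventually.of_forall fun y hy => ?_
  have h1 : h.bump.normed volume y ≠ 0 := fun h0 => hy (by rw [h0, ENNReal.ofReal_zero])
  have h2 : y ∈ Function.support (h.bump.normed volume) := h1
  rw [h.bump.support_normed_eq] at h2
  have hρ := h.pos
  exact Metric.ball_subset_ball (by change ρ / 2 ≤ ρ; linarith) h2

theorem integral_bumpMeasure (h : IsStarDomain Ω c ρ M) (f : E3 → ℂ) :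
    ∫ y, f y ∂h.bumpMeasure = ∫ y, h.bump.normed volume y • f y := by
  rw [bumpMeasure, integral_withDensity_eq_integral_toReal_smul h.measurable_density
    (Eventually.of_forall fun _ => ENNReal.ofReal_lt_top)]
  simp only [ENNReal.toReal_ofReal (h.bump.nonneg_normed _)]

theorem dilate_mem (h : IsStarDomain Ω c ρ M) {x y : E3} (hx : x ∈ Ω) (hy : y ∈ Metric.ball c ρ)
    {t : ℝ} (ht0 : 0 ≤ t) (ht1 : t < 1) : (1 - t) • x + t • y ∈ Ω := by
  rcases ht0.eq_or_lt with rfl | ht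
  · simpa using hx
  have := h.mem_of_mem_closure (subset_closure hx) hy (t := 1 - t) (by linarith) (by linarith)
  convert! this using 1
  module

/-- The dilation maps `Ω` into itself, and for `t ≤ 1/2` the inverse Jacobian `(1 - t)⁻³` is at most
`8`. -/
theorem lintegral_dilate_le (h : IsStarDomain Ω c ρ M) {y : E3} (hy : y ∈ Metric.ball c ρ)
    {t : ℝ} (ht0 : 0 ≤ t) (ht1 : t ≤ 1 / 2) {F : E3 → ℝ≥0∞} (hF : Measurable F) :
    ∫⁻ x in Ω, F ((1 - t) • x + t • y) ≤ 8 * ∫⁻ x in Ω, F x := by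
  have h1t : 0 < 1 - t := by linarith
  have hΩ := h.isOpen.measurableSet
  have hG : Measurable fun x : E3 => Ω.indicator F (x + t • y) :=
    (hF.indicator hΩ).comp (by fun_prop)
  calc ∫⁻ x in Ω, F ((1 - t) • x + t • y)
      ≤ ∫⁻ x, Ω.indicator F ((1 - t) • x + t • y) := by
        rw [← lintegral_indicator hΩ]
        refine lintegral_mono fun x => ?_
        by_cases hx : x ∈ Ω
        · rw [indicator_of_mem hx, indicator_of_mem (h.dilate_mem hx hy ht0 (by linarith))]
        · rw [indicator_of_notMem hx]; exact zero_le
    _ = ENNReal.ofReal |((1 - t) ^ Module.finrank ℝ E3)⁻¹| * ∫⁻ x, Ω.indicator F (x + t • y) := by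
        rw [← lintegral_map hG (measurable_const_smul (1 - t)),
          Measure.map_addHaar_smul volume h1t.ne', lintegral_smul_measure, smul_eq_mul]
    _ = ENNReal.ofReal |((1 - t) ^ Module.finrank ℝ E3)⁻¹| * ∫⁻ x in Ω, F x := by
        rw [lintegral_add_right_eq_self (Ω.indicator F) (t • y), lintegral_indicator hΩ]
    _ ≤ 8 * ∫⁻ x in Ω, F x := by
        gcongr
        rw [show (8 : ℝ≥0∞) = ENNReal.ofReal 8 by norm_num]
        refine ENNReal.ofReal_le_ofReal ?_
        rw [finrank_euclideanSpace_fin, abs_of_pos (by positivity), inv_le_comm₀ (by positivity)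
          (by norm_num)]
        calc (8 : ℝ)⁻¹ = (1 / 2) ^ 3 := by norm_num
          _ ≤ (1 - t) ^ 3 := by gcongr; linarith

/-- The convolution kernel of the mollification. -/
noncomputable def kern (h : IsStarDomain Ω c ρ M) (ε : ℝ) (w : E3) : ℝ :=
  (ε ^ 3)⁻¹ * h.bump.normed volume (-(ε⁻¹ • w))

/-- A mollification which averages `u` over the points `(1 - ε) x + ε y`, `y` near the centre. -/
noncomputable def mollify (h : IsStarDomain Ω c ρ M) (ε : ℝ) (u : E3 → ℂ) (x : E3) : ℂ :=
  ∫ z in Ω, h.kern ε ((1 - ε) • x - z) • u z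

theorem contDiff_kern (h : IsStarDomain Ω c ρ M) (ε : ℝ) : ContDiff ℝ ∞ (h.kern ε) := by
  have h1 : ContDiff ℝ ∞ (h.bump.normed volume) := h.bump.contDiff_normed (n := (⊤ : ℕ∞))
  exact contDiff_const.mul (h1.comp (by fun_prop))

theorem mem_of_kern_ne_zero (h : IsStarDomain Ω c ρ M) {ε : ℝ} {w : E3} (hw : h.kern ε w ≠ 0) :
    -(ε⁻¹ • w) ∈ Metric.ball c (ρ / 2) := by
  have h1 : -(ε⁻¹ • w) ∈ Function.support (h.bump.normed volume) := right_ne_zero_of_mul hw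
  rw [h.bump.support_normed_eq] at h1
  exact h1

theorem hasCompactSupport_kern (h : IsStarDomain Ω c ρ M) {ε : ℝ} (hε : 0 < ε) :
    HasCompactSupport (h.kern ε) := by
  refine HasCompactSupport.intro
    ((isCompact_closedBall c (ρ / 2)).image (f := fun y : E3 => -(ε • y)) (by fun_prop))
    fun w hw => ?_
  by_contra hne
  refine hw ⟨-(ε⁻¹ • w), Metric.ball_subset_closedBall (h.mem_of_kern_ne_zero hne), ?_⟩
  simp [hε.ne']

/-- Substitute `z = (1 - ε) x + ε y`; the factor `ε³` cancels the normalisation of `kern`. The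
kernel form gives smoothness and compactness, this averaged form gives `L²` bounds by Jensen. -/
theorem mollify_eq_integral (h : IsStarDomain Ω c ρ M) {ε : ℝ} (hε : 0 < ε) (u : E3 → ℂ) (x : E3) :
    h.mollify ε u x = ∫ y, Ω.indicator u ((1 - ε) • x + ε • y) ∂h.bumpMeasure := by
  rw [h.integral_bumpMeasure, mollify]
  set g : E3 → ℂ := fun z => h.kern ε ((1 - ε) • x - z) • Ω.indicator u z with hg
  have h1 : ∫ z in Ω, h.kern ε ((1 - ε) • x - z) • u z = ∫ z, g z := by
    rw [← integral_indicator h.isOpen.measurableSet]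
    congr 1
    funext z
    by_cases hz : z ∈ Ω <;> simp [hg, hz]
  rw [h1, ← integral_add_left_eq_self g ((1 - ε) • x)]
  have h2 := Measure.integral_comp_smul (volume : Measure E3)
    (fun z => g ((1 - ε) • x + z)) ε
  rw [finrank_euclideanSpace_fin, abs_of_pos (by positivity), eq_inv_smul_iff₀ (by positivity)]
    at h2
  rw [← h2, ← integral_smul]
  congr 1
  funext y
  simp only [hg, kern]
  rw [sub_add_cancel_left, smul_neg, neg_neg, smul_smul ε⁻¹, inv_mul_cancel₀ hε.ne', one_smul,
    smul_smul, ← mul_assoc, mul_inv_cancel₀ (by positivity), one_mul]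

theorem locallyIntegrable_indicator (h : IsStarDomain Ω c ρ M) {u : E3 → ℂ}
    (hu : MemLp u 2 (volume.restrict Ω)) : LocallyIntegrable (Ω.indicator u) := by
  have : IsFiniteMeasure (volume.restrict Ω) :=
    ⟨by rw [Measure.restrict_apply_univ]; exact h.isBounded.measure_lt_top⟩
  exact ((integrable_indicator_iff h.isOpen.measurableSet).2
    (hu.integrable (by norm_num))).locallyIntegrable

theorem mollify_eq_convolution (h : IsStarDomain Ω c ρ M) (ε : ℝ) (u : E3 → ℂ) :
    h.mollify ε u = fun x => (Ω.indicator u ⋆[(ContinuousLinearMap.lsmul ℝ ℝ).flip] h.kern ε)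
      ((1 - ε) • x) := by
  funext x
  rw [convolution_def, mollify, ← integral_indicator h.isOpen.measurableSet]
  congr 1
  funext z
  by_cases hz : z ∈ Ω <;> simp [hz]

theorem contDiff_mollify (h : IsStarDomain Ω c ρ M) {ε : ℝ} (hε : 0 < ε) {u : E3 → ℂ}
    (hu : MemLp u 2 (volume.restrict Ω)) : ContDiff ℝ ∞ (h.mollify ε u) := by
  rw [h.mollify_eq_convolution]
  have h1 := (h.hasCompactSupport_kern hε).contDiff_convolution_right (n := (⊤ : ℕ∞))
    (ContinuousLinearMap.lsmul ℝ ℝ).flip (h.locallyIntegrable_indicator hu) (h.contDiff_kern ε)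
  exact h1.comp (contDiff_const_smul (1 - ε))

/-- Mollification commutes with weak derivatives up to the dilation factor. -/
theorem fderiv_mollify (h : IsStarDomain Ω c ρ M) {ε : ℝ} (hε : 0 < ε) (hε1 : ε < 1)
    {u : E3 → ℂ} {g : E3 → EuclideanSpace ℂ (Fin 3)} (hu : MemLp u 2 (volume.restrict Ω))
    (hg : IsWeakGrad Ω u g) {x : E3} (hx : x ∈ Ω) (i : Fin 3) :
    fderiv ℝ (h.mollify ε u) x (EuclideanSpace.single i 1) =
      (1 - ε : ℝ) • h.mollify ε (fun z => g z i) x := by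
  set e := EuclideanSpace.single (𝕜 := ℝ) i (1 : ℝ) with he
  set L : ℂ →L[ℝ] ℝ →L[ℝ] ℂ := (ContinuousLinearMap.lsmul ℝ ℝ).flip with hL
  have hk := h.contDiff_kern ε
  have hk1 : ContDiff ℝ 1 (h.kern ε) := hk.of_le (by simp)
  have hkc := h.hasCompactSupport_kern hε
  have hli := h.locallyIntegrable_indicator hu
  have h1 := hkc.hasFDerivAt_convolution_right L hli hk1 ((1 - ε) • x)
  have h2 : HasFDerivAt (fun x : E3 => (1 - ε) • x) ((1 - ε) • ContinuousLinearMap.id ℝ E3) x :=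
    (hasFDerivAt_id x).const_smul (1 - ε)
  have h3 := h1.comp x h2
  have h4 : fderiv ℝ (h.mollify ε u) x e =
      (1 - ε) • ((Ω.indicator u ⋆[L.precompR E3] fderiv ℝ (h.kern ε)) ((1 - ε) • x)) e := by
    rw [h.mollify_eq_convolution]
    have h5 : fderiv ℝ (fun x => (Ω.indicator u ⋆[L] h.kern ε) ((1 - ε) • x)) x = _ := h3.fderiv
    rw [h5]
    simp
  rw [h4]
  congr 1
  have hint : ConvolutionExistsAt (Ω.indicator u) (fderiv ℝ (h.kern ε)) ((1 - ε) • x)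
      (L.precompR E3) :=
    HasCompactSupport.convolutionExists_right (L.precompR E3) (hkc.fderiv ℝ) hli
      (hk1.continuous_fderiv one_ne_zero) _
  rw [convolution_def, ContinuousLinearMap.integral_apply hint]
  -- The shifted kernel serves as test function in the weak gradient of `u`. Its support lies among
  -- the points `(1 - ε) x + ε y` with `y` in the closed half-size ball, hence inside `Ω` for every
  -- `x ∈ Ω`, however close to the boundary.
  set φ : E3 → ℝ := fun z => h.kern ε ((1 - ε) • x - z) with hφ
  have hφd : ∀ z, fderiv ℝ φ z e = -fderiv ℝ (h.kern ε) ((1 - ε) • x - z) e := by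
    intro z
    have h6 : HasFDerivAt φ _ z :=
      ((hk.differentiable (by simp)) ((1 - ε) • x - z)).hasFDerivAt.comp z
        ((hasFDerivAt_id z).const_sub ((1 - ε) • x))
    rw [h6.fderiv]
    simp
  have hts : tsupport φ ⊆ (fun y : E3 => (1 - ε) • x + ε • y) '' Metric.closedBall c (ρ / 2) := by
    refine closure_minimal (fun z hz => ?_)
      ((isCompact_closedBall c (ρ / 2)).image (by fun_prop)).isClosed
    refine ⟨_, Metric.ball_subset_closedBall (h.mem_of_kern_ne_zero hz), ?_⟩
    simp only [smul_neg, smul_smul, mul_inv_cancel₀ hε.ne', one_smul]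
    abel
  have hφc : HasCompactSupport φ :=
    ((isCompact_closedBall c (ρ / 2)).image (by fun_prop)).of_isClosed_subset
      (isClosed_tsupport φ) hts
  have hφΩ : tsupport φ ⊆ Ω := by
    refine hts.trans ?_
    rintro _ ⟨y, hy, rfl⟩
    have hρ := h.pos
    exact h.dilate_mem hx (Metric.closedBall_subset_ball (by linarith) hy) hε.le hε1
  have hw := hg φ (hk.comp (contDiff_const.sub contDiff_id)) hφc hφΩ i
  have h7 : ∫ z, (L.precompR E3) (Ω.indicator u z) (fderiv ℝ (h.kern ε) ((1 - ε) • x - z)) e =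
      -∫ z in Ω, (fderiv ℝ φ z e) • u z := by
    rw [← integral_neg, ← integral_indicator h.isOpen.measurableSet]
    congr 1
    funext z
    by_cases hz : z ∈ Ω <;> simp [hz, hφd, hL]
  rw [h7, hw, neg_neg]
  rfl

/-- Jensen for the probability measure `bumpMeasure`, Tonelli, and the dilation bound for each `y`.
-/
theorem enorm_mollify_sq_le (h : IsStarDomain Ω c ρ M) {ε : ℝ} (hε : 0 < ε) (hε1 : ε ≤ 1 / 2)
    {u : E3 → ℂ} (hu : Measurable u) :
    ∫⁻ x in Ω, ‖h.mollify ε u x‖ₑ ^ 2 ≤ 8 * ∫⁻ x in Ω, ‖u x‖ₑ ^ 2 := by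
  have hΩ := h.isOpen.measurableSet
  have hum : Measurable (Ω.indicator u) := hu.indicator hΩ
  have hmap : Measurable fun p : E3 × E3 => (1 - ε) • p.1 + ε • p.2 := by fun_prop
  calc ∫⁻ x in Ω, ‖h.mollify ε u x‖ₑ ^ 2
      ≤ ∫⁻ x in Ω, ∫⁻ y, ‖Ω.indicator u ((1 - ε) • x + ε • y)‖ₑ ^ 2 ∂h.bumpMeasure := by
        refine lintegral_mono fun x => ?_
        rw [h.mollify_eq_integral hε]
        exact enorm_integral_sq_le _
          (hum.comp (hmap.comp (measurable_const.prodMk measurable_id))).aestronglyMeasurable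
    _ = ∫⁻ y, ∫⁻ x in Ω, ‖Ω.indicator u ((1 - ε) • x + ε • y)‖ₑ ^ 2 ∂volume ∂h.bumpMeasure :=
        lintegral_lintegral_swap ((hum.comp hmap).enorm.pow_const 2).aemeasurable
    _ ≤ ∫⁻ _y, (8 * ∫⁻ x in Ω, ‖u x‖ₑ ^ 2) ∂h.bumpMeasure := by
        refine lintegral_mono_ae ?_
        filter_upwards [h.ae_bumpMeasure] with y hy
        refine (h.lintegral_dilate_le hy hε.le hε1 (hum.enorm.pow_const 2)).trans (le_of_eq ?_)
        congr 1
        refine setLIntegral_congr_fun hΩ fun x hx => ?_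
        rw [indicator_of_mem hx]
    _ = _ := by rw [lintegral_const, measure_univ, mul_one]

/-- The error of mollification of a `C¹` function is controlled by its gradient. -/
theorem enorm_mollify_sub_sq_le (h : IsStarDomain Ω c ρ M) {ε : ℝ} (hε : 0 < ε) (hε1 : ε ≤ 1 / 2)
    {φ : E3 → ℂ} (hφ : ContDiff ℝ 1 φ) :
    ∫⁻ x in Ω, ‖h.mollify ε φ x - φ x‖ₑ ^ 2 ≤
      ENNReal.ofReal (32 * M ^ 2 * ε ^ 2) * ∫⁻ x in Ω, ‖classicalGrad φ x‖ₑ ^ 2 := by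
  have hΩ := h.isOpen.measurableSet
  have hM := h.radius_nonneg
  set G : E3 → ℝ≥0∞ := fun x => ‖classicalGrad φ x‖ₑ ^ 2 with hG
  have hGc : Continuous (classicalGrad φ) := continuous_classicalGrad hφ
  have hGm : Measurable G := hGc.measurable.enorm.pow_const 2
  -- Integrate the derivative along `t ↦ (1 - t) x + t y`. The length `‖y - x‖ ≤ 2M` contributes
  -- `4M²`, Cauchy–Schwarz on `(0, ε]` contributes `ε`.
  have hpath : ∀ x ∈ Ω, ∀ y ∈ Metric.ball c ρ, ‖φ ((1 - ε) • x + ε • y) - φ x‖ₑ ^ 2 ≤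
      ENNReal.ofReal (4 * M ^ 2 * ε) * ∫⁻ t in Ioc 0 ε, G ((1 - t) • x + t • y) := by
    intro x hx y hy
    have hcγ : Continuous fun t : ℝ => (1 - t) • x + t • y := by fun_prop
    have hd : ∀ t : ℝ, HasDerivAt (fun t : ℝ => φ ((1 - t) • x + t • y))
        (fderiv ℝ φ ((1 - t) • x + t • y) (y - x)) t := by
      intro t
      have h1 : HasDerivAt (fun t : ℝ => (1 - t) • x + t • y) (y - x) t := by
        have := (((hasDerivAt_id t).const_sub 1).smul_const x).add
          ((hasDerivAt_id t).smul_const y)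
        convert! this using 1
        module
      exact ((hφ.differentiable one_ne_zero) _).hasFDerivAt.comp_hasDerivAt t h1
    have hcd : Continuous fun t : ℝ => fderiv ℝ φ ((1 - t) • x + t • y) (y - x) :=
      ((hφ.continuous_fderiv one_ne_zero).comp hcγ).clm_apply continuous_const
    have h1 := intervalIntegral.integral_eq_sub_of_hasDerivAt (a := 0) (b := ε)
      (fun t _ => hd t) (hcd.intervalIntegrable _ _)
    simp only [sub_zero, one_smul, zero_smul, add_zero] at h1
    have hyx : ‖y - x‖ ≤ 2 * M := by
      have h2 := h.norm_le_of_mem_closure (subset_closure hx)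
      have h3 := h.norm_le_of_mem_closure (subset_closure (h.ball_subset hy))
      calc ‖y - x‖ = ‖(y - c) - (x - c)‖ := by congr 1; abel
        _ ≤ ‖y - c‖ + ‖x - c‖ := norm_sub_le _ _
        _ ≤ 2 * M := by linarith
    have hle : ∀ t : ℝ, ‖fderiv ℝ φ ((1 - t) • x + t • y) (y - x)‖ₑ ≤
        ENNReal.ofReal (2 * M) * ‖classicalGrad φ ((1 - t) • x + t • y)‖ₑ := by
      intro t
      rw [← ofReal_norm, ← ofReal_norm, ← ENNReal.ofReal_mul (by positivity), mul_comm]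
      refine ENNReal.ofReal_le_ofReal ((norm_fderiv_apply_le _ _ _).trans ?_)
      gcongr
    have hcs : (∫⁻ t in Ioc 0 ε, ‖classicalGrad φ ((1 - t) • x + t • y)‖ₑ) ^ 2 ≤
        ENNReal.ofReal ε * ∫⁻ t in Ioc 0 ε, G ((1 - t) • x + t • y) := by
      have h2 := eLpNorm_le_eLpNorm_mul_rpow_measure_univ (p := 1) (q := 2)
        (μ := volume.restrict (Ioc 0 ε)) (f := fun t : ℝ => classicalGrad φ ((1 - t) • x + t • y))
        (by norm_num) (hGc.comp hcγ).aestronglyMeasurable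
      rw [eLpNorm_one_eq_lintegral_enorm] at h2
      refine (pow_le_pow_left' h2 2).trans (le_of_eq ?_)
      rw [mul_pow, eLpNorm_two_sq, mul_comm, Measure.restrict_apply_univ, Real.volume_Ioc, sub_zero,
        ← ENNReal.rpow_natCast, ← ENNReal.rpow_mul]
      norm_num [hG]
    calc ‖φ ((1 - ε) • x + ε • y) - φ x‖ₑ ^ 2
        ≤ (∫⁻ t in Ioc 0 ε, ENNReal.ofReal (2 * M) *
            ‖classicalGrad φ ((1 - t) • x + t • y)‖ₑ) ^ 2 := by
          gcongr
          rw [← h1, intervalIntegral.integral_of_le hε.le]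
          exact (enorm_integral_le_lintegral_enorm _).trans (lintegral_mono hle)
      _ = ENNReal.ofReal (2 * M) ^ 2 *
            (∫⁻ t in Ioc 0 ε, ‖classicalGrad φ ((1 - t) • x + t • y)‖ₑ) ^ 2 := by
          have hme : Measurable fun t : ℝ => ‖classicalGrad φ ((1 - t) • x + t • y)‖ₑ :=
            (hGc.comp hcγ).measurable.enorm
          rw [lintegral_const_mul _ hme, mul_pow]
      _ ≤ ENNReal.ofReal (2 * M) ^ 2 *
            (ENNReal.ofReal ε * ∫⁻ t in Ioc 0 ε, G ((1 - t) • x + t • y)) := by gcongr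
      _ = _ := by
          rw [← mul_assoc, ← ENNReal.ofReal_pow (by positivity),
            ← ENNReal.ofReal_mul (by positivity)]
          congr 2; ring
  have hjoint : Measurable fun p : (E3 × E3) × ℝ => G ((1 - p.2) • p.1.1 + p.2 • p.1.2) :=
    hGm.comp (by fun_prop)
  have hpt : ∀ x ∈ Ω, ‖h.mollify ε φ x - φ x‖ₑ ^ 2 ≤ ENNReal.ofReal (4 * M ^ 2 * ε) *
      ∫⁻ y, ∫⁻ t in Ioc 0 ε, G ((1 - t) • x + t • y) ∂volume ∂h.bumpMeasure := by
    intro x hx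
    have hae : (fun y => Ω.indicator φ ((1 - ε) • x + ε • y)) =ᵐ[h.bumpMeasure]
        fun y => φ ((1 - ε) • x + ε • y) := by
      filter_upwards [h.ae_bumpMeasure] with y hy
      rw [indicator_of_mem (h.dilate_mem hx hy hε.le (by linarith))]
    have hcy : Continuous fun y => φ ((1 - ε) • x + ε • y) := hφ.continuous.comp (by fun_prop)
    have hi : Integrable (fun y => φ ((1 - ε) • x + ε • y)) h.bumpMeasure := by
      obtain ⟨C, hC⟩ := h.isBounded.isCompact_closure.exists_bound_of_continuousOn
        hφ.continuous.continuousOn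
      refine Integrable.of_bound hcy.aestronglyMeasurable C ?_
      filter_upwards [h.ae_bumpMeasure] with y hy
      exact hC _ (subset_closure (h.dilate_mem hx hy hε.le (by linarith)))
    have heq : h.mollify ε φ x - φ x = ∫ y, (φ ((1 - ε) • x + ε • y) - φ x) ∂h.bumpMeasure := by
      rw [h.mollify_eq_integral hε, integral_congr_ae hae, integral_sub hi (integrable_const _),
        integral_const]
      simp
    rw [heq, ← lintegral_const_mul]
    · refine (enorm_integral_sq_le _ (hcy.sub continuous_const).aestronglyMeasurable).trans ?_
      refine lintegral_mono_ae ?_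
      filter_upwards [h.ae_bumpMeasure] with y hy
      exact hpath x hx y hy
    · exact Measurable.lintegral_prod_right' (f := fun p : E3 × ℝ =>
        G ((1 - p.2) • x + p.2 • p.1)) (hGm.comp (by fun_prop))
  calc ∫⁻ x in Ω, ‖h.mollify ε φ x - φ x‖ₑ ^ 2
      ≤ ∫⁻ x in Ω, ENNReal.ofReal (4 * M ^ 2 * ε) *
          ∫⁻ y, ∫⁻ t in Ioc 0 ε, G ((1 - t) • x + t • y) ∂volume ∂h.bumpMeasure :=
        setLIntegral_mono' hΩ hpt
    _ = ENNReal.ofReal (4 * M ^ 2 * ε) * ∫⁻ x in Ω,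
          ∫⁻ y, ∫⁻ t in Ioc 0 ε, G ((1 - t) • x + t • y) ∂volume ∂h.bumpMeasure := by
        rw [lintegral_const_mul]
        exact Measurable.lintegral_prod_right' (f := fun p : E3 × E3 =>
          ∫⁻ t in Ioc 0 ε, G ((1 - t) • p.1 + t • p.2)) hjoint.lintegral_prod_right'
    _ = ENNReal.ofReal (4 * M ^ 2 * ε) * ∫⁻ y, ∫⁻ x in Ω,
          ∫⁻ t in Ioc 0 ε, G ((1 - t) • x + t • y) ∂volume ∂volume ∂h.bumpMeasure := by
        rw [lintegral_lintegral_swap]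
        exact hjoint.lintegral_prod_right'.aemeasurable
    -- Each `t ∈ (0, ε]` costs the dilation factor `8`; integrating over `t` supplies the second
    -- power of `ε`.
    _ ≤ ENNReal.ofReal (4 * M ^ 2 * ε) * ∫⁻ _y,
          (ENNReal.ofReal (8 * ε) * ∫⁻ x in Ω, G x) ∂h.bumpMeasure := by
        refine mul_le_mul' le_rfl ?_
        refine lintegral_mono_ae ?_
        filter_upwards [h.ae_bumpMeasure] with y hy
        rw [lintegral_lintegral_swap]
        · calc ∫⁻ t in Ioc 0 ε, ∫⁻ x in Ω, G ((1 - t) • x + t • y)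
              ≤ ∫⁻ _t in Ioc 0 ε, 8 * ∫⁻ x in Ω, G x :=
                setLIntegral_mono' measurableSet_Ioc fun t ht =>
                  h.lintegral_dilate_le hy ht.1.le (ht.2.trans hε1) hGm
            _ = _ := by
                rw [lintegral_const, Measure.restrict_apply_univ, Real.volume_Ioc, sub_zero,
                  ENNReal.ofReal_mul (by norm_num), mul_right_comm]
                norm_num
        · exact (hGm.comp (by fun_prop)).aemeasurable
    _ = _ := by
        rw [lintegral_const, measure_univ, mul_one, ← mul_assoc,
          ← ENNReal.ofReal_mul (by positivity)]
        congr 2; ring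

end IsStarDomain

end HelmholtzRobin

/-! ### Density of smooth functions and Rellich compactness. -/

namespace HelmholtzRobin

/-- A sequence of mollification parameters. -/
noncomputable def step (n : ℕ) : ℝ := 1 / (n + 2)

theorem step_pos (n : ℕ) : 0 < step n := by unfold step; positivity

theorem step_le_half (n : ℕ) : step n ≤ 1 / 2 := by
  unfold step
  gcongr
  simp

theorem step_lt_one (n : ℕ) : step n < 1 := (step_le_half n).trans_lt (by norm_num)

theorem tendsto_step : Tendsto step atTop (𝓝 0) := by
  have h := (tendsto_one_div_add_atTop_nhds_zero_nat (𝕜 := ℝ)).comp (tendsto_add_atTop_nat 1)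
  refine h.congr fun n => ?_
  simp only [Function.comp_apply, step]
  push_cast
  ring_nf

namespace IsStarDomain

variable {Ω : Set E3} {c : E3} {ρ M : ℝ}

theorem isFiniteMeasure_restrict (h : IsStarDomain Ω c ρ M) :
    IsFiniteMeasure (volume.restrict Ω) :=
  ⟨by rw [Measure.restrict_apply_univ]; exact h.isBounded.measure_lt_top⟩

theorem memLp_kern (h : IsStarDomain Ω c ρ M) (ε : ℝ) (x : E3) :
    MemLp (fun z => (h.kern ε ((1 - ε) • x - z) : ℂ)) 2 (volume.restrict Ω) :=
  memLp_restrict_of_continuous h.isBounded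
    (Complex.continuous_ofReal.comp ((h.contDiff_kern ε).continuous.comp (by fun_prop)))

/-- Continuity of the kernel as an `L²`-valued function of `x` makes it square integrable over the
bounded domain, so that mollification is a compact kernel operator. -/
theorem continuous_kern_toLp (h : IsStarDomain Ω c ρ M) {ε : ℝ} (hε : 0 < ε) :
    Continuous fun x => (h.memLp_kern ε x).toLp := by
  have := h.isFiniteMeasure_restrict
  obtain ⟨C, hC⟩ := ContDiff.lipschitzWith_of_hasCompactSupport (h.hasCompactSupport_kern hε)
    (h.contDiff_kern ε) (by simp)
  refine (LipschitzWith.of_dist_le_mul (K := (measureUnivNNReal (volume.restrict Ω)) ^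
    ((2 : ℝ≥0∞).toReal)⁻¹ * (C * ‖1 - ε‖₊)) fun x y => ?_).continuous
  rw [dist_eq_norm]
  have hb : ∀ᵐ z ∂(volume.restrict Ω),
      ‖((h.memLp_kern ε x).toLp - (h.memLp_kern ε y).toLp : L2 Ω) z‖ ≤
        C * ‖1 - ε‖ * dist x y := by
    filter_upwards [Lp.coeFn_sub (h.memLp_kern ε x).toLp (h.memLp_kern ε y).toLp,
      (h.memLp_kern ε x).coeFn_toLp, (h.memLp_kern ε y).coeFn_toLp] with z hz hx hy
    rw [hz, Pi.sub_apply, hx, hy, ← Complex.ofReal_sub, Complex.norm_real, ← dist_eq_norm,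
      mul_assoc]
    refine (hC.dist_le_mul _ _).trans (le_of_eq ?_)
    rw [dist_sub_right, dist_smul₀]
  refine (Lp.norm_le_of_ae_bound (by positivity) hb).trans (le_of_eq ?_)
  push_cast
  ring

/-- The mollification as an operator on `L²(Ω)`. -/
noncomputable def mollOp (h : IsStarDomain Ω c ρ M) (n : ℕ) : L2 Ω →L[ℂ] L2 Ω :=
  kernelOp (volume.restrict Ω) (memLp_restrict_of_continuous h.isBounded
    ((innerSL ℂ).continuous.comp (h.continuous_kern_toLp (step_pos n)))).toLp

theorem isCompactOperator_mollOp (h : IsStarDomain Ω c ρ M) (n : ℕ) :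
    IsCompactOperator (h.mollOp n) :=
  isCompactOperator_kernelOp _ _

theorem coeFn_mollOp (h : IsStarDomain Ω c ρ M) (n : ℕ) (u : L2 Ω) :
    h.mollOp n u =ᵐ[volume.restrict Ω] h.mollify (step n) u := by
  refine (coeFn_kernelOp _ _ u).trans ?_
  filter_upwards [(memLp_restrict_of_continuous h.isBounded
    ((innerSL ℂ).continuous.comp (h.continuous_kern_toLp (step_pos n)))).coeFn_toLp] with x hx
  rw [hx, Function.comp_apply, innerSL_apply_apply, MeasureTheory.L2.inner_def, mollify]
  refine integral_congr_ae ?_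
  filter_upwards [(h.memLp_kern (step n) x).coeFn_toLp] with z hz
  rw [hz, RCLike.inner_apply, Complex.conj_ofReal, Complex.real_smul, mul_comm]

theorem mollify_congr (h : IsStarDomain Ω c ρ M) (ε : ℝ) {u v : E3 → ℂ}
    (huv : u =ᵐ[volume.restrict Ω] v) : h.mollify ε u = h.mollify ε v := by
  funext x
  refine integral_congr_ae ?_
  filter_upwards [huv] with z hz
  rw [hz]

theorem norm_le_of_enorm_sq_le {X Y : Type*} [NormedAddCommGroup X] [NormedAddCommGroup Y] {x : X}
    {y : Y} {a b : ℝ} (hb : 0 ≤ b) (hab : a ≤ b ^ 2)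
    (hxy : ‖x‖ₑ ^ 2 ≤ ENNReal.ofReal a * ‖y‖ₑ ^ 2) : ‖x‖ ≤ b * ‖y‖ := by
  rw [← ofReal_norm, ← ofReal_norm, ← ENNReal.ofReal_pow (norm_nonneg _),
    ← ENNReal.ofReal_pow (norm_nonneg _), ← ENNReal.ofReal_mul' (by positivity)] at hxy
  have h1 : ‖x‖ ^ 2 ≤ b ^ 2 * ‖y‖ ^ 2 := by
    rcases le_or_gt 0 (a * ‖y‖ ^ 2) with h0 | h0
    · exact ((ENNReal.ofReal_le_ofReal_iff h0).1 hxy).trans (by gcongr)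
    · rw [ENNReal.ofReal_of_nonpos h0.le, nonpos_iff_eq_zero, ENNReal.ofReal_eq_zero] at hxy
      exact hxy.trans (by positivity)
  rw [← mul_pow] at h1
  exact le_of_sq_le_sq h1 (by positivity)

theorem norm_mollOp_le (h : IsStarDomain Ω c ρ M) (n : ℕ) (u : L2 Ω) :
    ‖h.mollOp n u‖ ≤ 3 * ‖u‖ := by
  refine norm_le_of_enorm_sq_le (a := 8) (by norm_num) (by norm_num) ?_
  rw [enorm_sq_Lp, enorm_sq_Lp, ENNReal.ofReal_ofNat]
  refine le_trans (le_of_eq ?_) (h.enorm_mollify_sq_le (step_pos n) (step_le_half n)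
    (Lp.stronglyMeasurable u).measurable)
  refine lintegral_congr_ae ?_
  filter_upwards [h.coeFn_mollOp n u] with x hx
  rw [hx]

theorem norm_mollOp_sub_smooth_le (h : IsStarDomain Ω c ρ M) (n : ℕ) (φ : smoothFun) :
    ‖h.mollOp n (toL2 (smoothToH1 h.isOpen h.isBounded φ)) -
      toL2 (smoothToH1 h.isOpen h.isBounded φ)‖ ≤
      6 * M * step n * ‖grad (smoothToH1 h.isOpen h.isBounded φ)‖ := by
  have hM := h.radius_nonneg
  have hs := step_pos n
  refine norm_le_of_enorm_sq_le (a := 32 * M ^ 2 * step n ^ 2) (by positivity)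
    (by nlinarith [mul_nonneg (sq_nonneg M) (sq_nonneg (step n))]) ?_
  rw [enorm_sq_Lp, enorm_sq_Lp]
  refine le_trans (le_of_eq ?_) ((h.enorm_mollify_sub_sq_le (step_pos n) (step_le_half n)
    ((smoothFun_contDiff φ).of_le (by simp))).trans (le_of_eq ?_))
  · refine lintegral_congr_ae ?_
    filter_upwards [h.coeFn_mollOp n (toL2 (smoothToH1 h.isOpen h.isBounded φ)),
      coeFn_toL2_smoothToH1 h.isOpen h.isBounded φ,
      Lp.coeFn_sub (h.mollOp n (toL2 (smoothToH1 h.isOpen h.isBounded φ)))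
        (toL2 (smoothToH1 h.isOpen h.isBounded φ))] with x h1 h2 h3
    rw [h3, Pi.sub_apply, h1, h2,
      h.mollify_congr (step n) (coeFn_toL2_smoothToH1 h.isOpen h.isBounded φ)]
  · congr 1
    refine lintegral_congr_ae ?_
    filter_upwards [coeFn_grad_smoothToH1 h.isOpen h.isBounded φ] with x hx
    rw [hx]

/-- The operators are uniformly bounded by `3` and converge on the dense set of smooth functions;
the error is below `3δ/8 + δ/4 + δ/8 < δ`. -/
theorem tendsto_mollOp (h : IsStarDomain Ω c ρ M) (u : L2 Ω) :
    Tendsto (fun n => h.mollOp n u) atTop (𝓝 u) := by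
  have hdense : Dense {f : L2 Ω | ∃ g : E3 → ℂ, f =ᵐ[volume.restrict Ω] g ∧ HasCompactSupport g ∧
      ContDiff ℝ ∞ g} := Lp.dense_hasCompactSupport_contDiff (by simp)
  rw [Metric.tendsto_atTop]
  intro δ hδ
  obtain ⟨f, hf, g, hfg, -, hg⟩ := Metric.dense_iff.1 hdense u (δ / 8) (by positivity)
  set φ : smoothFun := ⟨g, hg⟩
  set v := smoothToH1 h.isOpen h.isBounded φ with hv
  have hfv : f = toL2 v :=
    Lp.ext (hfg.trans (coeFn_toL2_smoothToH1 h.isOpen h.isBounded φ).symm)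
  have hlim : Tendsto (fun n => 6 * M * step n * ‖grad v‖) atTop (𝓝 0) := by
    have := (tendsto_step.const_mul (6 * M)).mul_const ‖grad v‖
    simpa using this
  obtain ⟨N, hN⟩ := (hlim.eventually (gt_mem_nhds (show 0 < δ / 4 by positivity))).exists_forall_of_atTop
  refine ⟨N, fun n hn => ?_⟩
  have h1 : ‖h.mollOp n f - f‖ < δ / 4 := by
    rw [hfv]; exact (h.norm_mollOp_sub_smooth_le n φ).trans_lt (hN n hn)
  have h2 : ‖u - f‖ < δ / 8 := by
    rw [← dist_eq_norm, dist_comm]; exact hf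
  have h3 := h.norm_mollOp_le n (u - f)
  calc dist (h.mollOp n u) u = ‖h.mollOp n (u - f) + (h.mollOp n f - f) - (u - f)‖ := by
        rw [dist_eq_norm, map_sub]; congr 1; abel
    _ ≤ ‖h.mollOp n (u - f)‖ + ‖h.mollOp n f - f‖ + ‖u - f‖ :=
        (norm_sub_le _ _).trans (by gcongr; exact norm_add_le _ _)
    _ < δ := by linarith

/-- The mollification of an `H¹` function as a smooth function. -/
noncomputable def mollSmooth (h : IsStarDomain Ω c ρ M) (n : ℕ) (u : H1 Ω) : smoothFun :=
  ⟨h.mollify (step n) (toL2 u), h.contDiff_mollify (step_pos n) (Lp.memLp _)⟩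

theorem toL2_mollSmooth (h : IsStarDomain Ω c ρ M) (n : ℕ) (u : H1 Ω) :
    toL2 (smoothToH1 h.isOpen h.isBounded (h.mollSmooth n u)) = h.mollOp n (toL2 u) :=
  Lp.ext ((coeFn_toL2_smoothToH1 _ _ _).trans (h.coeFn_mollOp n _).symm)

theorem comp_grad_mollSmooth (h : IsStarDomain Ω c ρ M) (n : ℕ) (u : H1 Ω) (i : Fin 3) :
    comp Ω i (grad (smoothToH1 h.isOpen h.isBounded (h.mollSmooth n u))) =
      ((1 - step n : ℝ) : ℂ) • h.mollOp n (comp Ω i (grad u)) := by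
  apply Lp.ext
  filter_upwards [coeFn_comp i (grad (smoothToH1 h.isOpen h.isBounded (h.mollSmooth n u))),
    coeFn_grad_smoothToH1 h.isOpen h.isBounded (h.mollSmooth n u),
    Lp.coeFn_smul ((1 - step n : ℝ) : ℂ) (h.mollOp n (comp Ω i (grad u))),
    h.coeFn_mollOp n (comp Ω i (grad u)),
    ae_restrict_mem h.isOpen.measurableSet] with x h1 h2 h3 h4 hx
  rw [h1, h2, h3, Pi.smul_apply, h4, h.mollify_congr (step n) (coeFn_comp i (grad u))]
  have := h.fderiv_mollify (step_pos n) (step_lt_one n) (u := toL2 u) (g := grad u)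
    (Lp.memLp _) u.2 hx i
  rw [Complex.real_smul] at this
  exact this

/-- Each gradient component of the mollification is `1 - ε` times the mollified component, so `L²`
convergence of mollifiers gives `H¹` convergence. -/
theorem tendsto_mollSmooth (h : IsStarDomain Ω c ρ M) (u : H1 Ω) :
    Tendsto (fun n => smoothToH1 h.isOpen h.isBounded (h.mollSmooth n u)) atTop (𝓝 u) := by
  set v := fun n => smoothToH1 h.isOpen h.isBounded (h.mollSmooth n u) with hv
  rw [tendsto_iff_norm_sub_tendsto_zero]
  have hsq : Tendsto (fun n => ‖v n - u‖ ^ 2) atTop (𝓝 0) := by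
    have h1 : ∀ n, ‖v n - u‖ ^ 2 = ‖h.mollOp n (toL2 u) - toL2 u‖ ^ 2 +
        ∑ i, ‖((1 - step n : ℝ) : ℂ) • h.mollOp n (comp Ω i (grad u)) - comp Ω i (grad u)‖ ^ 2 := by
      intro n
      rw [norm_sq_H1, norm_sq_eq_sum_comp, ← toL2L_apply, ← gradL_apply, map_sub, map_sub,
        toL2L_apply, toL2L_apply, h.toL2_mollSmooth]
      simp only [map_sub, gradL_apply, hv, h.comp_grad_mollSmooth]
    simp only [h1]
    have h2 : Tendsto (fun n => ‖h.mollOp n (toL2 u) - toL2 u‖ ^ 2) atTop (𝓝 0) := by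
      have := ((tendsto_iff_norm_sub_tendsto_zero.1 (h.tendsto_mollOp (toL2 u))).pow 2)
      simpa using this
    have h3 : ∀ i, Tendsto (fun n => ‖((1 - step n : ℝ) : ℂ) • h.mollOp n (comp Ω i (grad u)) -
        comp Ω i (grad u)‖ ^ 2) atTop (𝓝 0) := by
      intro i
      have hc : Tendsto (fun n => ((1 - step n : ℝ) : ℂ)) atTop (𝓝 1) := by
        have h4 : Tendsto (fun n => (1 - step n : ℝ)) atTop (𝓝 (1 - 0)) :=
          tendsto_step.const_sub 1
        have := (Complex.continuous_ofReal.tendsto _).comp h4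
        rwa [sub_zero, Complex.ofReal_one] at this
      have h5 := hc.smul (h.tendsto_mollOp (comp Ω i (grad u)))
      rw [one_smul] at h5
      have := (tendsto_iff_norm_sub_tendsto_zero.1 h5).pow 2
      simpa using this
    have := h2.add (tendsto_finsetSum Finset.univ fun i _ => h3 i)
    simpa using this
  have := hsq.sqrt
  simpa [Real.sqrt_sq (norm_nonneg _)] using this

/-- Functions which are smooth up to the boundary are dense in `H¹(Ω)`. -/
theorem denseRange_smoothToH1 (h : IsStarDomain Ω c ρ M) :
    DenseRange (smoothToH1 h.isOpen h.isBounded) := fun u =>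
  mem_closure_of_tendsto (h.tendsto_mollSmooth u) (Eventually.of_forall fun _ => mem_range_self _)

/-- Extended from smooth functions by density. A rate uniform over bounded sets of `H¹` is what
gives convergence in operator norm. -/
theorem norm_mollOp_sub_le (h : IsStarDomain Ω c ρ M) (n : ℕ) (u : H1 Ω) :
    ‖h.mollOp n (toL2 u) - toL2 u‖ ≤ 6 * M * step n * ‖grad u‖ := by
  refine h.denseRange_smoothToH1.induction_on
    (p := fun u : H1 Ω => ‖h.mollOp n (toL2 u) - toL2 u‖ ≤ 6 * M * step n * ‖grad u‖) u
    (isClosed_le ?_ ?_) (h.norm_mollOp_sub_smooth_le n)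
  · exact (((h.mollOp n).continuous.comp (toL2L Ω).continuous).sub (toL2L Ω).continuous).norm
  · exact continuous_const.mul (gradL Ω).continuous.norm

theorem norm_grad_le (u : H1 Ω) : ‖grad u‖ ≤ ‖u‖ := by
  refine le_of_sq_le_sq ?_ (norm_nonneg _)
  rw [norm_sq_H1]
  nlinarith [sq_nonneg ‖toL2 u‖]

/-- Rellich's theorem: the embedding of `H¹(Ω)` into `L²(Ω)` is compact. -/
theorem isCompactOperator_toL2L (h : IsStarDomain Ω c ρ M) : IsCompactOperator (toL2L Ω) := by
  -- The embedding is an operator-norm limit of compact operators.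
  have hlim : Tendsto (fun n => h.mollOp n ∘L toL2L Ω) atTop (𝓝 (toL2L Ω)) := by
    refine (tendsto_iff_norm_sub_tendsto_zero (E := H1 Ω →L[ℂ] L2 Ω)).2 ?_
    have hM := h.radius_nonneg
    have hs : Tendsto (fun n => 6 * M * step n) atTop (𝓝 0) := by
      simpa using tendsto_step.const_mul (6 * M)
    refine squeeze_zero (fun n => norm_nonneg (E := H1 Ω →L[ℂ] L2 Ω) _) (fun n => ?_) hs
    have := step_pos n
    refine ContinuousLinearMap.opNorm_le_bound _ (by positivity) fun u => ?_
    refine (h.norm_mollOp_sub_le n u).trans ?_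
    gcongr
    exact norm_grad_le u
  refine isCompactOperator_of_tendsto hlim (Eventually.of_forall fun n => ?_)
  exact (h.isCompactOperator_mollOp n).comp_clm (toL2L Ω)

end IsStarDomain

end HelmholtzRobin

/-! ### The trace operator and a boundary estimate for Green's formula. -/

namespace HelmholtzRobin

theorem lintegral_enorm_mul_enorm_le {α F G : Type*} [MeasurableSpace α] [NormedAddCommGroup F]
    [NormedAddCommGroup G] (μ : Measure α) {f : α → F} {g : α → G} (hf : AEStronglyMeasurable f μ)
    (hg : AEStronglyMeasurable g μ) :
    ∫⁻ x, ‖f x‖ₑ * ‖g x‖ₑ ∂μ ≤ eLpNorm f 2 μ * eLpNorm g 2 μ := by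
  have h := eLpNorm_smul_le_mul_eLpNorm (p := 2) (q := 2) (r := 1) hg.norm hf.norm
  rw [eLpNorm_norm, eLpNorm_norm, eLpNorm_one_eq_lintegral_enorm] at h
  refine le_trans (le_of_eq (lintegral_congr fun x => ?_)) h
  rw [Pi.smul_apply', enorm_smul, enorm_norm, enorm_norm]

theorem memLp_surfaceMeasure {Ω : Set E3} (hb : Bornology.IsBounded Ω)
    [IsFiniteMeasure (surfaceMeasure Ω)] {φ : E3 → ℂ} (hφ : Continuous φ) :
    MemLp φ 2 (surfaceMeasure Ω) := by
  obtain ⟨C, hC⟩ := hb.isCompact_closure.exists_bound_of_continuousOn hφ.continuousOn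
  exact MemLp.of_bound hφ.aestronglyMeasurable C
    ((ae_restrict_iff' isClosed_frontier.measurableSet).2
      (Eventually.of_forall fun x hx => hC x (frontier_subset_closure hx)))

namespace IsStarDomain

variable {Ω : Set E3} {c : E3} {ρ M : ℝ}

theorem memLp_bdry (h : IsStarDomain Ω c ρ M) (φ : smoothFun) :
    MemLp (φ : E3 → ℂ) 2 (surfaceMeasure Ω) :=
  have := h.isFiniteMeasure_surfaceMeasure
  memLp_surfaceMeasure h.isBounded (smoothFun_continuous φ)

/-- The restriction of smooth functions to the boundary. -/
noncomputable def toBdry (h : IsStarDomain Ω c ρ M) : smoothFun →ₗ[ℂ] L2Bdry Ω where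
  toFun φ := (h.memLp_bdry φ).toLp
  map_add' _ _ := rfl
  map_smul' _ _ := rfl

theorem coeFn_toBdry (h : IsStarDomain Ω c ρ M) (φ : smoothFun) :
    h.toBdry φ =ᵐ[surfaceMeasure Ω] φ :=
  (h.memLp_bdry φ).coeFn_toLp

/-- Multiplicative trace inequality for smooth functions. -/
theorem exists_norm_toBdry_sq_le (h : IsStarDomain Ω c ρ M) : ∃ K : ℝ, 0 ≤ K ∧ ∀ φ : smoothFun,
    ‖h.toBdry φ‖ ^ 2 ≤ K * (‖toL2 (smoothToH1 h.isOpen h.isBounded φ)‖ *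
      (‖toL2 (smoothToH1 h.isOpen h.isBounded φ)‖ +
        ‖grad (smoothToH1 h.isOpen h.isBounded φ)‖)) := by
  obtain ⟨K, hK⟩ := h.exists_lintegral_surface_le
  have hM := h.radius_nonneg
  refine ⟨K * (3 + 2 * M), by positivity, fun φ => ?_⟩
  set v := smoothToH1 h.isOpen h.isBounded φ with hv
  have hφ1 : ContDiff ℝ 1 (φ : E3 → ℂ) := (smoothFun_contDiff φ).of_le (by simp)
  -- The surface estimate is applied to `φ · φ` rather than `|φ|²`: it has the same modulus, and its
  -- derivative is simply `2 φ ∂φ`.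
  have hpt : ∀ x ∈ Ω, ‖radialDiv c (fun x => (φ : E3 → ℂ) x * (φ : E3 → ℂ) x) x‖ₑ ≤
      3 * (‖(φ : E3 → ℂ) x‖ₑ * ‖(φ : E3 → ℂ) x‖ₑ) +
        ENNReal.ofReal (2 * M) * (‖(φ : E3 → ℂ) x‖ₑ * ‖classicalGrad φ x‖ₑ) := by
    intro x hx
    have hd := ((hφ1.differentiable one_ne_zero) x).hasFDerivAt
    have h1 : fderiv ℝ (fun x => (φ : E3 → ℂ) x * (φ : E3 → ℂ) x) x (x - c) =
        2 * ((φ : E3 → ℂ) x * fderiv ℝ (φ : E3 → ℂ) x (x - c)) := by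
      have hm : HasFDerivAt (fun x => (φ : E3 → ℂ) x * (φ : E3 → ℂ) x) _ x := hd.mul hd
      rw [hm.fderiv]
      simp only [add_apply, smul_apply, smul_eq_mul]
      ring
    have h2 : ‖fderiv ℝ (φ : E3 → ℂ) x (x - c)‖ ≤ ‖classicalGrad φ x‖ * M :=
      (norm_fderiv_apply_le _ _ _).trans
        (by gcongr; exact h.norm_le_of_mem_closure (subset_closure hx))
    have h3 : ‖radialDiv c (fun x => (φ : E3 → ℂ) x * (φ : E3 → ℂ) x) x‖ ≤
        3 * (‖(φ : E3 → ℂ) x‖ * ‖(φ : E3 → ℂ) x‖) +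
          (2 * M) * (‖(φ : E3 → ℂ) x‖ * ‖classicalGrad φ x‖) := by
      rw [radialDiv, h1]
      refine (norm_add_le _ _).trans ?_
      simp only [norm_mul, Complex.norm_ofNat]
      have : ‖(φ : E3 → ℂ) x‖ * ‖fderiv ℝ (φ : E3 → ℂ) x (x - c)‖ ≤
        ‖(φ : E3 → ℂ) x‖ * (‖classicalGrad φ x‖ * M) := by gcongr
      linarith
    simp only [← ofReal_norm]
    rw [← ENNReal.ofReal_mul (norm_nonneg _), ← ENNReal.ofReal_mul (norm_nonneg _),
      ← ENNReal.ofReal_mul (by positivity), ← ENNReal.ofReal_ofNat 3,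
      ← ENNReal.ofReal_mul (by positivity), ← ENNReal.ofReal_add (by positivity) (by positivity)]
    exact ENNReal.ofReal_le_ofReal h3
  have hcφ := smoothFun_continuous φ
  have hcg := smoothFun_continuous_classicalGrad φ
  have hN1 : eLpNorm (φ : E3 → ℂ) 2 (volume.restrict Ω) = ‖toL2 v‖ₑ := by
    rw [Lp.enorm_def]
    exact eLpNorm_congr_ae (coeFn_toL2_smoothToH1 h.isOpen h.isBounded φ).symm
  have hN2 : eLpNorm (classicalGrad φ) 2 (volume.restrict Ω) = ‖grad v‖ₑ := by
    rw [Lp.enorm_def]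
    exact eLpNorm_congr_ae (coeFn_grad_smoothToH1 h.isOpen h.isBounded φ).symm
  have key : ‖h.toBdry φ‖ₑ ^ 2 ≤
      K * (3 * (‖toL2 v‖ₑ * ‖toL2 v‖ₑ) + ENNReal.ofReal (2 * M) * (‖toL2 v‖ₑ * ‖grad v‖ₑ)) := by
    calc ‖h.toBdry φ‖ₑ ^ 2 = ∫⁻ x, ‖(φ : E3 → ℂ) x * (φ : E3 → ℂ) x‖ₑ ∂surfaceMeasure Ω := by
          rw [enorm_sq_Lp]
          refine lintegral_congr_ae ?_
          filter_upwards [h.coeFn_toBdry φ] with x hx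
          rw [hx, enorm_mul, sq]
      _ ≤ K * ∫⁻ x in Ω, ‖radialDiv c (fun x => (φ : E3 → ℂ) x * (φ : E3 → ℂ) x) x‖ₑ :=
          hK _ (hφ1.mul hφ1)
      _ ≤ K * ∫⁻ x in Ω, (3 * (‖(φ : E3 → ℂ) x‖ₑ * ‖(φ : E3 → ℂ) x‖ₑ) +
            ENNReal.ofReal (2 * M) * (‖(φ : E3 → ℂ) x‖ₑ * ‖classicalGrad φ x‖ₑ)) := by
          refine mul_le_mul' le_rfl ?_
          exact setLIntegral_mono' h.isOpen.measurableSet hpt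
      _ = K * (3 * (∫⁻ x in Ω, ‖(φ : E3 → ℂ) x‖ₑ * ‖(φ : E3 → ℂ) x‖ₑ) +
            ENNReal.ofReal (2 * M) * ∫⁻ x in Ω, ‖(φ : E3 → ℂ) x‖ₑ * ‖classicalGrad φ x‖ₑ) := by
          have m1 : Measurable fun x => ‖(φ : E3 → ℂ) x‖ₑ := hcφ.measurable.enorm
          have m2 : Measurable fun x => ‖classicalGrad φ x‖ₑ := hcg.measurable.enorm
          have m11 : Measurable fun x => ‖(φ : E3 → ℂ) x‖ₑ * ‖(φ : E3 → ℂ) x‖ₑ := m1.mul m1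
          have m12 : Measurable fun x => ‖(φ : E3 → ℂ) x‖ₑ * ‖classicalGrad φ x‖ₑ := m1.mul m2
          have m13 : Measurable fun x => 3 * (‖(φ : E3 → ℂ) x‖ₑ * ‖(φ : E3 → ℂ) x‖ₑ) :=
            m11.const_mul 3
          rw [lintegral_add_left m13, lintegral_const_mul _ m11, lintegral_const_mul _ m12]
      _ ≤ _ := by
          rw [← hN1, ← hN2]
          gcongr
          · exact lintegral_enorm_mul_enorm_le _ hcφ.aestronglyMeasurable hcφ.aestronglyMeasurable
          · exact lintegral_enorm_mul_enorm_le _ hcφ.aestronglyMeasurable hcg.aestronglyMeasurable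
  set a := ‖toL2 v‖
  set b := ‖grad v‖
  have ha : 0 ≤ a := norm_nonneg _
  have hb : 0 ≤ b := norm_nonneg _
  have key2 : ‖h.toBdry φ‖ ^ 2 ≤ K * (3 * (a * a) + 2 * M * (a * b)) := by
    simp only [← ofReal_norm] at key
    rw [← ENNReal.ofReal_pow (norm_nonneg _), ← ENNReal.ofReal_mul (norm_nonneg _),
      ← ENNReal.ofReal_mul (norm_nonneg _),
      ← ENNReal.ofReal_mul (by positivity), ← ENNReal.ofReal_ofNat 3,
      ← ENNReal.ofReal_mul (by positivity), ← ENNReal.ofReal_add (by positivity) (by positivity),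
      ← ENNReal.ofReal_coe_nnreal, ← ENNReal.ofReal_mul (by positivity),
      ENNReal.ofReal_le_ofReal_iff (by positivity)] at key
    exact key
  refine key2.trans ?_
  have h1 : 3 * (a * a) + 2 * M * (a * b) ≤ (3 + 2 * M) * (a * (a + b)) := by
    nlinarith [mul_nonneg ha hb, mul_nonneg hM (mul_nonneg ha ha)]
  calc K * (3 * (a * a) + 2 * M * (a * b)) ≤ K * ((3 + 2 * M) * (a * (a + b))) := by gcongr
    _ = _ := by ring

theorem norm_toL2_le (u : H1 Ω) : ‖toL2 u‖ ≤ ‖u‖ := by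
  refine le_of_sq_le_sq ?_ (norm_nonneg _)
  rw [norm_sq_H1]
  nlinarith [sq_nonneg ‖grad u‖]

theorem exists_norm_toBdry_le (h : IsStarDomain Ω c ρ M) : ∃ K : ℝ, ∀ φ : smoothFun,
    ‖h.toBdry φ‖ ≤ K * ‖smoothToH1 h.isOpen h.isBounded φ‖ := by
  obtain ⟨K, hK0, hK⟩ := h.exists_norm_toBdry_sq_le
  refine ⟨Real.sqrt (2 * K), fun φ => le_of_sq_le_sq ?_ (by positivity)⟩
  refine (hK φ).trans ?_
  rw [mul_pow, Real.sq_sqrt (by positivity)]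
  set v := smoothToH1 h.isOpen h.isBounded φ
  calc K * (‖toL2 v‖ * (‖toL2 v‖ + ‖grad v‖)) ≤ K * (‖v‖ * (‖v‖ + ‖v‖)) := by
        gcongr
        · exact norm_toL2_le v
        · exact norm_toL2_le v
        · exact norm_grad_le v
    _ = _ := by ring

/-- Extension by continuity from the dense range of `smoothToH1`. An `H¹` function that agrees
almost everywhere with a smooth one equals its image there, which is all that the defining property
tests. -/
theorem exists_isTraceOperator (h : IsStarDomain Ω c ρ M) :
    ∃ T : H1 Ω →L[ℂ] L2Bdry Ω, IsTraceOperator Ω T := by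
  refine ⟨h.toBdry.extendOfNorm (smoothToH1 h.isOpen h.isBounded), fun φ hφ u hu => ?_⟩
  rw [eq_smoothToH1 h.isOpen h.isBounded ⟨φ, hφ⟩ hu,
    LinearMap.extendOfNorm_eq h.denseRange_smoothToH1 h.exists_norm_toBdry_le]
  exact h.coeFn_toBdry ⟨φ, hφ⟩

theorem isTraceOperator_trace (h : IsStarDomain Ω c ρ M) : IsTraceOperator Ω (trace Ω) := by
  rw [trace, dif_pos h.exists_isTraceOperator]
  exact h.exists_isTraceOperator.choose_spec

/-- Fixes the chosen `trace` on a dense subspace, so estimates for it follow from those for smooth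
functions. -/
theorem trace_smoothToH1 (h : IsStarDomain Ω c ρ M) (φ : smoothFun) :
    trace Ω (smoothToH1 h.isOpen h.isBounded φ) = h.toBdry φ :=
  Lp.ext ((h.isTraceOperator_trace φ (smoothFun_contDiff φ) _
    (coeFn_toL2_smoothToH1 h.isOpen h.isBounded φ)).trans (h.coeFn_toBdry φ).symm)

/-- Multiplicative trace inequality. -/
theorem exists_norm_trace_sq_le (h : IsStarDomain Ω c ρ M) : ∃ K : ℝ, 0 ≤ K ∧ ∀ u : H1 Ω,
    ‖trace Ω u‖ ^ 2 ≤ K * (‖toL2 u‖ * (‖toL2 u‖ + ‖grad u‖)) := by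
  obtain ⟨K, hK0, hK⟩ := h.exists_norm_toBdry_sq_le
  refine ⟨K, hK0, fun u => ?_⟩
  refine h.denseRange_smoothToH1.induction_on
    (p := fun u : H1 Ω => ‖trace Ω u‖ ^ 2 ≤ K * (‖toL2 u‖ * (‖toL2 u‖ + ‖grad u‖))) u
    (isClosed_le ?_ ?_) fun φ => ?_
  · exact (trace Ω).continuous.norm.pow 2
  · exact continuous_const.mul ((toL2L Ω).continuous.norm.mul
      ((toL2L Ω).continuous.norm.add (gradL Ω).continuous.norm))
  · rw [h.trace_smoothToH1]
    exact hK φ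

/-- A constant field is a multiple of the difference of two radial fields: with `c' = c + (ρ/2) e`,
`(x - c) - (x - c') = (ρ/2) e`, and the terms `3ψ` cancel. The domain is still star-shaped about a
smaller ball centred at `c'`. -/
theorem exists_enorm_integral_fderiv_le (h : IsStarDomain Ω c ρ M) (i : Fin 3) :
    ∃ K : NNReal, ∀ ψ : E3 → ℂ, ContDiff ℝ 1 ψ →
      ‖∫ x in Ω, fderiv ℝ ψ x (EuclideanSpace.single i 1)‖ₑ ≤
        K * ∫⁻ x, ‖ψ x‖ₑ ∂surfaceMeasure Ω := by
  have hρ := h.pos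
  set e := EuclideanSpace.single (𝕜 := ℝ) i (1 : ℝ) with he
  set c' : E3 := c + (ρ / 2) • e with hc'
  have h' : IsStarDomain Ω c' (ρ / 2) (M + ρ / 2) := h.change_center (by
    rw [hc', dist_self_add_left, norm_smul, he, PiLp.norm_single, norm_one, mul_one,
      Real.norm_of_nonneg (by positivity)])
  obtain ⟨K, hK⟩ := h.exists_enorm_integral_radialDiv_le
  obtain ⟨K', hK'⟩ := h'.exists_enorm_integral_radialDiv_le
  refine ⟨Real.toNNReal (2 / ρ) * (K + K'), fun ψ hψ => ?_⟩
  have hint : ∀ c, IntegrableOn (radialDiv c ψ) Ω := fun c =>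
    ((continuous_radialDiv c hψ).continuousOn.integrableOn_compact
      h.isBounded.isCompact_closure).mono_set subset_closure
  have h1 : ∫ x in Ω, fderiv ℝ ψ x e =
      (2 / ρ) • ((∫ x in Ω, radialDiv c ψ x) - ∫ x in Ω, radialDiv c' ψ x) := by
    rw [← integral_sub (hint c) (hint c'), ← integral_smul]
    congr 1
    funext x
    have h2 : (fderiv ℝ ψ x) (x - c) - (fderiv ℝ ψ x) (x - c') = (ρ / 2) • fderiv ℝ ψ x e := by
      rw [← map_sub, ← map_smul]; congr 1; rw [hc']; module
    rw [radialDiv, radialDiv, add_sub_add_left_eq_sub, h2, smul_smul, div_mul_div_comm,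
      mul_comm 2 ρ, div_self (by positivity), one_smul]
  rw [h1, enorm_smul]
  have h3 : ‖(2 / ρ : ℝ)‖ₑ = (Real.toNNReal (2 / ρ) : ℝ≥0∞) := by
    rw [Real.enorm_eq_ofReal (by positivity)]; rfl
  rw [h3]
  push_cast
  rw [mul_assoc, add_mul]
  gcongr
  exact enorm_sub_le.trans (add_le_add (hK ψ hψ) (hK' ψ hψ))

/-- The boundary term in Green's formula is controlled by the traces. -/
theorem exists_norm_green_le (h : IsStarDomain Ω c ρ M) (i : Fin 3) :
    ∃ K : ℝ, ∀ (w : smoothFun) (u : H1 Ω),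
      ‖inner ℂ (toL2 (smoothToH1 h.isOpen h.isBounded w)) (comp Ω i (grad u)) +
        inner ℂ (comp Ω i (grad (smoothToH1 h.isOpen h.isBounded w))) (toL2 u)‖ ≤
      K * ‖h.toBdry w‖ * ‖trace Ω u‖ := by
  obtain ⟨K, hK⟩ := h.exists_enorm_integral_fderiv_le i
  refine ⟨K, fun w u => ?_⟩
  set e := EuclideanSpace.single (𝕜 := ℝ) i (1 : ℝ) with he
  set W := smoothToH1 h.isOpen h.isBounded w with hW
  refine h.denseRange_smoothToH1.induction_on (p := fun u : H1 Ω =>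
    ‖inner ℂ (toL2 W) (comp Ω i (grad u)) + inner ℂ (comp Ω i (grad W)) (toL2 u)‖ ≤
      K * ‖h.toBdry w‖ * ‖trace Ω u‖) u (isClosed_le ?_ ?_) fun φ => ?_
  · have h1 : Continuous fun u : H1 Ω => comp Ω i (gradL Ω u) := by fun_prop
    have h2 : Continuous fun u : H1 Ω => toL2L Ω u := by fun_prop
    exact ((continuous_const.inner h1).add (continuous_const.inner h2)).norm
  · exact continuous_const.mul (trace Ω).continuous.norm
  rw [h.trace_smoothToH1]
  set v := smoothToH1 h.isOpen h.isBounded φ with hv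
  have hφ1 : ContDiff ℝ 1 (φ : E3 → ℂ) := (smoothFun_contDiff φ).of_le (by simp)
  have hw1 : ContDiff ℝ 1 (w : E3 → ℂ) := (smoothFun_contDiff w).of_le (by simp)
  -- By the product rule the sum of the two inner products is the integral of `∂ᵢ(conj w · φ)`.
  set ψ : E3 → ℂ := fun x => Complex.conjCLE ((w : E3 → ℂ) x) * (φ : E3 → ℂ) x with hψ
  have hψ1 : ContDiff ℝ 1 ψ := (Complex.conjCLE.contDiff.comp hw1).mul hφ1
  have hd : ∀ x, fderiv ℝ ψ x e = conj ((w : E3 → ℂ) x) * fderiv ℝ (φ : E3 → ℂ) x e +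
      conj (fderiv ℝ (w : E3 → ℂ) x e) * (φ : E3 → ℂ) x := by
    intro x
    have d1 := ((hφ1.differentiable one_ne_zero) x).hasFDerivAt
    have d2 := ((hw1.differentiable one_ne_zero) x).hasFDerivAt
    have d3 : HasFDerivAt (fun x => Complex.conjCLE ((w : E3 → ℂ) x)) _ x :=
      Complex.conjCLE.hasFDerivAt.comp x d2
    have d4 : HasFDerivAt ψ _ x := d3.mul d1
    rw [d4.fderiv]
    simp [mul_comm]
  have heq : inner ℂ (toL2 W) (comp Ω i (grad v)) + inner ℂ (comp Ω i (grad W)) (toL2 v) =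
      ∫ x in Ω, fderiv ℝ ψ x e := by
    rw [MeasureTheory.L2.inner_def, MeasureTheory.L2.inner_def,
      ← integral_add (L2.integrable_inner _ _) (L2.integrable_inner _ _)]
    refine integral_congr_ae ?_
    filter_upwards [coeFn_toL2_smoothToH1 h.isOpen h.isBounded w,
      coeFn_toL2_smoothToH1 h.isOpen h.isBounded φ, coeFn_comp i (grad v), coeFn_comp i (grad W),
      coeFn_grad_smoothToH1 h.isOpen h.isBounded w,
      coeFn_grad_smoothToH1 h.isOpen h.isBounded φ] with x h1 h2 h3 h4 h5 h6
    rw [hd, h3, h4, h1, h2, h5, h6, RCLike.inner_apply, RCLike.inner_apply]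
    change fderiv ℝ (φ : E3 → ℂ) x e * conj ((w : E3 → ℂ) x) +
      (φ : E3 → ℂ) x * conj (fderiv ℝ (w : E3 → ℂ) x e) = _
    ring
  rw [heq]
  have key : ‖∫ x in Ω, fderiv ℝ ψ x e‖ₑ ≤ K * (‖h.toBdry w‖ₑ * ‖h.toBdry φ‖ₑ) := by
    refine (hK ψ hψ1).trans ?_
    gcongr
    rw [Lp.enorm_def, Lp.enorm_def, eLpNorm_congr_ae (h.coeFn_toBdry w),
      eLpNorm_congr_ae (h.coeFn_toBdry φ)]
    refine le_trans (le_of_eq (lintegral_congr fun x => ?_))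
      (lintegral_enorm_mul_enorm_le _ (smoothFun_continuous w).aestronglyMeasurable
        (smoothFun_continuous φ).aestronglyMeasurable)
    rw [hψ, enorm_mul]
    congr 1
    rw [← ofReal_norm, ← ofReal_norm]
    simp
  simp only [← ofReal_norm] at key
  rwa [← ENNReal.ofReal_mul (norm_nonneg _), ← ENNReal.ofReal_coe_nnreal,
    ← ENNReal.ofReal_mul (by positivity), ENNReal.ofReal_le_ofReal_iff (by positivity),
    ← mul_assoc] at key

end IsStarDomain

end HelmholtzRobin

/-! ### Uniqueness for the Robin problem, by Fourier transform. -/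

namespace HelmholtzRobin

open scoped FourierTransform SchwartzMap

/-- An integrable function whose Fourier transform vanishes almost everywhere is zero. -/
theorem ae_eq_zero_of_fourier_ae_eq_zero {V : Type*} [NormedAddCommGroup V] [InnerProductSpace ℝ V]
    [FiniteDimensional ℝ V] [MeasurableSpace V] [BorelSpace V] {f : V → ℂ} (hf : Integrable f)
    (h : 𝓕 f =ᵐ[volume] 0) : f =ᵐ[volume] 0 := by
  refine ae_eq_zero_of_integral_contDiff_smul_eq_zero hf.locallyIntegrable fun g hg hc => ?_
  have hc' : HasCompactSupport (Complex.ofRealCLM ∘ g) := hc.comp_left rfl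
  have hg' : ContDiff ℝ ∞ (Complex.ofRealCLM ∘ g) := by fun_prop
  set G : 𝓢(V, ℂ) := hc'.toSchwartzMap hg'
  have hG : 𝓕 (𝓕⁻ G) = G := FourierTransform.fourier_fourierInv_eq G
  -- A test function is the Fourier transform of a Schwartz function, and the transform is then
  -- moved onto `f`.
  have h1 : ∫ x, 𝓕 (𝓕⁻ G) x • f x = ∫ x, (𝓕⁻ G) x • 𝓕 f x := by
    have h2 := VectorFourier.integral_fourierIntegral_smul_eq_flip (L := innerₗ V)
      Real.continuous_fourierChar continuous_inner (SchwartzMap.integrable (μ := volume) (𝓕⁻ G)) hf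
    rwa [flip_innerₗ] at h2
  rw [hG] at h1
  have h2 : ∫ x, (𝓕⁻ G) x • 𝓕 f x = 0 := by
    refine integral_eq_zero_of_ae ?_
    filter_upwards [h] with x hx
    simp [hx]
  rw [← h2, ← h1]
  refine integral_congr_ae (Eventually.of_forall fun x => ?_)
  change g x • f x = (g x : ℂ) • f x
  simp

/-- The plane wave `x ↦ exp(2πi ξ·x)`. -/
noncomputable def planeWave (ξ : E3) : smoothFun :=
  ⟨fun x => Complex.exp (((2 * Real.pi * inner ℝ x ξ : ℝ) : ℂ) * Complex.I), by
    have h : ContDiff ℝ ∞ fun x : E3 => 2 * Real.pi * inner ℝ x ξ :=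
      contDiff_const.mul (contDiff_id.inner ℝ contDiff_const)
    exact ((Complex.ofRealCLM.contDiff.comp h).mul contDiff_const).cexp⟩

theorem planeWave_apply (ξ x : E3) : (planeWave ξ : E3 → ℂ) x =
    Complex.exp (((2 * Real.pi * inner ℝ x ξ : ℝ) : ℂ) * Complex.I) := rfl

theorem classicalGrad_planeWave (ξ x : E3) (i : Fin 3) : classicalGrad (planeWave ξ) x i =
    ((2 * Real.pi * ξ i : ℝ) : ℂ) * Complex.I * (planeWave ξ : E3 → ℂ) x := by
  have h0 : HasFDerivAt (fun x : E3 => 2 * Real.pi * inner ℝ x ξ)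
      ((2 * Real.pi) • innerSL ℝ ξ) x := by
    have := ((innerSL ℝ ξ).hasFDerivAt (x := x)).const_mul (2 * Real.pi)
    refine this.congr_of_eventuallyEq (Eventually.of_forall fun y => ?_)
    simp [real_inner_comm]
  have h1 : HasFDerivAt (fun x : E3 => (((2 * Real.pi * inner ℝ x ξ : ℝ) : ℂ) * Complex.I)) _ x :=
    (Complex.ofRealCLM.hasFDerivAt.comp x h0).mul_const Complex.I
  have h2 : HasFDerivAt (planeWave ξ : E3 → ℂ) _ x := h1.cexp
  change fderiv ℝ (planeWave ξ : E3 → ℂ) x (EuclideanSpace.single i 1) = _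
  rw [h2.fderiv, planeWave_apply]
  simp [EuclideanSpace.inner_single_right]
  ring

variable {Ω : Set E3} {c : E3} {ρ M : ℝ}

theorem aForm_self (ζ : ℂ) (u : H1 Ω) : aForm ζ u u =
    (‖grad u‖ ^ 2 : ℝ) + ζ ^ 2 * (‖toL2 u‖ ^ 2 : ℝ) + ζ * (‖trace Ω u‖ ^ 2 : ℝ) := by
  simp only [aForm, bForm, inner_self_eq_norm_sq_to_K]
  push_cast
  rfl

namespace IsStarDomain

theorem comp_grad_planeWave (h : IsStarDomain Ω c ρ M) (ξ : E3) (i : Fin 3) :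
    comp Ω i (grad (smoothToH1 h.isOpen h.isBounded (planeWave ξ))) =
      (((2 * Real.pi * ξ i : ℝ) : ℂ) * Complex.I) •
        toL2 (smoothToH1 h.isOpen h.isBounded (planeWave ξ)) := by
  apply Lp.ext
  filter_upwards [coeFn_comp i (grad (smoothToH1 h.isOpen h.isBounded (planeWave ξ))),
    coeFn_grad_smoothToH1 h.isOpen h.isBounded (planeWave ξ),
    coeFn_toL2_smoothToH1 h.isOpen h.isBounded (planeWave ξ),
    Lp.coeFn_smul (((2 * Real.pi * ξ i : ℝ) : ℂ) * Complex.I)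
      (toL2 (smoothToH1 h.isOpen h.isBounded (planeWave ξ)))] with x h1 h2 h3 h4
  rw [h1, h2, h4, Pi.smul_apply, h3, classicalGrad_planeWave, smul_eq_mul]

/-- An `H¹` function with vanishing trace has a Fourier symbol for its Dirichlet form. -/
theorem inner_grad_planeWave (h : IsStarDomain Ω c ρ M) (ξ : E3) {u : H1 Ω}
    (hu : trace Ω u = 0) :
    inner ℂ (grad (smoothToH1 h.isOpen h.isBounded (planeWave ξ))) (grad u) =
      (((2 * Real.pi * ‖ξ‖) ^ 2 : ℝ) : ℂ) *
        inner ℂ (toL2 (smoothToH1 h.isOpen h.isBounded (planeWave ξ))) (toL2 u) := by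
  set W := smoothToH1 h.isOpen h.isBounded (planeWave ξ) with hW
  -- Zero trace annihilates the bound on the boundary term, so integration by parts is exact.
  have hgreen : ∀ i, inner ℂ (toL2 W) (comp Ω i (grad u)) =
      -inner ℂ (comp Ω i (grad W)) (toL2 u) := by
    intro i
    obtain ⟨K, hK⟩ := h.exists_norm_green_le i
    have := hK (planeWave ξ) u
    rw [hu, norm_zero, mul_zero, norm_le_zero_iff] at this
    exact eq_neg_of_add_eq_zero_left this
  have hi : ∀ i, inner ℂ (comp Ω i (grad W)) (comp Ω i (grad u)) =
      (((2 * Real.pi * ξ i) ^ 2 : ℝ) : ℂ) * inner ℂ (toL2 W) (toL2 u) := by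
    intro i
    rw [h.comp_grad_planeWave, inner_smul_left, hgreen, h.comp_grad_planeWave, inner_smul_left,
      map_mul, Complex.conj_I, Complex.conj_ofReal]
    push_cast
    linear_combination (-(2 * Real.pi * ξ i) ^ 2 * inner ℂ (toL2 W) (toL2 u) : ℂ) * Complex.I_sq
  rw [inner_eq_sum_comp, Finset.sum_congr rfl fun i _ => hi i, ← Finset.sum_mul,
    ← Complex.ofReal_sum]
  congr 2
  rw [mul_pow, EuclideanSpace.norm_sq_eq, Finset.mul_sum]
  exact Finset.sum_congr rfl fun i _ => by rw [mul_pow, Real.norm_eq_abs, sq_abs]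

theorem fourier_indicator (h : IsStarDomain Ω c ρ M) (u : H1 Ω) (ξ : E3) :
    𝓕 (Ω.indicator (toL2 u)) ξ =
      inner ℂ (toL2 (smoothToH1 h.isOpen h.isBounded (planeWave ξ))) (toL2 u) := by
  rw [Real.fourier_eq', MeasureTheory.L2.inner_def]
  have : (fun v : E3 => Complex.exp (↑(-2 * Real.pi * inner ℝ v ξ) * Complex.I) •
      Ω.indicator (toL2 u) v) = Ω.indicator fun v =>
        Complex.exp (↑(-2 * Real.pi * inner ℝ v ξ) * Complex.I) • toL2 u v := by
    funext v
    by_cases hv : v ∈ Ω <;> simp [hv]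
  rw [this, integral_indicator h.isOpen.measurableSet]
  refine integral_congr_ae ?_
  filter_upwards [coeFn_toL2_smoothToH1 h.isOpen h.isBounded (planeWave ξ)] with x hx
  rw [hx, RCLike.inner_apply, planeWave_apply, smul_eq_mul, mul_comm]
  congr 1
  rw [← Complex.exp_conj, map_mul, Complex.conj_I, Complex.conj_ofReal]
  push_cast
  congr 1
  ring

/-- Unique continuation for the Helmholtz equation with vanishing Cauchy data. -/
theorem eq_zero_of_trace_eq_zero (h : IsStarDomain Ω c ρ M) {k : ℝ} {u : H1 Ω}
    (hu : trace Ω u = 0)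
    (ha : ∀ w : H1 Ω, inner ℂ (grad w) (grad u) = (k ^ 2 : ℝ) * inner ℂ (toL2 w) (toL2 u)) :
    u = 0 := by
  -- Testing with the plane wave of frequency `ξ` gives `(k² - 4π²|ξ|²) û(ξ) = 0`, and the sphere
  -- `2π|ξ| = |k|` is a null set.
  have hF : 𝓕 (Ω.indicator (toL2 u)) =ᵐ[volume] 0 := by
    have hnull : ∀ᵐ ξ : E3, ξ ∉ Metric.sphere (0 : E3) (|k| / (2 * Real.pi)) :=
      measure_eq_zero_iff_ae_notMem.1 (Measure.addHaar_sphere _ _ _)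
    filter_upwards [hnull] with ξ hξ
    rw [h.fourier_indicator, Pi.zero_apply]
    have h1 := h.inner_grad_planeWave ξ hu
    rw [ha, ← sub_eq_zero, ← sub_mul, mul_eq_zero] at h1
    refine h1.resolve_left fun h2 => hξ ?_
    rw [← Complex.ofReal_sub, Complex.ofReal_eq_zero, sub_eq_zero, sq_eq_sq_iff_abs_eq_abs,
      abs_of_nonneg (a := 2 * Real.pi * ‖ξ‖) (by positivity)] at h2
    rw [mem_sphere_zero_iff_norm, h2]
    field_simp
  have := h.isFiniteMeasure_restrict
  have hint : Integrable (Ω.indicator (toL2 u)) := by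
    rw [integrable_indicator_iff h.isOpen.measurableSet]
    exact (Lp.memLp (toL2 u)).integrable (by norm_num)
  have h0 := ae_eq_zero_of_fourier_ae_eq_zero hint hF
  apply H1.ext_of_toL2_eq h.isOpen
  apply Lp.ext
  refine EventuallyEq.trans ?_ (Lp.coeFn_zero ℂ 2 (volume.restrict Ω)).symm
  filter_upwards [ae_restrict_of_ae h0, ae_restrict_mem h.isOpen.measurableSet] with x hx hxΩ
  rwa [indicator_of_mem hxΩ] at hx

/-- Uniqueness for the Helmholtz problem with Robin boundary conditions. -/
theorem eq_zero_of_aForm_eq_zero (h : IsStarDomain Ω c ρ M) {ζ : ℂ} (hζ : 0 ≤ ζ.re)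
    (hζ1 : 1 ≤ ‖ζ‖) {u : H1 Ω} (ha : ∀ w, aForm ζ u w = 0) : u = 0 := by
  have hself := ha u
  rw [aForm_self] at hself
  have hre := congrArg Complex.re hself
  have him := congrArg Complex.im hself
  have hn : ζ.re ^ 2 + ζ.im ^ 2 = ‖ζ‖ ^ 2 := by
    rw [Complex.sq_norm, Complex.normSq_apply]; ring
  simp only [Complex.add_re, Complex.add_im, Complex.mul_re, Complex.mul_im, Complex.ofReal_re,
    Complex.ofReal_im, sq, Complex.zero_re, Complex.zero_im] at hre him
  ring_nf at hre him
  set G := ‖grad u‖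
  set U := ‖toL2 u‖
  set T := ‖trace Ω u‖
  -- The real part of `conj ζ · a_ζ(u,u)`, in which all terms are nonnegative.
  have hkey : ζ.re * (G ^ 2 + ‖ζ‖ ^ 2 * U ^ 2) + ‖ζ‖ ^ 2 * T ^ 2 = 0 := by
    rw [← hn]
    linear_combination ζ.re * hre + ζ.im * him
  have hζ2 : 0 < ‖ζ‖ ^ 2 := by positivity
  have hT : T ^ 2 = 0 := by
    have h1 : 0 ≤ ζ.re * (G ^ 2 + ‖ζ‖ ^ 2 * U ^ 2) := by positivity
    have h2 : 0 ≤ ‖ζ‖ ^ 2 * T ^ 2 := by positivity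
    exact (mul_eq_zero.1 (le_antisymm (by linarith) h2)).resolve_left hζ2.ne'
  have htr : trace Ω u = 0 := norm_eq_zero.1 (pow_eq_zero_iff two_ne_zero |>.1 hT)
  rcases hζ.eq_or_lt with h0 | h0
  · refine h.eq_zero_of_trace_eq_zero (k := ζ.im) htr fun w => ?_
    have h3 := ha w
    rw [aForm, bForm, htr, inner_zero_right, mul_zero, add_zero] at h3
    have h4 : ζ ^ 2 = -((ζ.im ^ 2 : ℝ) : ℂ) := by
      apply Complex.ext <;> simp [sq, ← h0]
    rw [h4] at h3
    linear_combination h3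
  · rw [hT, mul_zero, add_zero, mul_eq_zero] at hkey
    have h5 := hkey.resolve_left h0.ne'
    have hU : U ^ 2 = 0 := by
      have : 0 ≤ ‖ζ‖ ^ 2 * U ^ 2 := by positivity
      exact (mul_eq_zero.1 (le_antisymm (by linarith [sq_nonneg G]) this)).resolve_left hζ2.ne'
    apply H1.ext_of_toL2_eq h.isOpen
    have : toL2 u = 0 := norm_eq_zero.1 (pow_eq_zero_iff two_ne_zero |>.1 hU)
    rw [this]
    rfl

end IsStarDomain

end HelmholtzRobin

/-! ### Gårding inequality, duality and quasi-optimality. -/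

namespace HelmholtzRobin

section FunctionalAnalysis

variable {H X : Type*} [NormedAddCommGroup H] [InnerProductSpace ℂ H] [CompleteSpace H]
  [NormedAddCommGroup X] [InnerProductSpace ℂ X] [CompleteSpace X]

/-- The operator representing the form `c (T u, T v)`. -/
noncomputable def sandwich (c : ℂ) (T : H →L[ℂ] X) : H →L[ℂ] H := c • (T.adjoint ∘L T)

theorem inner_sandwich (c : ℂ) (T : H →L[ℂ] X) (u v : H) :
    inner ℂ v (sandwich c T u) = c * inner ℂ (T v) (T u) := by
  rw [sandwich, smul_apply, inner_smul_right, ContinuousLinearMap.comp_apply,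
    ContinuousLinearMap.adjoint_inner_right]

/-- Fredholm alternative on a closed subspace, for forms satisfying a Gårding inequality. -/
theorem exists_mem_forall_inner_eq (A : H →L[ℂ] H) (J : H →L[ℂ] X) (hJ : IsCompactOperator J)
    {c C : ℝ} (hc : 0 < c) (hA : ∀ u, c * ‖u‖ ^ 2 ≤ (inner ℂ u (A u)).re + C * ‖J u‖ ^ 2)
    {S : Submodule ℂ H} (hS : IsClosed (S : Set H))
    (hinj : ∀ u ∈ S, (∀ v ∈ S, inner ℂ v (A u) = 0) → u = 0) (b : H) :
    ∃ u ∈ S, ∀ v ∈ S, inner ℂ v (A u) = inner ℂ v b := by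
  have : CompleteSpace S := hS.completeSpace_coe
  -- The compression of `A` to `S` inherits the Gårding inequality, and its kernel is governed by
  -- `hinj`.
  set B : S →L[ℂ] S := S.subtypeL.adjoint ∘L A ∘L S.subtypeL with hB
  have hBinner : ∀ u v : S, inner ℂ v (B u) = inner ℂ (v : H) (A u) := fun u v => by
    rw [hB, ContinuousLinearMap.comp_apply, ContinuousLinearMap.adjoint_inner_right]
    rfl
  have hsurj : Function.Surjective B := by
    refine surjective_of_garding B (J ∘L S.subtypeL) (hJ.comp_clm S.subtypeL) (C := C) hc
      (fun u => ?_) fun u hu => ?_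
    · rw [hBinner]
      exact hA u
    · refine Subtype.ext (hinj u u.2 fun v hv => ?_)
      rw [← hBinner u ⟨v, hv⟩, hu, inner_zero_right]
  obtain ⟨u, hu⟩ := hsurj (S.subtypeL.adjoint b)
  refine ⟨u, u.2, fun v hv => ?_⟩
  rw [← hBinner u ⟨v, hv⟩, hu, ContinuousLinearMap.adjoint_inner_right]
  rfl

end FunctionalAnalysis

variable {Ω : Set E3} {c : E3} {ρ M : ℝ}

theorem wnorm_nonneg (N : ℝ) (u : H1 Ω) : 0 ≤ wnorm N u := Real.sqrt_nonneg _

theorem wnorm_sq (N : ℝ) (u : H1 Ω) : wnorm N u ^ 2 = ‖grad u‖ ^ 2 + N ^ 2 * ‖toL2 u‖ ^ 2 :=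
  Real.sq_sqrt (by positivity)

theorem norm_grad_le_wnorm (N : ℝ) (u : H1 Ω) : ‖grad u‖ ≤ wnorm N u :=
  Real.le_sqrt_of_sq_le (le_add_of_nonneg_right (by positivity))

theorem mul_norm_toL2_le_wnorm (N : ℝ) (u : H1 Ω) : N * ‖toL2 u‖ ≤ wnorm N u :=
  Real.le_sqrt_of_sq_le (by rw [mul_pow]; exact le_add_of_nonneg_left (by positivity))

theorem wnorm_zero (N : ℝ) : wnorm N (0 : H1 Ω) = 0 := by
  rw [wnorm, ← gradL_apply, ← toL2L_apply, map_zero, map_zero]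
  simp

theorem eq_zero_of_wnorm_eq_zero (hΩ : IsOpen Ω) {N : ℝ} (hN : 1 ≤ N) {u : H1 Ω}
    (hu : wnorm N u ≤ 0) : u = 0 := by
  have h1 := (mul_norm_toL2_le_wnorm N u).trans hu
  have h2 : ‖toL2 u‖ ≤ 0 := by nlinarith [norm_nonneg (toL2 u)]
  apply H1.ext_of_toL2_eq hΩ
  rw [norm_le_zero_iff.1 h2]
  rfl

/-- The operator representing `aForm ζ`. -/
noncomputable def formOp (Ω : Set E3) (ζ : ℂ) : H1 Ω →L[ℂ] H1 Ω :=
  sandwich 1 (gradL Ω) + sandwich (ζ ^ 2) (toL2L Ω) + sandwich ζ (trace Ω)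

theorem inner_formOp (ζ : ℂ) (u v : H1 Ω) : inner ℂ v (formOp Ω ζ u) = aForm ζ u v := by
  simp only [formOp, add_apply, inner_add_right, inner_sandwich, one_mul]
  rfl

theorem aForm_sub_right (ζ : ℂ) (u v w : H1 Ω) :
    aForm ζ u (v - w) = aForm ζ u v - aForm ζ u w := by
  simp only [← inner_formOp, inner_sub_left]

theorem aForm_sub_left (ζ : ℂ) (u v w : H1 Ω) :
    aForm ζ (u - v) w = aForm ζ u w - aForm ζ v w := by
  simp only [← inner_formOp, map_sub, inner_sub_right]

theorem aForm_conj (ζ : ℂ) (u v : H1 Ω) : aForm (conj ζ) u v = conj (aForm ζ v u) := by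
  simp only [aForm, bForm, map_add, map_mul, map_pow, inner_conj_symm]

theorem re_aForm_self (ζ : ℂ) (u : H1 Ω) : (aForm ζ u u).re =
    ‖grad u‖ ^ 2 + (ζ.re ^ 2 - ζ.im ^ 2) * ‖toL2 u‖ ^ 2 + ζ.re * ‖trace Ω u‖ ^ 2 := by
  rw [aForm_self]
  simp only [Complex.add_re, Complex.mul_re, Complex.ofReal_re, Complex.ofReal_im, sq]
  ring

theorem norm_sq_eq_re_sq_add_im_sq (ζ : ℂ) : ‖ζ‖ ^ 2 = ζ.re ^ 2 + ζ.im ^ 2 := by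
  rw [Complex.sq_norm, Complex.normSq_apply]; ring

/-- Gårding inequality. -/
theorem wnorm_sq_le {ζ : ℂ} (hζ : 0 ≤ ζ.re) (u : H1 Ω) :
    wnorm ‖ζ‖ u ^ 2 ≤ (aForm ζ u u).re + 2 * (ζ.im ^ 2 * ‖toL2 u‖ ^ 2) := by
  have : 0 ≤ ζ.re * ‖trace Ω u‖ ^ 2 := by positivity
  rw [wnorm_sq, re_aForm_self, norm_sq_eq_re_sq_add_im_sq]
  linarith

namespace IsStarDomain

theorem nontrivial_H1 (h : IsStarDomain Ω c ρ M) : Nontrivial (H1 Ω) := by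
  refine ⟨smoothToH1 h.isOpen h.isBounded (planeWave 0), 0, fun h0 => ?_⟩
  have h1 := coeFn_toL2_smoothToH1 h.isOpen h.isBounded (planeWave 0)
  rw [h0] at h1
  have h2 : ∀ᵐ x ∂volume.restrict Ω, False := by
    filter_upwards [h1, Lp.coeFn_zero ℂ 2 (volume.restrict Ω)] with x hx hx0
    exact Complex.exp_ne_zero _ (hx.symm.trans hx0)
  rw [eventually_false_iff_eq_bot, ae_eq_bot, Measure.restrict_eq_zero] at h2
  exact (h.isOpen.measure_pos volume h.nonempty).ne' h2

/-- At `ζ = 1` the Gårding inequality has no negative term, so a nonzero `u` forces the continuity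
constant to be at least `1`. This makes divisions by `1 + Cb` safe and `ENNReal.ofReal (1 + Cb)`
faithful for an arbitrary admissible `Cb`. -/
theorem one_le_of_isContinuityConstant (h : IsStarDomain Ω c ρ M) {Cb : ℝ}
    (hCb : IsContinuityConstant Ω Cb) : 1 ≤ 1 + Cb := by
  have := h.nontrivial_H1
  obtain ⟨u, hu⟩ := exists_ne (0 : H1 Ω)
  have h1 := hCb 1 (by simp) (by simp) u u
  have h2 := wnorm_sq_le (ζ := 1) (by simp) u
  simp only [Complex.one_im, norm_one] at h1 h2
  have hpos : 0 < wnorm 1 u := by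
    by_contra! hle
    exact hu (eq_zero_of_wnorm_eq_zero h.isOpen le_rfl hle)
  have h3 := Complex.re_le_norm (aForm 1 u u)
  have h4 : 1 * (wnorm 1 u * wnorm 1 u) ≤ (1 + Cb) * (wnorm 1 u * wnorm 1 u) := by
    nlinarith
  exact le_of_mul_le_mul_right h4 (by positivity)

/-- The multiplicative form of the trace inequality is essential: the factor `|ζ|` pairs with one
`‖u‖`, so `|ζ| ‖γ₀u‖² ≤ 2K ‖u‖²_{|ζ|}` uniformly in `|ζ| ≥ 1`. -/
theorem exists_isContinuityConstant (h : IsStarDomain Ω c ρ M) :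
    ∃ Cb : ℝ, 0 ≤ Cb ∧ IsContinuityConstant Ω Cb := by
  obtain ⟨K, hK0, hK⟩ := h.exists_norm_trace_sq_le
  refine ⟨2 * K, by positivity, fun ζ _ hζ1 u v => ?_⟩
  have htr : ∀ u : H1 Ω, ‖ζ‖ * ‖trace Ω u‖ ^ 2 ≤ 2 * K * wnorm ‖ζ‖ u ^ 2 := by
    intro u
    have hw := wnorm_nonneg ‖ζ‖ u
    have h1 : ‖toL2 u‖ ≤ wnorm ‖ζ‖ u :=
      (le_mul_of_one_le_left (norm_nonneg _) hζ1).trans (mul_norm_toL2_le_wnorm ‖ζ‖ u)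
    calc ‖ζ‖ * ‖trace Ω u‖ ^ 2 ≤ ‖ζ‖ * (K * (‖toL2 u‖ * (‖toL2 u‖ + ‖grad u‖))) := by
          gcongr; exact hK u
      _ = K * ((‖ζ‖ * ‖toL2 u‖) * (‖toL2 u‖ + ‖grad u‖)) := by ring
      _ ≤ K * (wnorm ‖ζ‖ u * (wnorm ‖ζ‖ u + wnorm ‖ζ‖ u)) := by
          gcongr
          · exact mul_norm_toL2_le_wnorm ‖ζ‖ u
          · exact norm_grad_le_wnorm ‖ζ‖ u
      _ = _ := by ring
  have hwu := wnorm_nonneg ‖ζ‖ u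
  have hwv := wnorm_nonneg ‖ζ‖ v
  have hT : ‖ζ‖ * (‖trace Ω u‖ * ‖trace Ω v‖) ≤ 2 * K * (wnorm ‖ζ‖ u * wnorm ‖ζ‖ v) := by
    refine le_of_sq_le_sq ?_ (by positivity)
    calc (‖ζ‖ * (‖trace Ω u‖ * ‖trace Ω v‖)) ^ 2 =
          (‖ζ‖ * ‖trace Ω u‖ ^ 2) * (‖ζ‖ * ‖trace Ω v‖ ^ 2) := by ring
      _ ≤ (2 * K * wnorm ‖ζ‖ u ^ 2) * (2 * K * wnorm ‖ζ‖ v ^ 2) := by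
          exact mul_le_mul (htr u) (htr v) (by positivity) (by positivity)
      _ = _ := by ring
  have hV : ‖grad u‖ * ‖grad v‖ + ‖ζ‖ ^ 2 * (‖toL2 u‖ * ‖toL2 v‖) ≤
      wnorm ‖ζ‖ u * wnorm ‖ζ‖ v := by
    refine le_of_sq_le_sq ?_ (by positivity)
    rw [mul_pow (wnorm _ _), wnorm_sq, wnorm_sq]
    nlinarith [sq_nonneg (‖ζ‖ * (‖grad u‖ * ‖toL2 v‖ - ‖grad v‖ * ‖toL2 u‖))]
  have h1 : ‖aForm ζ u v‖ ≤ ‖grad u‖ * ‖grad v‖ + ‖ζ‖ ^ 2 * (‖toL2 u‖ * ‖toL2 v‖) +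
      ‖ζ‖ * (‖trace Ω u‖ * ‖trace Ω v‖) := by
    refine (norm_add₃_le).trans ?_
    rw [bForm, norm_mul, norm_mul, norm_pow]
    gcongr
    · exact (norm_inner_le_norm _ _).trans_eq (mul_comm _ _)
    · exact (norm_inner_le_norm _ _).trans_eq (mul_comm _ _)
    · exact (norm_inner_le_norm _ _).trans_eq (mul_comm _ _)
  calc ‖aForm ζ u v‖ ≤ wnorm ‖ζ‖ u * wnorm ‖ζ‖ v + 2 * K * (wnorm ‖ζ‖ u * wnorm ‖ζ‖ v) := by
        linarith
    _ = _ := by ring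

/-- Fredholm alternative for `aForm ζ` on a closed subspace. -/
theorem exists_forall_aForm_eq_inner (h : IsStarDomain Ω c ρ M) {ζ : ℂ} (hζ : 0 ≤ ζ.re)
    {S : Submodule ℂ (H1 Ω)} (hS : IsClosed (S : Set (H1 Ω)))
    (hinj : ∀ u ∈ S, (∀ v ∈ S, aForm ζ u v = 0) → u = 0) (b : H1 Ω) :
    ∃ u ∈ S, ∀ v ∈ S, aForm ζ u v = inner ℂ v b := by
  simp only [← inner_formOp] at hinj ⊢
  refine exists_mem_forall_inner_eq (formOp Ω ζ) (toL2L Ω) h.isCompactOperator_toL2L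
    -- `ζ.im ^ 2` offsets the negative part of `Re ζ²`; the extra `1` supplies the `L²` part of the
    -- `H¹` norm.
    (c := 1) (C := ζ.im ^ 2 + 1) one_pos (fun u => ?_) hS hinj b
  rw [inner_formOp, re_aForm_self, norm_sq_H1, toL2L_apply]
  have h1 : 0 ≤ ζ.re * ‖trace Ω u‖ ^ 2 := by positivity
  have h2 : 0 ≤ ζ.re ^ 2 * ‖toL2 u‖ ^ 2 := by positivity
  linarith

/-- The Fredholm alternative on the whole space, with uniqueness applied to `conj ζ`, which lies in
the same half-plane. -/
theorem isAdjointSolution_adjointSolution (h : IsStarDomain Ω c ρ M) {ζ : ℂ} (hζ : 0 ≤ ζ.re)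
    (hζ1 : 1 ≤ ‖ζ‖) (f : L2 Ω) : IsAdjointSolution ζ f (adjointSolution ζ f) := by
  have hex : ∃ z : H1 Ω, IsAdjointSolution ζ f z := by
    obtain ⟨z, -, hz⟩ := h.exists_forall_aForm_eq_inner (ζ := conj ζ) (by simpa using hζ)
      (S := ⊤) isClosed_univ (fun u _ hu => h.eq_zero_of_aForm_eq_zero (ζ := conj ζ)
        (by simpa using hζ) (by simpa using hζ1) fun w => hu w trivial) ((toL2L Ω).adjoint f)
    refine ⟨z, fun w => ?_⟩
    rw [hz w trivial, ContinuousLinearMap.adjoint_inner_right]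
    rfl
  rw [adjointSolution, dif_pos hex]
  exact hex.choose_spec

variable {Cb : ℝ} {ζ : ℂ} {S : Submodule ℂ (H1 Ω)}

/-- Aubin–Nitsche duality estimate. -/
theorem ofReal_norm_toL2_le (h : IsStarDomain Ω c ρ M) (hCb : IsContinuityConstant Ω Cb)
    (hζ : 0 ≤ ζ.re) (hζ1 : 1 ≤ ‖ζ‖) {e : H1 Ω} (he : ∀ v ∈ S, aForm ζ e v = 0) :
    ENNReal.ofReal ‖toL2 e‖ ≤
      ENNReal.ofReal (1 + Cb) * eta ζ S * ENNReal.ofReal (wnorm ‖ζ‖ e) := by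
  rcases eq_or_ne (toL2 e) 0 with h0 | h0
  · simp [h0]
  have hC := h.one_le_of_isContinuityConstant hCb
  have hpos : 0 < ‖toL2 e‖ := norm_pos_iff.2 h0
  set z := adjointSolution ζ (toL2 e) with hz
  have hdual : aForm ζ e z = (‖toL2 e‖ ^ 2 : ℝ) := by
    have h1 := h.isAdjointSolution_adjointSolution hζ hζ1 (toL2 e) e
    rw [aForm_conj, inner_self_eq_norm_sq_to_K] at h1
    have h2 := congrArg conj h1
    rw [Complex.conj_conj] at h2
    rw [h2]
    simp
  have hv : ∀ v : S, ENNReal.ofReal ‖toL2 e‖ ≤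
      ENNReal.ofReal ((1 + Cb) * wnorm ‖ζ‖ e) *
        ENNReal.ofReal (wnorm ‖ζ‖ (z - (v : H1 Ω)) / ‖toL2 e‖) := by
    intro v
    have hw := wnorm_nonneg ‖ζ‖ e
    rw [← ENNReal.ofReal_mul (by positivity)]
    refine ENNReal.ofReal_le_ofReal ?_
    rw [← mul_div_assoc, le_div_iff₀ hpos, ← sq]
    calc ‖toL2 e‖ ^ 2 = ‖aForm ζ e (z - v)‖ := by
          rw [aForm_sub_right, he v v.2, sub_zero, hdual, Complex.norm_real,
            Real.norm_of_nonneg (by positivity)]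
      _ ≤ _ := hCb ζ hζ hζ1 e _
  have hinf : ENNReal.ofReal ‖toL2 e‖ ≤ ENNReal.ofReal ((1 + Cb) * wnorm ‖ζ‖ e) *
      ⨅ v : S, ENNReal.ofReal (wnorm ‖ζ‖ (z - (v : H1 Ω)) / ‖toL2 e‖) := by
    rw [ENNReal.mul_iInf fun h => absurd h ENNReal.ofReal_ne_top]
    exact le_iInf hv
  rw [mul_right_comm, ← ENNReal.ofReal_mul (by positivity)]
  refine hinf.trans (mul_le_mul' le_rfl ?_)
  exact le_iSup₂ (f := fun (f : L2 Ω) (_ : f ≠ 0) => ⨅ v : S,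
    ENNReal.ofReal (wnorm ‖ζ‖ (adjointSolution ζ f - (v : H1 Ω)) / ‖f‖)) (toL2 e) h0

/-- Quasi-optimality of functions orthogonal to `S`. -/
theorem wnorm_le_of_forall_aForm_eq_zero (h : IsStarDomain Ω c ρ M)
    (hCb : IsContinuityConstant Ω Cb) (hζ : 0 ≤ ζ.re) (hζ1 : 1 ≤ ‖ζ‖)
    (hη : ENNReal.ofReal (ζ.im ^ 2 / ‖ζ‖) * eta ζ S ≤ ENNReal.ofReal (1 / (4 * (1 + Cb))))
    {e y : H1 Ω} (he : ∀ v ∈ S, aForm ζ e v = 0) (hy : e - y ∈ S) :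
    wnorm ‖ζ‖ e ≤ 2 * (1 + Cb) * wnorm ‖ζ‖ y := by
  have hC := h.one_le_of_isContinuityConstant hCb
  have hw := wnorm_nonneg ‖ζ‖ e
  have hwy := wnorm_nonneg ‖ζ‖ y
  -- The duality estimate contributes `1 + Cb`, which cancels against the threshold and leaves
  -- `1/4`.
  have h1 : ζ.im ^ 2 / ‖ζ‖ * ‖toL2 e‖ ≤ wnorm ‖ζ‖ e / 4 := by
    rw [← ENNReal.ofReal_le_ofReal_iff (by positivity), ENNReal.ofReal_mul (by positivity)]
    calc ENNReal.ofReal (ζ.im ^ 2 / ‖ζ‖) * ENNReal.ofReal ‖toL2 e‖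
        ≤ ENNReal.ofReal (ζ.im ^ 2 / ‖ζ‖) *
          (ENNReal.ofReal (1 + Cb) * eta ζ S * ENNReal.ofReal (wnorm ‖ζ‖ e)) := by
          gcongr
          exact h.ofReal_norm_toL2_le hCb hζ hζ1 he
      _ = ENNReal.ofReal (1 + Cb) * (ENNReal.ofReal (ζ.im ^ 2 / ‖ζ‖) * eta ζ S) *
          ENNReal.ofReal (wnorm ‖ζ‖ e) := by ring
      _ ≤ ENNReal.ofReal (1 + Cb) * ENNReal.ofReal (1 / (4 * (1 + Cb))) *
          ENNReal.ofReal (wnorm ‖ζ‖ e) := by gcongr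
      _ = _ := by
          rw [← ENNReal.ofReal_mul (by positivity), ← ENNReal.ofReal_mul (by positivity)]
          congr 1
          field_simp
  have h2 : ζ.im ^ 2 * ‖toL2 e‖ ^ 2 ≤ wnorm ‖ζ‖ e / 4 * wnorm ‖ζ‖ e := by
    have hζ0 : ‖ζ‖ ≠ 0 := by positivity
    calc ζ.im ^ 2 * ‖toL2 e‖ ^ 2 = (ζ.im ^ 2 / ‖ζ‖ * ‖toL2 e‖) * (‖ζ‖ * ‖toL2 e‖) := by
          field_simp
      _ ≤ _ := by
          gcongr
          exact mul_norm_toL2_le_wnorm ‖ζ‖ e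
  have h3 := wnorm_sq_le hζ e
  -- Orthogonality to `e - y ∈ S`. With `h2`, twice the negative term is at most half of
  -- `‖e‖²_{|ζ|}` and is absorbed.
  have h4 : aForm ζ e e = aForm ζ e y := by
    rw [← sub_eq_zero, ← aForm_sub_right, he _ hy]
  rw [h4] at h3
  have h5 := (Complex.re_le_norm _).trans (hCb ζ hζ hζ1 e y)
  by_contra! hlt
  have hpos : 0 < wnorm ‖ζ‖ e := lt_of_le_of_lt (by positivity) hlt
  nlinarith

/-- Quasi-optimality with `y = 0` shows that an element of `S` orthogonal to `S` vanishes; this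
gives uniqueness and, by Fredholm, existence. -/
theorem existsUnique_isGalerkinSolution (h : IsStarDomain Ω c ρ M)
    (hCb : IsContinuityConstant Ω Cb) (hζ : 0 ≤ ζ.re) (hζ1 : 1 ≤ ‖ζ‖)
    (hS : IsClosed (S : Set (H1 Ω)))
    (hη : ENNReal.ofReal (ζ.im ^ 2 / ‖ζ‖) * eta ζ S ≤ ENNReal.ofReal (1 / (4 * (1 + Cb))))
    (u : H1 Ω) : ∃! uS : H1 Ω, IsGalerkinSolution ζ S u uS := by
  have hinj : ∀ s ∈ S, (∀ v ∈ S, aForm ζ s v = 0) → s = 0 := by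
    intro s hs hs0
    refine eq_zero_of_wnorm_eq_zero h.isOpen hζ1 ?_
    have := h.wnorm_le_of_forall_aForm_eq_zero hCb hζ hζ1 hη hs0 (y := 0) (by simpa using hs)
    rwa [wnorm_zero, mul_zero] at this
  obtain ⟨uS, huS, hsol⟩ := h.exists_forall_aForm_eq_inner hζ hS hinj (formOp Ω ζ u)
  refine ⟨uS, ⟨huS, fun v hv => ?_⟩, fun y hy => ?_⟩
  · rw [aForm_sub_left, hsol v hv, inner_formOp, sub_self]
  · refine sub_eq_zero.1 (hinj _ (S.sub_mem hy.1 huS) fun v hv => ?_)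
    have h1 := hy.2 v hv
    rw [aForm_sub_left] at h1 ⊢
    rw [hsol v hv, inner_formOp]
    linear_combination -h1

end IsStarDomain

end HelmholtzRobin

theorem mainTheorem10 (Ω : Set HelmholtzRobin.E3) (hΩ : HelmholtzRobin.IsAdmissibleDomain Ω) :
    (∃ Cb : ℝ, 0 ≤ Cb ∧ HelmholtzRobin.IsContinuityConstant Ω Cb) ∧
    ∀ Cb : ℝ, HelmholtzRobin.IsContinuityConstant Ω Cb →
      ∀ ζ : ℂ, 0 ≤ ζ.re → 1 ≤ ‖ζ‖ →
      ∀ S : Submodule ℂ (HelmholtzRobin.H1 Ω), IsClosed (S : Set (HelmholtzRobin.H1 Ω)) →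
        ENNReal.ofReal (ζ.im ^ 2 / ‖ζ‖) * HelmholtzRobin.eta ζ S
            ≤ ENNReal.ofReal (1 / (4 * (1 + Cb))) →
        ∀ u : HelmholtzRobin.H1 Ω,
          (∃! uS : HelmholtzRobin.H1 Ω, HelmholtzRobin.IsGalerkinSolution ζ S u uS) ∧
          ∀ uS : HelmholtzRobin.H1 Ω, HelmholtzRobin.IsGalerkinSolution ζ S u uS →
            HelmholtzRobin.wnorm ‖ζ‖ (u - uS)
                ≤ 2 * (1 + Cb) * ⨅ v : S, HelmholtzRobin.wnorm ‖ζ‖ (u - (v : HelmholtzRobin.H1 Ω)) ∧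
            ENNReal.ofReal ‖HelmholtzRobin.toL2 (u - uS)‖
                ≤ ENNReal.ofReal (1 + Cb) * HelmholtzRobin.eta ζ S
                    * ENNReal.ofReal (HelmholtzRobin.wnorm ‖ζ‖ (u - uS)) := by
  obtain ⟨c, ρ, M, h⟩ := hΩ.exists_isStarDomain
  refine ⟨h.exists_isContinuityConstant, fun Cb hCb ζ hζ hζ1 S hS hη u =>
    ⟨h.existsUnique_isGalerkinSolution hCb hζ hζ1 hS hη u, fun uS huS =>
      ⟨?_, h.ofReal_norm_toL2_le hCb hζ hζ1 huS.2⟩⟩⟩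
  have hC := h.one_le_of_isContinuityConstant hCb
  -- For each `v ∈ S` take `y = u - v`; then `(u - uS) - y = v - uS` lies in `S`.
  rw [Real.mul_iInf_of_nonneg (by positivity)]
  refine le_ciInf fun v => h.wnorm_le_of_forall_aForm_eq_zero hCb hζ hζ1 hη huS.2 ?_
  rw [sub_sub_sub_cancel_left]
  exact S.sub_mem v.2 huS.1
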